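/- Let $n\ge 2$, let $\Omega\subset\mathbb R^n$ be a bounded domain (nonempty, open, connected) with smooth boundary, and let $\Gamma$ be a domain with smooth boundary such that $\overline\Gamma\subset\Omega$ and $\Omega\setminus\overline\Gamma$ is connected. For $j=1,2$ let $g_j\in C^\infty(\overline\Omega;\mathbb R^{n\times n})$ be a Riemannian metric that is uniformly elliptic, i.e. $\lambda_j|\xi|^2\le (g_j)_{kl}(x)\xi^k\xi^l\le\lambda_j^{-1}|\xi|^2$ for all $x\in\Omega$, $\xi\in\mathbb R^n$ and some $\lambda_j\in(0,1)$, and let $0\le V_j\in C^\infty(\overline\Omega)$. All functions are real-valued. *The partial Neumann-to-Dirichlet map.* For such $(g,V)$ let $\widetilde g=g_{kl}\,dx^k\otimes dx^l+dy\otimes dy$ on $\Omega\times(0,\infty)$, so that $\Delta_{\widetilde g}=\Delta_g+\partial_y^2$, and let $dV_g=|g|^{1/2}dx$ and $dV_{\widetilde g}=|g|^{1/2}dx\,dy$, where $|g|=\det g$. Let $H^1_0(\Omega\times[0,\infty))$ be the closure of $C^1_c(\Omega\times[0,\infty))$ in $H^1(\Omega\times(0,\infty))$. For $f\in C_c^\infty(\Gamma)$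 let $u_f\in H^1_0(\Omega\times[0,\infty))$ be the unique weak solution of $$(-\Delta_{\widetilde g}+V)u=0\ \text{ in }\Omega\times(0,\infty),\qquad -\partial_yu=f\ \text{ on }\Omega\times\{0\},\qquad u=0\ \text{ on }\partial\Omega\times(0,\infty),$$ that is, $\int_{\Omega\times(0,\infty)}(du_f\cdot d\varphi+Vu_f\varphi)\,dV_{\widetilde g}=\int_\Omega f\,\varphi|_{y=0}\,dV_g$ for all $\varphi\in H^1_0(\Omega\times[0,\infty))$, where the dot is the inner product of $1$-forms given by $\widetilde g$ and $\varphi|_{y=0}$ is the trace. Put $\Lambda^\Gamma_{g,V}f=u_f|_{\Gamma\times\{0\}}$. *The local source-to-solution map.* Let $\mathsf P_{g,V}=-\Delta_g+V$ with homogeneous Dirichlet condition on $\partial\Omega$, let $(\phi_k)_{k\in\mathbb N}\subset H^1_0(\Omega)$ be a Hilbert basis of $L^2(\Omega,dV_g)$ of eigenfunctions of $\mathsf P_{g,V}$ with eigenvalues $\lambda_k>0$, and write $u_k=\langle u,\phi_k\rangle_{L^2(\Omega,dV_g)}$. For $f\in C_c^\infty(\Gamma)$ let $v^f$ be the unique weak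 solution of $\mathsf P_{g,V}^{1/2}v=f$ in $\Omega$, $v=0$ on $\partial\Omega$, that is, $v^f\in\widetilde H^{1/2}_{g,V}(\Omega)=\{u\in L^2(\Omega,dV_g):\sum_k\lambda_k^{1/2}|u_k|^2<\infty\}$ and $\sum_k\lambda_k^{1/2}(v^f)_kw_k=\int_\Omega fw\,dV_g$ for all $w\in\widetilde H^{1/2}_{g,V}(\Omega)$. Put $\mathcal S^\Gamma_{g,V}f=v^f|_\Gamma\in L^2(\Gamma)$. **Claim.** If $$\Lambda^\Gamma_{g_1,V_1}f=\Lambda^\Gamma_{g_2,V_2}f\ \text{ on }\Gamma\quad\text{for all }f\in C_c^\infty(\Gamma),$$ then $$\mathcal S^\Gamma_{g_1,V_1}f=\mathcal S^\Gamma_{g_2,V_2}f\quad\text{for all }f\in C_c^\infty(\Gamma).$$ -/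

import Mathlib

open MeasureTheory Filter Topology
open scoped ContDiff ENNReal

noncomputable section

namespace TransversalND

/-! ### Domains, test functions, Sobolev spaces -/

/-- `ℝⁿ` with its Euclidean norm. -/
abbrev Space (n : ℕ) : Type := EuclideanSpace ℝ (Fin n)

/-- A smooth domain of `ℝⁿ`: a nonempty open connected set that near each of its boundary points
is the strict sublevel set of a smooth function with nonvanishing differential. -/
structure IsSmoothDomain {n : ℕ} (Ω : Set (Space n)) : Prop where
  isOpen : IsOpen Ω
  isConnected : IsConnected Ω
  smooth_boundary : ∀ p ∈ frontier Ω, ∃ U : Set (Space n), IsOpen U ∧ p ∈ U ∧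
    ∃ ρ : Space n → ℝ, ContDiffOn ℝ ∞ ρ U ∧ fderiv ℝ ρ p ≠ 0 ∧ ∀ x ∈ U, (x ∈ Ω ↔ ρ x < 0)

section Sobolev

variable {F : Type*} [NormedAddCommGroup F] [NormedSpace ℝ F] [MeasureSpace F]

/-- `C_c^k(U)`: functions of class `C^k` with compact support contained in `U`. -/
def CompactlySupported (k : WithTop ℕ∞) (U : Set F) : Set (F → ℝ) :=
  {φ | ContDiff ℝ k φ ∧ HasCompactSupport φ ∧ tsupport φ ⊆ U}

/-- `Du` is the weak (distributional) differential of `u` on the open set `U`. -/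
def IsWeakDifferential (U : Set F) (u : F → ℝ) (Du : F → F →L[ℝ] ℝ) : Prop :=
  ∀ ψ ∈ CompactlySupported ∞ U, ∀ e : F,
    ∫ z in U, u z * fderiv ℝ ψ z e = - ∫ z in U, Du z e * ψ z

/-- `u ∈ H¹(U)`, with weak differential `Du`. -/
structure IsH1 (U : Set F) (u : F → ℝ) (Du : F → F →L[ℝ] ℝ) : Prop where
  memLp : MemLp u 2 (volume.restrict U)
  memLp_diff : MemLp Du 2 (volume.restrict U)
  isWeakDifferential : IsWeakDifferential U u Du

/-- The sequence `φ k` of `C¹` functions converges to `u` (with differential `Du`) in `H¹(U)`. -/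
def TendstoH1 (U : Set F) (φ : ℕ → F → ℝ) (u : F → ℝ) (Du : F → F →L[ℝ] ℝ) : Prop :=
  Tendsto (fun k => eLpNorm (fun z => φ k z - u z) 2 (volume.restrict U)) atTop (𝓝 0) ∧
  Tendsto (fun k => eLpNorm (fun z => fderiv ℝ (φ k) z - Du z) 2 (volume.restrict U))
    atTop (𝓝 0)

/-- `u` (with differential `Du`) lies in the closure in `H¹(U)` of the class `C` of
`C¹` functions. -/
def MemH1Closure (U : Set F) (C : Set (F → ℝ)) (u : F → ℝ) (Du : F → F →L[ℝ] ℝ) : Prop :=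
  IsH1 U u Du ∧ ∃ φ : ℕ → F → ℝ, (∀ k, φ k ∈ C) ∧ TendstoH1 U φ u Du

end Sobolev

/-- `u ∈ H¹₀(Ω)`, the closure of `C_c^∞(Ω)` in `H¹(Ω)`. -/
def MemH10 {n : ℕ} (Ω : Set (Space n)) (u : Space n → ℝ)
    (Du : Space n → Space n →L[ℝ] ℝ) : Prop :=
  MemH1Closure Ω (CompactlySupported ∞ Ω) u Du

/-- The open half-cylinder `Ω × (0,∞)`. -/
def halfCylinder {n : ℕ} (Ω : Set (Space n)) : Set (Space n × ℝ) := Ω ×ˢ Set.Ioi 0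

/-- `C_c^1(Ω × [0,∞))`, given through the `C¹` extensions of its members across `y = 0`: the
functions of class `C¹` with compact support in `Ω × ℝ` (of which only the restriction to
`y ≥ 0` is used). -/
def HalfCylinderTest {n : ℕ} (Ω : Set (Space n)) : Set (Space n × ℝ → ℝ) :=
  CompactlySupported 1 (Ω ×ˢ Set.univ)

/-- `u ∈ H¹₀(Ω × [0,∞))`, the closure of `C_c^1(Ω × [0,∞))` in `H¹(Ω × (0,∞))`: no condition is
imposed on the bottom `Ω × {0}`. -/
def MemH10Cyl {n : ℕ} (Ω : Set (Space n)) (u : Space n × ℝ → ℝ)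
    (Du : Space n × ℝ → Space n × ℝ →L[ℝ] ℝ) : Prop :=
  MemH1Closure (halfCylinder Ω) (HalfCylinderTest Ω) u Du

/-- `w ∈ L²(Ω)` is the trace on `Ω × {0}` of `u ∈ H¹₀(Ω × [0,∞))`: the extension by continuity of
the restriction `φ ↦ φ(·,0)` of functions in `C_c^1(Ω × [0,∞))`. -/
def HasBottomTrace {n : ℕ} (Ω : Set (Space n)) (u : Space n × ℝ → ℝ)
    (Du : Space n × ℝ → Space n × ℝ →L[ℝ] ℝ) (w : Space n → ℝ) : Prop :=
  MemLp w 2 (volume.restrict Ω) ∧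
  ∃ φ : ℕ → Space n × ℝ → ℝ, (∀ k, φ k ∈ HalfCylinderTest Ω) ∧
    TendstoH1 (halfCylinder Ω) φ u Du ∧
    Tendsto (fun k => eLpNorm (fun x => φ k (x, 0) - w x) 2 (volume.restrict Ω)) atTop (𝓝 0)

/-! ### Riemannian metrics -/

/-- `g ∈ C^∞(Ω̄; ℝⁿˣⁿ)` is a Riemannian metric, uniformly elliptic on `Ω`. -/
structure IsEllipticMetric {n : ℕ} (Ω : Set (Space n))
    (g : Space n → Matrix (Fin n) (Fin n) ℝ) : Prop where
  smooth : ∀ i j, ContDiffOn ℝ ∞ (fun x => g x i j) (closure Ω)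
  symm : ∀ x ∈ closure Ω, (g x).IsSymm
  elliptic : ∃ lam : ℝ, 0 < lam ∧ lam < 1 ∧ ∀ x ∈ Ω, ∀ ξ : Space n,
    lam * ‖ξ‖ ^ 2 ≤ ∑ i, ∑ j, g x i j * ξ i * ξ j ∧
    ∑ i, ∑ j, g x i j * ξ i * ξ j ≤ lam⁻¹ * ‖ξ‖ ^ 2

/-- `V ∈ C^∞(Ω̄)` is a nonnegative potential. -/
structure IsPotential {n : ℕ} (Ω : Set (Space n)) (V : Space n → ℝ) : Prop where
  smooth : ContDiffOn ℝ ∞ V (closure Ω)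
  nonneg : ∀ x ∈ closure Ω, 0 ≤ V x

section Riemannian

variable {F : Type*} [NormedAddCommGroup F] [NormedSpace ℝ F] [MeasureSpace F]
  {ι : Type*} [Fintype ι] [DecidableEq ι]

/-- The Riemannian measure `dV_h = |h|^{1/2} dx` on `U`, where `|h| = det h`. -/
def riemannianMeasure (h : F → Matrix ι ι ℝ) (U : Set F) : Measure F :=
  (volume.restrict U).withDensity fun z => ENNReal.ofReal (Real.sqrt (h z).det)

/-- The bilinear form `∫_U (du · dφ + V u φ) dV_h` of `-Δ_h + V`, where
`du · dφ = h^{ij} ∂_i u ∂_j φ` and `∂_i` is the derivative along the coordinate vector `e i`. -/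
def bilinearForm (e : ι → F) (h : F → Matrix ι ι ℝ) (V : F → ℝ) (U : Set F)
    (u : F → ℝ) (Du : F → F →L[ℝ] ℝ) (φ : F → ℝ) (Dφ : F → F →L[ℝ] ℝ) : ℝ :=
  ∫ z, ((∑ i, ∑ j, (h z)⁻¹ i j * Du z (e i) * Dφ z (e j)) + V z * u z * φ z)
    ∂(riemannianMeasure h U)

end Riemannian

/-- The coordinate vectors of `ℝⁿ`. -/
def coordVec (n : ℕ) (i : Fin n) : Space n := EuclideanSpace.single i 1

/-- The coordinate vectors of `ℝⁿ × ℝ`; the last one is the `y`-direction. -/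
def coordVecCyl (n : ℕ) : Fin n ⊕ Unit → Space n × ℝ :=
  Sum.elim (fun i => (coordVec n i, 0)) (fun _ => (0, 1))

/-- The extended metric `g̃ = g_{ij} dx^i ⊗ dx^j + dy ⊗ dy`. -/
def extendedMetric {n : ℕ} (g : Space n → Matrix (Fin n) (Fin n) ℝ) (z : Space n × ℝ) :
    Matrix (Fin n ⊕ Unit) (Fin n ⊕ Unit) ℝ :=
  Matrix.fromBlocks (g z.1) 0 0 1

/-! ### The partial Neumann-to-Dirichlet map -/

/-- `u ∈ H¹₀(Ω × [0,∞))` is the weak solution of `(-Δ_{g̃} + V) u = 0` in `Ω × (0,∞)`,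
`-∂_y u = f` on `Ω × {0}`, `u = 0` on `∂Ω × (0,∞)`. -/
def IsExtensionSolution {n : ℕ} (Ω : Set (Space n)) (g : Space n → Matrix (Fin n) (Fin n) ℝ)
    (V : Space n → ℝ) (f : Space n → ℝ) (u : Space n × ℝ → ℝ)
    (Du : Space n × ℝ → Space n × ℝ →L[ℝ] ℝ) : Prop :=
  MemH10Cyl Ω u Du ∧
  ∀ (φ : Space n × ℝ → ℝ) (Dφ : Space n × ℝ → Space n × ℝ →L[ℝ] ℝ) (w : Space n → ℝ),
    MemH10Cyl Ω φ Dφ → HasBottomTrace Ω φ Dφ w →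
    bilinearForm (coordVecCyl n) (extendedMetric g) (fun z => V z.1) (halfCylinder Ω) u Du φ Dφ
      = ∫ x, f x * w x ∂(riemannianMeasure g Ω)

/-- `w = u_f|_{y=0}` for the weak solution `u_f` of the mixed problem with Neumann data `f`. -/
def IsNDValue {n : ℕ} (Ω : Set (Space n)) (g : Space n → Matrix (Fin n) (Fin n) ℝ)
    (V : Space n → ℝ) (f w : Space n → ℝ) : Prop :=
  ∃ (u : Space n × ℝ → ℝ) (Du : Space n × ℝ → Space n × ℝ →L[ℝ] ℝ),
    IsExtensionSolution Ω g V f u Du ∧ HasBottomTrace Ω u Du w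

open Classical in
/-- The Neumann-to-Dirichlet map `f ↦ u_f|_{y=0}`. The trace is unique up to a null set; the
partial map on `Γ` takes `f ∈ C_c^∞(Γ)` and restricts the result to `Γ`. -/
def ndMap {n : ℕ} (Ω : Set (Space n)) (g : Space n → Matrix (Fin n) (Fin n) ℝ)
    (V : Space n → ℝ) (f : Space n → ℝ) : Space n → ℝ :=
  if h : ∃ w, IsNDValue Ω g V f w then h.choose else 0

/-! ### Fractional powers and the source-to-solution map -/

/-- `L²(Ω, dV_g)`. -/
abbrev L2g {n : ℕ} (Ω : Set (Space n)) (g : Space n → Matrix (Fin n) (Fin n) ℝ) : Type :=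
  Lp ℝ 2 (riemannianMeasure g Ω)

/-- `b` is a Hilbert basis of `L²(Ω, dV_g)` consisting of Dirichlet eigenfunctions of
`P_{g,V} = -Δ_g + V`, with eigenvalues `lam k`: `b k ∈ H¹₀(Ω)` and `P_{g,V} (b k) = lam k • b k`
weakly. -/
structure IsDirichletEigenbasis {n : ℕ} (Ω : Set (Space n))
    (g : Space n → Matrix (Fin n) (Fin n) ℝ) (V : Space n → ℝ)
    (b : HilbertBasis ℕ ℝ (L2g Ω g)) (lam : ℕ → ℝ) : Prop where
  pos : ∀ k, 0 < lam k
  eigen : ∀ k, ∃ Db : Space n → Space n →L[ℝ] ℝ, MemH10 Ω (b k) Db ∧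
    ∀ (ψ : Space n → ℝ) (Dψ : Space n → Space n →L[ℝ] ℝ), MemH10 Ω ψ Dψ →
      bilinearForm (coordVec n) g V Ω (b k) Db ψ Dψ
        = lam k * ∫ x, b k x * ψ x ∂(riemannianMeasure g Ω)

/-- `u ∈ H̃^r_{g,V}(Ω)`: `∑ λ_k^r |u_k|² < ∞`, where `u = ∑ u_k φ_k`. -/
def MemSpectralSobolev {n : ℕ} {Ω : Set (Space n)} {g : Space n → Matrix (Fin n) (Fin n) ℝ}
    (b : HilbertBasis ℕ ℝ (L2g Ω g)) (lam : ℕ → ℝ) (r : ℝ) (u : L2g Ω g) : Prop :=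
  Summable fun k => lam k ^ r * (b.repr u k) ^ 2

/-- `v` is the weak solution of `P_{g,V}^s v = f` in `Ω`, `v = 0` on `∂Ω`: `v ∈ H̃^s_{g,V}(Ω)` and
`⟨v, w⟩_{H̃^s} = ∑ λ_k^s v_k w_k = ∫_Ω f w dV_g` for all `w ∈ H̃^s_{g,V}(Ω)`. -/
def IsFractionalSolution {n : ℕ} (Ω : Set (Space n)) (g : Space n → Matrix (Fin n) (Fin n) ℝ)
    (V : Space n → ℝ) (s : ℝ) (f : Space n → ℝ) (v : L2g Ω g) : Prop :=
  ∃ (b : HilbertBasis ℕ ℝ (L2g Ω g)) (lam : ℕ → ℝ),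
    IsDirichletEigenbasis Ω g V b lam ∧ MemSpectralSobolev b lam s v ∧
    ∀ w : L2g Ω g, MemSpectralSobolev b lam s w →
      HasSum (fun k => lam k ^ s * b.repr v k * b.repr w k)
        (∫ x, f x * w x ∂(riemannianMeasure g Ω))

open Classical in
/-- The source-to-solution map `f ↦ v^f` of `P_{g,V}^{1/2} v = f` in `Ω`. The local map on `Γ`
takes `f ∈ C_c^∞(Γ)` and restricts the result to `Γ`. -/
def sourceToSolution {n : ℕ} (Ω : Set (Space n)) (g : Space n → Matrix (Fin n) (Fin n) ℝ)
    (V : Space n → ℝ) (f : Space n → ℝ) : L2g Ω g :=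
  if h : ∃ v, IsFractionalSolution Ω g V (1 / 2) f v then h.choose else 0

end TransversalND

end

namespace TransversalND

/-! ### Coercive forms and compact operators on Hilbert spaces -/

section Hilbert

open scoped InnerProductSpace

variable {X Y : Type*} [NormedAddCommGroup X] [InnerProductSpace ℝ X]
  [NormedAddCommGroup Y] [InnerProductSpace ℝ Y]

/-! For a single pair (g, V) the two maps coincide on all of Ω: the trace at y = 0 of the extension
u_f is P^{-1/2} f. The two metrics therefore never have to be compared with each other; the assumed
identity on Γ is turned into the claimed one by substitution.

The reason is a duality. If φ_k is a Dirichlet eigenfunction with eigenvalue λ_k, then e^{-√λ_k y}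
φ_k is a finite-energy solution on the half-cylinder with Neumann datum √λ_k φ_k. Pair it with u_f
in the symmetric energy form. The weak equation of u_f evaluates the pairing as ∫ f φ_k dV_g, and
the equation of the decaying extension evaluates it as √λ_k ⟨φ_k, u_f|_{y=0}⟩. Hence the trace has
coefficients λ_k^{-1/2} f_k, and these characterise the solution of P^{1/2} v = f. The decaying
extension is built in `exists_tensor_mem_closure`, its equation is
`integral_energyDensity_tensorJet`, and the pairing is made in `IsNDValue.exists_coefficients`.

Both maps are choices from existence statements with default value 0, so existence has to be proved.
The Poincaré inequality and Lax–Milgram give u_f (`exists_isNDValue`); Rellich compactness and the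
spectral theorem give an eigenbasis (`exists_dirichletEigenbasis`).

Throughout, a function with its weak differential is stored as one element of L² of 1-jets with
respect to dV_g, and H¹₀ becomes the closure of the jets of test functions. On the half-cylinder
each jet is paired with its bottom value, so that the closure consists of functions together with
their traces. Ellipticity makes dV_g comparable to Lebesgue measure, hence the closures taken in
Lebesgue norms are the same. -/

theorem coercive_topologicalClosure {B : X →L[ℝ] X →L[ℝ] ℝ} {S : Submodule ℝ X} {c : ℝ}
    (hB : ∀ x ∈ S, c * ‖x‖ ^ 2 ≤ B x x) : ∀ x ∈ S.topologicalClosure, c * ‖x‖ ^ 2 ≤ B x x := by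
  intro x hx
  have hcl : IsClosed {x : X | c * ‖x‖ ^ 2 ≤ B x x} :=
    isClosed_le (by fun_prop) (by fun_prop)
  exact closure_minimal (fun y hy => hB y hy) hcl hx

/-- The solution operator of a coercive problem posed on the closure of a subspace. -/
theorem exists_solutionOperator [CompleteSpace X] [CompleteSpace Y] (B : X →L[ℝ] X →L[ℝ] ℝ)
    (S : Submodule ℝ X) {c : ℝ} (hc : 0 < c)
    (hB : ∀ x ∈ S, c * ‖x‖ ^ 2 ≤ B x x) (T : X →L[ℝ] Y) :
    ∃ R : Y →L[ℝ] X, (∀ y, R y ∈ S.topologicalClosure) ∧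
      ∀ y, ∀ v ∈ S.topologicalClosure, B (R y) v = ⟪y, T v⟫_ℝ := by
  set H := S.topologicalClosure with hH
  have : CompleteSpace H := S.isClosed_topologicalClosure.completeSpace_coe
  let BH : H →L[ℝ] H →L[ℝ] ℝ := B.bilinearComp H.subtypeL H.subtypeL
  have hBH : IsCoercive BH := by
    refine ⟨c, hc, fun u => ?_⟩
    have := coercive_topologicalClosure hB u u.2
    calc c * ‖u‖ * ‖u‖ = c * ‖(u : X)‖ ^ 2 := by rw [Submodule.coe_norm]; ring
      _ ≤ _ := this
  -- The adjoint of `Th` represents the functional v ↦ ⟪y, T v⟫ on H, and the Lax–Milgram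
  -- equivalence inverts the form.
  let Th : H →L[ℝ] Y := T ∘L H.subtypeL
  let R0 : Y →L[ℝ] H := (hBH.continuousLinearEquivOfBilin.symm : H →L[ℝ] H) ∘L Th.adjoint
  refine ⟨H.subtypeL ∘L R0, fun y => (R0 y).2, fun y v hv => ?_⟩
  have h1 := hBH.continuousLinearEquivOfBilin_apply (R0 y) ⟨v, hv⟩
  have h2 : hBH.continuousLinearEquivOfBilin (R0 y) = Th.adjoint y := by simp [R0]
  rw [h2, ContinuousLinearMap.adjoint_inner_left] at h1
  exact h1.symm

/-- An operator whose restriction to the closure of `S` is approximated on `S` by finite-dimensional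
subspaces is compact on this closure. -/
theorem isCompactOperator_of_finiteDimensional_approx [CompleteSpace Y] (T : X →L[ℝ] Y)
    (S : Submodule ℝ X)
    (h : ∀ ε > (0 : ℝ), ∃ W : Submodule ℝ Y, FiniteDimensional ℝ W ∧
      ∀ x ∈ S, ∃ w ∈ W, ‖T x - w‖ ≤ ε * ‖x‖) :
    IsCompactOperator (T ∘L S.topologicalClosure.subtypeL) := by
  choose! W hWfin hW using h
  set H := S.topologicalClosure
  -- Replacing the approximant by the orthogonal projection makes it linear in x and keeps the error
  -- bound; the inequality is then a closed condition and passes from S to its closure.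
  have key : ∀ ε > (0 : ℝ), ∀ x ∈ H, ∀ _ : FiniteDimensional ℝ (W ε),
      ‖T x - (W ε).starProjection (T x)‖ ≤ ε * ‖x‖ := by
    intro ε hε x hx _
    have hcl : IsClosed {x : X | ‖T x - (W ε).starProjection (T x)‖ ≤ ε * ‖x‖} :=
      isClosed_le (by fun_prop) (by fun_prop)
    refine closure_minimal (fun y hy => ?_) hcl hx
    obtain ⟨w, hw, hle⟩ := hW ε hε y hy
    refine le_trans ?_ hle
    rw [Submodule.starProjection_minimal]
    exact ciInf_le ⟨0, by rintro _ ⟨_, rfl⟩; positivity⟩ (⟨w, hw⟩ : W ε)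
  let e : ℕ → ℝ := fun k => 1 / ((k : ℝ) + 1)
  have he : ∀ k, 0 < e k := fun k => by positivity
  have hf : ∀ k, FiniteDimensional ℝ (W (e k)) := fun k => hWfin _ (he k)
  let P : ℕ → (H →L[ℝ] Y) := fun k => (W (e k)).starProjection ∘L (T ∘L H.subtypeL)
  refine isCompactOperator_of_tendsto (l := atTop) (F := P) ?_ (Eventually.of_forall fun k => ?_)
  · rw [tendsto_iff_norm_sub_tendsto_zero]
    refine squeeze_zero (fun _ => norm_nonneg _) (fun k => ?_)
      (tendsto_one_div_add_atTop_nhds_zero_nat (𝕜 := ℝ))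
    refine ContinuousLinearMap.opNorm_le_bound _ (he k).le fun x => ?_
    have := key (e k) (he k) x x.2 (hf k)
    rw [← norm_neg]
    simpa [P, e] using this
  · have h1 : P k = (W (e k)).subtypeL ∘L
        ((W (e k)).orthogonalProjectionOnto ∘L (T ∘L H.subtypeL)) := by
      ext x; rfl
    rw [h1]
    have : LocallyCompactSpace (W (e k)) := by
      have := FiniteDimensional.proper_real (W (e k))
      infer_instance
    exact (isCompactOperator_of_locallyCompactSpace_dom
      ((W (e k)).orthogonalProjectionOnto ∘L (T ∘L H.subtypeL))).clm_comp (W (e k)).subtypeL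

/-- Orthonormal vectors lie at mutual distance √2, so the balls of radius 1/2 around them are
disjoint, and a separable space holds only countably many. This is one half of indexing an
eigenbasis by ℕ. -/
theorem countable_of_orthonormal [SecondCountableTopology Y] {κ : Type*} {v : κ → Y}
    (hv : Orthonormal ℝ v) : Countable κ := by
  have hdist : ∀ i j, i ≠ j → ‖v i - v j‖ ^ 2 = 2 := by
    intro i j hij
    rw [norm_sub_sq_real, hv.1 i, hv.1 j, hv.2 hij]; norm_num
  refine Pairwise.countable_of_isOpen_disjoint (s := fun i => Metric.ball (v i) (1 / 2)) ?_
    (fun i => Metric.isOpen_ball) (fun i => ⟨v i, Metric.mem_ball_self (by norm_num)⟩)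
  intro i j hij
  refine Metric.ball_disjoint_ball ?_
  rw [dist_eq_norm]
  nlinarith [hdist i j hij, norm_nonneg (v i - v j)]

/-- The spectral theorem for an injective compact symmetric operator on a separable
infinite-dimensional Hilbert space. -/
theorem exists_hilbertBasis_eigenvectors [CompleteSpace Y] [SecondCountableTopology Y]
    (hY : ¬ FiniteDimensional ℝ Y) (A : Y →L[ℝ] Y) (hA : IsCompactOperator A)
    (hs : A.IsSymmetric) :
    ∃ (b : HilbertBasis ℕ ℝ Y) (μ : ℕ → ℝ), ∀ k, A (b k) = μ k • b k := by
  -- All real μ are allowed, the kernel of A included; that the eigenvalues are positive in the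
  -- application is shown in `exists_eigenbasis`.
  let G : ℝ → Submodule ℝ Y := fun μ => Module.End.eigenspace (A : Module.End ℝ Y) μ
  have hcomp : ∀ μ, CompleteSpace (G μ) := fun μ => by
    have : IsClosed (G μ : Set Y) := by
      have : (G μ : Set Y) = {y | A y = μ • y} := by
        ext y; simp [G]
      rw [this]
      exact isClosed_eq (by fun_prop) (by fun_prop)
    exact this.completeSpace_coe
  choose w b hb using fun μ => exists_hilbertBasis ℝ (G μ)
  have hfam := hs.orthogonalFamily_eigenspaces
  have horth : ∀ μ, Orthonormal ℝ (fun x : w μ => (x : G μ)) := fun μ => by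
    have := (b μ).orthonormal
    rwa [hb μ] at this
  have hon : Orthonormal ℝ (fun a : Σ μ, w μ => ((a.2 : G a.1) : Y)) :=
    hfam.orthonormal_sigma_orthonormal horth
  -- A vector orthogonal to the chosen basis of every eigenspace is orthogonal to the eigenspaces
  -- themselves, by density and closedness, hence vanishes by the spectral theorem.
  have hbot : (Submodule.span ℝ (Set.range (fun a : Σ μ, w μ => ((a.2 : G a.1) : Y))))ᗮ = ⊥ := by
    rw [Submodule.eq_bot_iff]
    intro y hy
    have hmem : y ∈ (⨆ μ, G μ)ᗮ := by
      have hle : (⨆ μ, G μ) ≤ (ℝ ∙ y)ᗮ := iSup_le fun μ g hg => by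
        let K : Submodule ℝ (G μ) := (ℝ ∙ y)ᗮ.comap (G μ).subtype
        have hKcl : IsClosed (K : Set (G μ)) :=
          (Submodule.isClosed_orthogonal _).preimage continuous_subtype_val
        have hK : (⊤ : Submodule ℝ (G μ)) ≤ K := by
          rw [← (b μ).dense_span]
          refine Submodule.topologicalClosure_minimal _ (Submodule.span_le.2 ?_) hKcl
          rintro _ ⟨i, rfl⟩
          rw [hb μ]
          refine Submodule.mem_orthogonal_singleton_iff_inner_left.2 ?_
          exact hy _ (Submodule.subset_span ⟨⟨μ, i⟩, rfl⟩)
        exact hK (x := ⟨g, hg⟩) trivial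
      exact fun z hz => Submodule.mem_orthogonal_singleton_iff_inner_left.1 (hle hz)
    rwa [ContinuousLinearMap.orthogonalComplement_iSup_eigenspaces_eq_bot hA hs] at hmem
  let c := HilbertBasis.mkOfOrthogonalEqBot hon hbot
  have hc : Countable (Σ μ, w μ) := countable_of_orthonormal hon
  have hinf : Infinite (Σ μ, w μ) := by
    by_contra hfin
    rw [not_infinite_iff_finite] at hfin
    have := Fintype.ofFinite (Σ μ, w μ)
    exact hY c.toOrthonormalBasis.toBasis.finiteDimensional_of_finite
  -- The index set is countable by separability and infinite because Y is not finite-dimensional.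
  obtain ⟨e⟩ := nonempty_equiv_of_countable (α := ℕ) (β := Σ μ, w μ)
  have hce : ∀ a, c a = ((a.2 : G a.1) : Y) := fun a => by simp [c]
  have hon' : Orthonormal ℝ (fun k => c (e k)) := c.orthonormal.comp _ e.injective
  have hbot' : (Submodule.span ℝ (Set.range (fun k => c (e k))))ᗮ = ⊥ := by
    have : Set.range (fun k => c (e k)) = Set.range (fun a : Σ μ, w μ => ((a.2 : G a.1) : Y)) := by
      rw [← funext hce]
      exact e.surjective.range_comp c
    rw [this, hbot]
  refine ⟨HilbertBasis.mkOfOrthogonalEqBot hon' hbot', fun k => (e k).1, fun k => ?_⟩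
  rw [HilbertBasis.coe_mkOfOrthogonalEqBot]
  simp only [hce]
  exact Module.End.mem_eigenspace_iff.1 ((e k).2 : G (e k).1).2

/-- The eigenvectors are those of A = T R, with R the solution operator: A is compact because T is
compact on the closure of S, and symmetric because B is. The eigenvalue of A at b_k is the energy
B(R b_k, R b_k) > 0; `lam k` is its inverse and x_k the rescaled solution R b_k. -/
theorem exists_eigenbasis [CompleteSpace X] [CompleteSpace Y] [SecondCountableTopology Y]
    (hY : ¬ FiniteDimensional ℝ Y)
    (B : X →L[ℝ] X →L[ℝ] ℝ) (hBs : ∀ x y, B x y = B y x) (S : Submodule ℝ X) {c : ℝ} (hc : 0 < c)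
    (hB : ∀ x ∈ S, c * ‖x‖ ^ 2 ≤ B x x) (T : X →L[ℝ] Y)
    (hT : IsCompactOperator (T ∘L S.topologicalClosure.subtypeL))
    (hdense : ∀ y : Y, (∀ x ∈ S, ⟪y, T x⟫_ℝ = 0) → y = 0) :
    ∃ (b : HilbertBasis ℕ ℝ Y) (lam : ℕ → ℝ) (x : ℕ → X), (∀ k, 0 < lam k) ∧
      (∃ δ > 0, ∀ k, δ ≤ lam k) ∧
      ∀ k, x k ∈ S.topologicalClosure ∧ T (x k) = b k ∧
        ∀ v ∈ S.topologicalClosure, B (x k) v = lam k * ⟪b k, T v⟫_ℝ := by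
  obtain ⟨R, hRmem, hR⟩ := exists_solutionOperator B S hc hB T
  have hcoer := coercive_topologicalClosure hB
  let A : Y →L[ℝ] Y := T ∘L R
  have hsymm : A.IsSymmetric := by
    intro y z
    change ⟪T (R y), z⟫_ℝ = ⟪y, T (R z)⟫_ℝ
    rw [← hR y _ (hRmem z), real_inner_comm, ← hR z _ (hRmem y), hBs]
  have hcompact : IsCompactOperator A := by
    let R' : Y →L[ℝ] S.topologicalClosure := R.codRestrict _ hRmem
    have : (A : Y → Y) = (T ∘L S.topologicalClosure.subtypeL) ∘ R' := by ext y; rfl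
    rw [this]
    exact hT.comp_clm R'
  obtain ⟨b, μ, hμ⟩ := exists_hilbertBasis_eigenvectors hY A hcompact hsymm
  have hbn : ∀ k, ‖b k‖ = 1 := fun k => b.orthonormal.1 k
  -- If R b_k = 0, then b_k is orthogonal to T(S), which is dense.
  have hRne : ∀ k, R (b k) ≠ 0 := by
    intro k h0
    have : b k = 0 := hdense _ fun x hx => by
      rw [← hR _ _ (S.le_topologicalClosure hx), h0]; simp
    have h1 := hbn k
    rw [this, norm_zero] at h1
    exact zero_ne_one h1
  have hμeq : ∀ k, B (R (b k)) (R (b k)) = μ k := by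
    intro k
    rw [hR _ _ (hRmem _)]
    change ⟪b k, A (b k)⟫_ℝ = _
    rw [hμ, inner_smul_right, real_inner_self_eq_norm_sq, hbn]; ring
  have hμpos : ∀ k, 0 < μ k := by
    intro k
    rw [← hμeq]
    exact lt_of_lt_of_le (by have := norm_pos_iff.2 (hRne k); positivity)
      (hcoer _ (hRmem (b k)))
  -- The summand 1 keeps the bound nonzero, so that its inverse is a positive lower bound for all
  -- `lam k`.
  have hμle : ∀ k, μ k ≤ ‖A‖ + 1 := by
    intro k
    have := A.le_opNorm (b k)
    rw [hμ, norm_smul, hbn, Real.norm_eq_abs, abs_of_pos (hμpos k)] at this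
    linarith
  refine ⟨b, fun k => (μ k)⁻¹, fun k => (μ k)⁻¹ • R (b k), fun k => inv_pos.2 (hμpos k),
    ⟨(‖A‖ + 1)⁻¹, by positivity, fun k => inv_anti₀ (hμpos k) (hμle k)⟩, fun k => ⟨?_, ?_, ?_⟩⟩
  · exact Submodule.smul_mem _ _ (hRmem _)
  · rw [map_smul]
    change (μ k)⁻¹ • A (b k) = _
    rw [hμ, smul_smul, inv_mul_cancel₀ (hμpos k).ne', one_smul]
  · intro v hv
    rw [map_smul, _root_.smul_apply, hR _ _ hv, smul_eq_mul]

end Hilbert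

/-! ### Translation estimates, smoothing and piecewise constant approximation -/

/-- Cauchy–Schwarz against the constant 1; used on the unit interval and on small cubes. -/
theorem sq_lintegral_le {α : Type*} [MeasurableSpace α] (μ : Measure α) {f : α → ℝ≥0∞}
    (hf : AEMeasurable f μ) : (∫⁻ x, f x ∂μ) ^ 2 ≤ μ Set.univ * ∫⁻ x, f x ^ 2 ∂μ := by
  have h := ENNReal.lintegral_mul_le_Lp_mul_Lq μ Real.HolderConjugate.two_two
    (aemeasurable_const (b := (1 : ℝ≥0∞))) hf
  simp only [Pi.mul_apply, one_mul, ENNReal.rpow_two, one_pow, lintegral_one] at h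
  calc (∫⁻ x, f x ∂μ) ^ 2
      ≤ (μ Set.univ ^ (1 / 2 : ℝ) * (∫⁻ x, f x ^ 2 ∂μ) ^ (1 / 2 : ℝ)) ^ 2 := by gcongr
    _ = μ Set.univ * ∫⁻ x, f x ^ 2 ∂μ := by
      rw [mul_pow, ← ENNReal.rpow_natCast, ← ENNReal.rpow_natCast, ← ENNReal.rpow_mul,
        ← ENNReal.rpow_mul]
      norm_num

theorem eLpNorm_le_of_support_subset {α E : Type*} [MeasureSpace α] [NormedAddCommGroup E]
    {K U : Set α} {f : α → E} {η : ℝ} (hf : ∀ x, ‖f x‖ ≤ η) (hfK : ∀ x, x ∉ K → f x = 0) :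
    eLpNorm f 2 (volume.restrict U) ≤ volume K ^ (1 / 2 : ℝ) * ENNReal.ofReal η := by
  calc eLpNorm f 2 (volume.restrict U) ≤ eLpNorm f 2 volume :=
        eLpNorm_mono_measure _ Measure.restrict_le_self
    _ = eLpNorm f 2 (volume.restrict K) := by
        refine (eLpNorm_restrict_eq_of_support_subset fun x hx => ?_).symm
        by_contra h; exact hx (hfK x h)
    _ ≤ _ := by
        refine (eLpNorm_le_of_ae_bound (Eventually.of_forall hf)).trans ?_
        simp

section Translation

variable {F : Type*} [NormedAddCommGroup F] [NormedSpace ℝ F] [FiniteDimensional ℝ F]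
  [MeasureSpace F] [BorelSpace F] [(volume : Measure F).IsAddHaarMeasure]

/-- The `L²` translation estimate on a set invariant under the translations along `ζ`. -/
theorem lintegral_sub_translate_le {S : Set F} (hS : MeasurableSet S) {ζ : F}
    (hinv : ∀ t : ℝ, (fun x => x + t • ζ) ⁻¹' S = S) {φ : F → ℝ} (hφ : ContDiff ℝ 1 φ) :
    ∫⁻ x in S, ‖φ (x + ζ) - φ x‖ₑ ^ 2 ≤ ‖ζ‖ₑ ^ 2 * ∫⁻ x in S, ‖fderiv ℝ φ x‖ₑ ^ 2 := by
  have hd : Continuous (fderiv ℝ φ) := hφ.continuous_fderiv one_ne_zero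
  -- The fundamental theorem of calculus on the segment from x to x + ζ, followed by Cauchy–Schwarz
  -- on [0, 1].
  have hpt : ∀ x, ‖φ (x + ζ) - φ x‖ₑ ^ 2 ≤
      ∫⁻ t in Set.Ioc (0 : ℝ) 1, ‖ζ‖ₑ ^ 2 * ‖fderiv ℝ φ (x + t • ζ)‖ₑ ^ 2 := by
    intro x
    have hder : ∀ t ∈ Set.uIcc (0 : ℝ) 1,
        HasDerivAt (fun t : ℝ => φ (x + t • ζ)) (fderiv ℝ φ (x + t • ζ) ζ) t := by
      intro t _
      have h1 : HasDerivAt (fun t : ℝ => x + t • ζ) ζ t := by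
        simpa using ((hasDerivAt_id t).smul_const ζ).const_add x
      exact ((hφ.differentiable one_ne_zero _).hasFDerivAt).comp_hasDerivAt t h1
    have hint : IntervalIntegrable (fun t : ℝ => fderiv ℝ φ (x + t • ζ) ζ) volume 0 1 := by
      apply Continuous.intervalIntegrable
      fun_prop
    have h2 := intervalIntegral.integral_eq_sub_of_hasDerivAt hder hint
    rw [one_smul, zero_smul, add_zero, intervalIntegral.integral_of_le zero_le_one] at h2
    calc ‖φ (x + ζ) - φ x‖ₑ ^ 2
        ≤ (∫⁻ t in Set.Ioc (0 : ℝ) 1, ‖fderiv ℝ φ (x + t • ζ) ζ‖ₑ) ^ 2 := by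
          rw [← h2]; gcongr; exact enorm_integral_le_lintegral_enorm _
      _ ≤ ∫⁻ t in Set.Ioc (0 : ℝ) 1, ‖fderiv ℝ φ (x + t • ζ) ζ‖ₑ ^ 2 := by
          refine (sq_lintegral_le _ (Continuous.aemeasurable (by fun_prop))).trans ?_
          simp
      _ ≤ _ := by
          gcongr with t
          rw [← mul_pow, mul_comm]
          gcongr
          exact ContinuousLinearMap.le_opENorm _ _
  calc ∫⁻ x in S, ‖φ (x + ζ) - φ x‖ₑ ^ 2
      ≤ ∫⁻ x in S, ∫⁻ t in Set.Ioc (0 : ℝ) 1, ‖ζ‖ₑ ^ 2 * ‖fderiv ℝ φ (x + t • ζ)‖ₑ ^ 2 :=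
        lintegral_mono hpt
    _ = ∫⁻ t in Set.Ioc (0 : ℝ) 1, ∫⁻ x in S, ‖ζ‖ₑ ^ 2 * ‖fderiv ℝ φ (x + t • ζ)‖ₑ ^ 2 := by
        refine lintegral_lintegral_swap (Continuous.aemeasurable ?_)
        simp only [Function.uncurry_def]
        refine ENNReal.continuous_const_mul (by finiteness) |>.comp ?_
        fun_prop
    _ = ∫⁻ t in Set.Ioc (0 : ℝ) 1, ‖ζ‖ₑ ^ 2 * ∫⁻ x in S, ‖fderiv ℝ φ x‖ₑ ^ 2 := by
        -- Since S is invariant under x ↦ x + tζ, the inner integral does not depend on t.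
        refine lintegral_congr fun t => ?_
        rw [lintegral_const_mul' _ _ (by finiteness)]
        congr 1
        have h := (measurePreserving_add_right (volume : Measure F)
            (t • ζ)).setLIntegral_comp_preimage
          hS (f := fun x => ‖fderiv ℝ φ x‖ₑ ^ 2) (by fun_prop)
        rwa [hinv t] at h
    _ = _ := by simp

/-- The Poincaré inequality for functions whose support is displaced by a translation. -/
theorem lintegral_sq_le_of_displaced {U U' S : Set F} (hS : MeasurableSet S)
    (hU : MeasurableSet U) {ζ : F} (hinv : ∀ t : ℝ, (fun x => x + t • ζ) ⁻¹' S = S) (hUS : U ⊆ S)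
    (hSU : S ∩ U' ⊆ U) (hdisp : ∀ x ∈ U, x + ζ ∉ U') {φ : F → ℝ}
    (hφ : φ ∈ CompactlySupported 1 U') :
    ∫⁻ x in U, ‖φ x‖ₑ ^ 2 ≤ ‖ζ‖ₑ ^ 2 * ∫⁻ x in U, ‖fderiv ℝ φ x‖ₑ ^ 2 := by
  obtain ⟨h1, -, h3⟩ := hφ
  -- For x in U the point x + ζ lies outside U', where φ is supported, so φ equals its own
  -- difference up to sign.
  calc ∫⁻ x in U, ‖φ x‖ₑ ^ 2 = ∫⁻ x in U, ‖φ (x + ζ) - φ x‖ₑ ^ 2 := by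
        refine setLIntegral_congr_fun hU fun x hx => ?_
        have : φ (x + ζ) = 0 := image_eq_zero_of_notMem_tsupport fun h => hdisp x hx (h3 h)
        simp [this]
    _ ≤ ∫⁻ x in S, ‖φ (x + ζ) - φ x‖ₑ ^ 2 := lintegral_mono_set hUS
    _ ≤ ‖ζ‖ₑ ^ 2 * ∫⁻ x in S, ‖fderiv ℝ φ x‖ₑ ^ 2 := lintegral_sub_translate_le hS hinv h1
    _ = ‖ζ‖ₑ ^ 2 * ∫⁻ x in U, ‖fderiv ℝ φ x‖ₑ ^ 2 := by
        congr 1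
        rw [← lintegral_inter_add_sdiff _ S hU, Set.inter_eq_self_of_subset_right hUS]
        -- The part of S outside U does not meet the support of φ and contributes nothing to the
        -- gradient integral.
        refine (congrArg _ ?_).trans (add_zero _)
        refine (setLIntegral_congr_fun (hS.diff hU) fun x hx => ?_).trans lintegral_zero
        have hx' : x ∉ tsupport φ := fun h => hx.2 (hSU ⟨hx.1, h3 h⟩)
        have : fderiv ℝ φ x = 0 :=
          image_eq_zero_of_notMem_tsupport fun h => hx' (tsupport_fderiv_subset ℝ h)
        simp [this, enorm_eq_nnnorm]

/-- `C_c^∞(U)` is dense in `C_c^1(U)` for the norm of `H¹(U)`. -/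
theorem exists_smooth_tendstoH1 {U : Set F} (hU : IsOpen U) {φ : F → ℝ}
    (hφ : φ ∈ CompactlySupported 1 U) :
    ∃ ψ : ℕ → F → ℝ, (∀ k, ψ k ∈ CompactlySupported ∞ U) ∧ TendstoH1 U ψ φ (fderiv ℝ φ) := by
  obtain ⟨h1, h2, h3⟩ := hφ
  have hd : Continuous (fderiv ℝ φ) := h1.continuous_fderiv one_ne_zero
  have hdc : HasCompactSupport (fderiv ℝ φ) := h2.fderiv ℝ
  -- All mollifications will be supported in one compact K inside U, so uniform convergence there
  -- implies convergence in L².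
  obtain ⟨δ, hδ, hδU⟩ := IsCompact.exists_cthickening_subset_open h2 hU h3
  set K := Metric.cthickening δ (tsupport φ) with hKdef
  have hKc : IsCompact K := IsCompact.cthickening h2
  have key : ∀ η > (0 : ℝ), ∃ ψ ∈ CompactlySupported ∞ U, (∀ x, ‖ψ x - φ x‖ ≤ η) ∧
      (∀ x, ‖fderiv ℝ ψ x - fderiv ℝ φ x‖ ≤ η) ∧ (∀ x, x ∉ K → ψ x = 0) ∧
      ∀ x, x ∉ K → fderiv ℝ ψ x = 0 := by
    intro η hη
    have hu1 : UniformContinuous φ := h2.uniformContinuous_of_continuous h1.continuous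
    have hu2 : UniformContinuous (fderiv ℝ φ) := hdc.uniformContinuous_of_continuous hd
    obtain ⟨d1, hd1, hd1'⟩ := Metric.uniformContinuous_iff.1 hu1 η hη
    obtain ⟨d2, hd2, hd2'⟩ := Metric.uniformContinuous_iff.1 hu2 η hη
    have hr : 0 < min δ (min d1 d2) := by positivity
    -- The radius is at most δ, to keep the support in K, and at most the moduli d1 and d2 of
    -- uniform continuity of φ and of its differential.
    let ρ : ContDiffBump (0 : F) := ⟨min δ (min d1 d2) / 2, min δ (min d1 d2), by positivity,
      by linarith⟩
    let ψ : F → ℝ := convolution (ρ.normed volume) φ (ContinuousLinearMap.lsmul ℝ ℝ) volume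
    have hli : LocallyIntegrable (ρ.normed volume) (volume : Measure F) :=
      (ρ.contDiff_normed (n := 0)).continuous.locallyIntegrable
    have hψd : ∀ x, HasFDerivAt ψ (convolution (ρ.normed volume) (fderiv ℝ φ)
        (ContinuousLinearMap.lsmul ℝ ℝ) volume x) x := by
      intro x
      have h := h2.hasFDerivAt_convolution_right (ContinuousLinearMap.lsmul ℝ ℝ)
        hli h1 x
      -- This identification says that the differential of the mollified function is the mollified
      -- differential.
      have hL : ContinuousLinearMap.precompR F (ContinuousLinearMap.lsmul ℝ ℝ (E := ℝ)) =
          ContinuousLinearMap.lsmul ℝ ℝ := by ext; rfl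
      rwa [hL] at h
    have hsupp : Function.support ψ ⊆ K := by
      refine (support_convolution_subset (ContinuousLinearMap.lsmul ℝ ℝ)).trans ?_
      rintro _ ⟨a, ha, b, hb, rfl⟩
      rw [ρ.support_normed_eq, mem_ball_zero_iff] at ha
      refine Metric.mem_cthickening_of_dist_le _ b _ _ (subset_tsupport _ hb) ?_
      simp only [dist_eq_norm, add_sub_cancel_right]
      exact ha.le.trans (min_le_left _ _)
    have htsupp : tsupport ψ ⊆ K := closure_minimal hsupp hKc.isClosed
    refine ⟨ψ, ⟨?_, ?_, htsupp.trans hδU⟩, fun x => ?_, fun x => ?_, fun x hx => ?_, fun x hx => ?_⟩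
    · exact ρ.hasCompactSupport_normed.contDiff_convolution_left _ ρ.contDiff_normed
        h1.continuous.locallyIntegrable
    · exact hKc.of_isClosed_subset (isClosed_tsupport _) htsupp
    · rw [← dist_eq_norm]
      refine ρ.dist_normed_convolution_le h1.continuous.aestronglyMeasurable fun y hy => ?_
      exact (hd1' (lt_of_lt_of_le hy ((min_le_right _ _).trans (min_le_left _ _)))).le
    · rw [← dist_eq_norm, (hψd x).fderiv]
      refine ρ.dist_normed_convolution_le hd.aestronglyMeasurable fun y hy => ?_
      exact (hd2' (lt_of_lt_of_le hy ((min_le_right _ _).trans (min_le_right _ _)))).le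
    · exact image_eq_zero_of_notMem_tsupport fun h => hx (htsupp h)
    · exact image_eq_zero_of_notMem_tsupport fun h => hx (htsupp (tsupport_fderiv_subset ℝ h))
  choose! ψ hψ hψ1 hψ2 hψ3 hψ4 using key
  have he : ∀ k : ℕ, (0 : ℝ) < 1 / ((k : ℝ) + 1) := fun k => by positivity
  have hφK : ∀ x, x ∉ K → φ x = 0 := fun x hx =>
    image_eq_zero_of_notMem_tsupport fun h => hx (Metric.self_subset_cthickening _ h)
  have hφK' : ∀ x, x ∉ K → fderiv ℝ φ x = 0 := fun x hx =>
    image_eq_zero_of_notMem_tsupport fun h =>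
      hx (Metric.self_subset_cthickening _ (tsupport_fderiv_subset ℝ h))
  have hlim : Tendsto (fun k : ℕ => volume K ^ (1 / 2 : ℝ) * ENNReal.ofReal (1 / ((k : ℝ) + 1)))
      atTop (𝓝 0) := by
    have hfin : volume K ^ (1 / 2 : ℝ) ≠ ⊤ :=
      ENNReal.rpow_ne_top_of_nonneg (by positivity) hKc.measure_lt_top.ne
    have := ENNReal.Tendsto.const_mul (a := volume K ^ (1 / 2 : ℝ)) (ENNReal.tendsto_ofReal
      (tendsto_one_div_add_atTop_nhds_zero_nat (𝕜 := ℝ))) (Or.inr hfin)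
    simpa using this
  refine ⟨fun k => ψ (1 / ((k : ℝ) + 1)), fun k => hψ _ (he k), ?_, ?_⟩
  · refine tendsto_of_tendsto_of_tendsto_of_le_of_le tendsto_const_nhds hlim
      (fun _ => bot_le) fun k => ?_
    refine eLpNorm_le_of_support_subset (K := K) (hψ1 _ (he k)) fun x hx => ?_
    simp only [hψ3 _ (he k) x hx, hφK x hx, sub_zero]
  · refine tendsto_of_tendsto_of_tendsto_of_le_of_le tendsto_const_nhds hlim
      (fun _ => bot_le) fun k => ?_
    refine eLpNorm_le_of_support_subset (K := K) (hψ2 _ (he k)) fun x hx => ?_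
    simp only [hψ4 _ (he k) x hx, hφK' x hx, sub_zero]

end Translation

/-- The trace inequality on the half-line. -/
theorem sq_le_integral_Ioi {φ : ℝ → ℝ} (hφ : ContDiff ℝ 1 φ) (hc : HasCompactSupport φ) :
    φ 0 ^ 2 ≤ ∫ y in Set.Ioi (0 : ℝ), (φ y ^ 2 + deriv φ y ^ 2) := by
  have hd : Continuous (deriv φ) := hφ.continuous_deriv le_rfl
  have hcd : HasCompactSupport (deriv φ) := hc.deriv
  have hcont := hφ.continuous
  have hder : ∀ y ∈ Set.Ici (0 : ℝ), HasDerivAt (fun y => φ y ^ 2) (2 * φ y * deriv φ y) y := by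
    intro y _
    exact (((hφ.differentiable one_ne_zero y).hasDerivAt).pow 2).congr_deriv (by simp)
  have hint : Integrable (fun y => 2 * φ y * deriv φ y) :=
    Continuous.integrable_of_hasCompactSupport (by fun_prop) (hcd.mul_left)
  have hint2 : Integrable (fun y => φ y ^ 2 + deriv φ y ^ 2) := by
    refine Continuous.integrable_of_hasCompactSupport (by fun_prop) ?_
    refine HasCompactSupport.add ?_ ?_
    · exact hc.comp_left (g := fun t : ℝ => t ^ 2) (by simp)
    · exact hcd.comp_left (g := fun t : ℝ => t ^ 2) (by simp)
  have hlim : Tendsto (fun y => φ y ^ 2) atTop (𝓝 0) := by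
    have := (hc.comp_left (g := fun t : ℝ => t ^ 2) (by simp)).is_zero_at_infty
    exact this.mono_left atTop_le_cocompact
  have h := integral_Ioi_of_hasDerivAt_of_tendsto' hder hint.integrableOn hlim
  -- φ(0)² is minus the integral of (φ²)' = 2φφ', and -2φφ' ≤ φ² + φ'².
  have h' : φ 0 ^ 2 = ∫ y in Set.Ioi (0 : ℝ), -(2 * φ y * deriv φ y) := by
    rw [integral_neg, h]; ring
  rw [h']
  refine integral_mono hint.neg.integrableOn hint2.integrableOn fun y => ?_
  nlinarith [sq_nonneg (φ y + deriv φ y)]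

/-! ### Approximation by means over small cubes -/

section Cubes

variable {n : ℕ}

/-- The index of the cube of side `1 / N` containing `x`. -/
noncomputable def cubeIndex (N : ℕ) (x : Space n) : Fin n → ℤ := fun i => ⌊(N : ℝ) * x i⌋

/-- The half-open cube of side `1 / N` with index `m`. -/
def cube (N : ℕ) (m : Fin n → ℤ) : Set (Space n) := {x | cubeIndex N x = m}

/-- The mean of `φ` over the cube of side `1 / N` with index `m`. -/
noncomputable def cubeMean (N : ℕ) (φ : Space n → ℝ) (m : Fin n → ℤ) : ℝ :=
  (N : ℝ) ^ n * ∫ z in cube N m, φ z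

theorem measurable_cubeIndex (N : ℕ) : Measurable (cubeIndex N : Space n → Fin n → ℤ) := by
  refine measurable_pi_lambda _ fun i => Int.measurable_floor.comp ?_
  fun_prop

theorem measurableSet_cube (N : ℕ) (m : Fin n → ℤ) : MeasurableSet (cube N m) :=
  measurable_cubeIndex N (measurableSet_singleton m)

theorem volume_cube {N : ℕ} (hN : 0 < N) (m : Fin n → ℤ) :
    volume (cube N m) = ENNReal.ofReal (((N : ℝ) ^ n)⁻¹) := by
  have hN' : (0 : ℝ) < N := by exact_mod_cast hN
  have h : cube N m = (WithLp.ofLp : Space n → Fin n → ℝ) ⁻¹'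
      (Set.pi Set.univ fun i => Set.Ico ((m i : ℝ) / N) (((m i : ℝ) + 1) / N)) := by
    ext x
    simp only [cube, cubeIndex, Set.mem_ofPred_eq, Set.mem_preimage, Set.mem_pi, Set.mem_univ,
      true_implies, Set.mem_Ico, funext_iff, Int.floor_eq_iff]
    refine forall_congr' fun i => ?_
    rw [div_le_iff₀' hN', lt_div_iff₀' hN']
  rw [h, (PiLp.volume_preserving_ofLp (Fin n)).measure_preimage
    (MeasurableSet.univ_pi fun i => measurableSet_Ico).nullMeasurableSet, Real.volume_pi_Ico]
  have : ∀ i : Fin n, ((m i : ℝ) + 1) / N - (m i : ℝ) / N = (N : ℝ)⁻¹ := fun i => by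
    field_simp; ring
  simp only [this, Finset.prod_const, Finset.card_univ, Fintype.card_fin]
  rw [← ENNReal.ofReal_pow (by positivity), inv_pow]

theorem norm_sub_le_of_cubeIndex_eq {N : ℕ} (hN : 0 < N) {x z : Space n}
    (h : cubeIndex N z = cubeIndex N x) : ‖z - x‖ ≤ Real.sqrt n / N := by
  have hN' : (0 : ℝ) < N := by exact_mod_cast hN
  have hi : ∀ i, ‖(z - x) i‖ ^ 2 ≤ ((N : ℝ)⁻¹) ^ 2 := by
    intro i
    have h1 := congrFun h i
    simp only [cubeIndex] at h1
    have h2 := Int.abs_sub_lt_one_of_floor_eq_floor h1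
    rw [← mul_sub, abs_mul, abs_of_pos hN'] at h2
    have h3 : |z i - x i| ≤ (N : ℝ)⁻¹ := by
      rw [← one_div, le_div_iff₀' hN']; exact h2.le
    rw [Real.norm_eq_abs]
    exact pow_le_pow_left₀ (abs_nonneg _) h3 2
  rw [EuclideanSpace.norm_eq]
  calc Real.sqrt (∑ i, ‖(z - x) i‖ ^ 2) ≤ Real.sqrt (∑ _i : Fin n, ((N : ℝ)⁻¹) ^ 2) :=
        Real.sqrt_le_sqrt (Finset.sum_le_sum fun i _ => hi i)
    _ = Real.sqrt n / N := by
        rw [Finset.sum_const, Finset.card_univ, Fintype.card_fin, nsmul_eq_mul,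
          Real.sqrt_mul (by positivity), Real.sqrt_sq (by positivity)]
        rfl

/-- The deviation from the mean is the mean of φ(x) - φ(z) over the cube; Cauchy–Schwarz bounds its
square by the mean of the squares. All z in the cube lie within √n / N of x, so the cube may be
replaced by a ball of translations, whose centre no longer depends on x: this is the form needed for
Fubini and the translation estimate. -/
theorem enorm_sub_cubeMean_sq_le {N : ℕ} (hN : 0 < N) {φ : Space n → ℝ} (hφ : Continuous φ)
    (hc : HasCompactSupport φ) (x : Space n) :
    ‖φ x - cubeMean N φ (cubeIndex N x)‖ₑ ^ 2 ≤ ENNReal.ofReal ((N : ℝ) ^ n) *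
      ∫⁻ ζ in Metric.closedBall (0 : Space n) (Real.sqrt n / N), ‖φ (x + ζ) - φ x‖ₑ ^ 2 := by
  have hN' : (0 : ℝ) < N := by exact_mod_cast hN
  set Q := cube N (cubeIndex N x) with hQ
  have hvol : volume Q = ENNReal.ofReal (((N : ℝ) ^ n)⁻¹) := volume_cube hN _
  have hreal : volume.real Q = ((N : ℝ) ^ n)⁻¹ := by
    rw [measureReal_def, hvol, ENNReal.toReal_ofReal (by positivity)]
  have hfin : IsFiniteMeasure (volume.restrict Q) := by
    refine ⟨?_⟩
    rw [Measure.restrict_apply_univ, hvol]; exact ENNReal.ofReal_lt_top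
  have hint : IntegrableOn φ Q := (hφ.integrable_of_hasCompactSupport hc).integrableOn
  have heq : φ x - cubeMean N φ (cubeIndex N x) = (N : ℝ) ^ n * ∫ z in Q, (φ x - φ z) := by
    rw [integral_sub (integrable_const _) hint, integral_const, measureReal_restrict_apply_univ,
      hreal, cubeMean, mul_sub, smul_eq_mul, mul_inv_cancel_left₀ (by positivity)]
  have hpt : ∫⁻ z in Q, ‖φ x - φ z‖ₑ ^ 2 ≤
      ∫⁻ ζ in Metric.closedBall (0 : Space n) (Real.sqrt n / N), ‖φ (x + ζ) - φ x‖ₑ ^ 2 := by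
    have hm := (measurePreserving_add_left
        (volume : Measure (Space n)) x).setLIntegral_comp_preimage
      (s := Metric.closedBall x (Real.sqrt n / N)) measurableSet_closedBall
      (f := fun z => ‖φ z - φ x‖ₑ ^ 2) (by fun_prop)
    have hpre : (fun ζ => x + ζ) ⁻¹' Metric.closedBall x (Real.sqrt n / N) =
        Metric.closedBall (0 : Space n) (Real.sqrt n / N) := by
      ext ζ; simp [dist_eq_norm]
    rw [hpre] at hm
    rw [hm]
    simp_rw [enorm_sub_rev (φ x)]
    refine lintegral_mono_set fun z hz => ?_
    rw [Metric.mem_closedBall, dist_eq_norm]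
    exact norm_sub_le_of_cubeIndex_eq hN hz
  rw [heq, enorm_mul, mul_pow, Real.enorm_of_nonneg (by positivity : (0 : ℝ) ≤ (N : ℝ) ^ n)]
  set A := ENNReal.ofReal ((N : ℝ) ^ n)
  calc A ^ 2 * ‖∫ z in Q, (φ x - φ z)‖ₑ ^ 2
      ≤ A ^ 2 * (∫⁻ z in Q, ‖φ x - φ z‖ₑ) ^ 2 := by
        gcongr; exact enorm_integral_le_lintegral_enorm _
    _ ≤ A ^ 2 * (volume Q * ∫⁻ z in Q, ‖φ x - φ z‖ₑ ^ 2) := by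
        gcongr
        refine (sq_lintegral_le _ (Continuous.aemeasurable (by fun_prop))).trans ?_
        rw [Measure.restrict_apply_univ]
    _ = A * ∫⁻ z in Q, ‖φ x - φ z‖ₑ ^ 2 := by
        -- The volume N⁻ⁿ of the cube cancels one of the two factors Nⁿ.
        rw [hvol, ENNReal.ofReal_inv_of_pos (by positivity), sq, ← mul_assoc, mul_assoc A A,
          ENNReal.mul_inv_cancel
              (ENNReal.ofReal_pos.2 (by positivity)).ne' ENNReal.ofReal_ne_top, mul_one]
    _ ≤ _ := by gcongr

/-- Functions of class `C_c^1` are approximated in `L²` by their means over small cubes. -/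
theorem exists_lintegral_sub_cubeMean_le (n : ℕ) : ∃ C : ℝ≥0∞, C ≠ ⊤ ∧
    ∀ N : ℕ, 0 < N → ∀ φ : Space n → ℝ, ContDiff ℝ 1 φ → HasCompactSupport φ →
      ∫⁻ x, ‖φ x - cubeMean N φ (cubeIndex N x)‖ₑ ^ 2 ≤
        C * ENNReal.ofReal ((N : ℝ)⁻¹) ^ 2 * ∫⁻ x, ‖fderiv ℝ φ x‖ₑ ^ 2 := by
  -- With r = √n / N, the first two factors are Nⁿ times the volume of the ball of radius r, and the
  -- last one comes from the r² of the translation estimate.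
  refine ⟨ENNReal.ofReal (Real.sqrt n ^ n) * volume (Metric.ball (0 : Space n) 1) *
    ENNReal.ofReal (Real.sqrt n) ^ 2, ?_, fun N hN φ hφ hc => ?_⟩
  · have := (measure_ball_lt_top (μ := (volume : Measure (Space n))) (x := 0) (r := 1)).ne
    finiteness
  have hN' : (0 : ℝ) < N := by exact_mod_cast hN
  set r := Real.sqrt n / N with hr
  have hr0 : 0 ≤ r := by positivity
  set I := ∫⁻ x, ‖fderiv ℝ φ x‖ₑ ^ 2
  calc ∫⁻ x, ‖φ x - cubeMean N φ (cubeIndex N x)‖ₑ ^ 2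
      ≤ ∫⁻ x, ENNReal.ofReal ((N : ℝ) ^ n) *
          ∫⁻ ζ in Metric.closedBall (0 : Space n) r, ‖φ (x + ζ) - φ x‖ₑ ^ 2 :=
        lintegral_mono fun x => enorm_sub_cubeMean_sq_le hN hφ.continuous hc x
    _ = ENNReal.ofReal ((N : ℝ) ^ n) * ∫⁻ ζ in Metric.closedBall (0 : Space n) r,
          ∫⁻ x, ‖φ (x + ζ) - φ x‖ₑ ^ 2 := by
        have hcont := hφ.continuous
        rw [lintegral_const_mul' _ _ ENNReal.ofReal_ne_top, lintegral_lintegral_swap]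
        refine Continuous.aemeasurable ?_
        simp only [Function.uncurry_def]
        fun_prop
    _ ≤ ENNReal.ofReal ((N : ℝ) ^ n) * ∫⁻ ζ in Metric.closedBall (0 : Space n) r,
          ENNReal.ofReal r ^ 2 * I := by
        refine mul_le_mul' le_rfl (setLIntegral_mono' measurableSet_closedBall fun ζ hζ => ?_)
        have h := lintegral_sub_translate_le (S := Set.univ) MeasurableSet.univ (ζ := ζ)
          (fun t => Set.preimage_univ) hφ
        simp only [Measure.restrict_univ] at h
        refine h.trans ?_
        gcongr
        rw [mem_closedBall_zero_iff] at hζ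
        rw [← ofReal_norm]
        exact ENNReal.ofReal_le_ofReal hζ
    _ = _ := by
        rw [setLIntegral_const, Measure.addHaar_closedBall _ _ hr0, finrank_euclideanSpace_fin]
        have h1 : ENNReal.ofReal ((N : ℝ) ^ n) * ENNReal.ofReal (r ^ n) =
            ENNReal.ofReal (Real.sqrt n ^ n) := by
          rw [← ENNReal.ofReal_mul (by positivity), ← mul_pow, hr, mul_div_cancel₀ _ hN'.ne']
        have h2 : ENNReal.ofReal r = ENNReal.ofReal (Real.sqrt n) * ENNReal.ofReal ((N : ℝ)⁻¹) := by
          rw [← ENNReal.ofReal_mul (by positivity)]; rfl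
        rw [← h1, h2]
        ring

/-- Only finitely many cubes meet a bounded set; hence their indicators span a finite-dimensional
space, as the compactness criterion requires. -/
theorem finite_cubeIndex_image (N : ℕ) {U : Set (Space n)} (hU : Bornology.IsBounded U) :
    (cubeIndex N '' U).Finite := by
  obtain ⟨R, hR⟩ := hU.exists_norm_le
  refine (Set.finite_Icc (fun _ : Fin n => ⌊-((N : ℝ) * R)⌋)
    (fun _ : Fin n => ⌊(N : ℝ) * R⌋)).subset ?_
  rintro _ ⟨x, hx, rfl⟩
  have hi : ∀ i, |x i| ≤ R := fun i => (PiLp.norm_apply_le x i).trans (hR x hx)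
  refine ⟨fun i => Int.floor_le_floor ?_, fun i => Int.floor_le_floor ?_⟩
  · have := (abs_le.1 (hi i)).1
    have hN : (0 : ℝ) ≤ N := by positivity
    nlinarith
  · exact mul_le_mul_of_nonneg_left (abs_le.1 (hi i)).2 (by positivity)

end Cubes

/-! ### Comparable measures -/

/-- Two measures are comparable if each is dominated by a finite multiple of the other. -/
def Comparable {α : Type*} [MeasurableSpace α] (μ ν : Measure α) : Prop :=
  ∃ C : ℝ≥0∞, C ≠ ⊤ ∧ μ ≤ C • ν ∧ ν ≤ C • μ

namespace Comparable

variable {α : Type*} [MeasurableSpace α] {μ ν : Measure α} {E : Type*} [NormedAddCommGroup E]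

theorem symm (h : Comparable μ ν) : Comparable ν μ := by
  obtain ⟨C, h1, h2, h3⟩ := h
  exact ⟨C, h1, h3, h2⟩

theorem absolutelyContinuous (h : Comparable μ ν) : μ ≪ ν := by
  obtain ⟨C, h1, h2, h3⟩ := h
  exact Measure.absolutelyContinuous_of_le_smul h2

theorem ae_eq (h : Comparable μ ν) : ae μ = ae ν :=
  le_antisymm h.absolutelyContinuous.ae_le h.symm.absolutelyContinuous.ae_le

theorem memLp (h : Comparable μ ν) {f : α → E} {p : ℝ≥0∞} (hf : MemLp f p μ) : MemLp f p ν := by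
  obtain ⟨C, h1, h2, h3⟩ := h
  exact hf.of_measure_le_smul h1 h3

theorem tendsto_eLpNorm (h : Comparable μ ν) {f : ℕ → α → E}
    (hf : Tendsto (fun k => eLpNorm (f k) 2 ν) atTop (𝓝 0)) :
    Tendsto (fun k => eLpNorm (f k) 2 μ) atTop (𝓝 0) := by
  obtain ⟨C, h1, h2, h3⟩ := h
  have hC : C ^ (1 / (2 : ℝ≥0∞)).toReal ≠ ⊤ := ENNReal.rpow_ne_top_of_nonneg (by positivity) h1
  have hlim := ENNReal.Tendsto.const_mul hf (Or.inr hC)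
  rw [mul_zero] at hlim
  refine tendsto_of_tendsto_of_tendsto_of_le_of_le tendsto_const_nhds hlim (fun _ => bot_le)
    fun k => ?_
  refine (eLpNorm_mono_measure (f k) h2).trans ?_
  rw [eLpNorm_smul_measure_of_ne_top (by norm_num), smul_eq_mul]

theorem lintegral_le (h : Comparable μ ν) : ∃ C : ℝ≥0∞, C ≠ ⊤ ∧
    ∀ f : α → ℝ≥0∞, ∫⁻ x, f x ∂μ ≤ C * ∫⁻ x, f x ∂ν := by
  obtain ⟨C, h1, h2, h3⟩ := h
  refine ⟨C, h1, fun f => ?_⟩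
  rw [← smul_eq_mul, ← lintegral_smul_measure]
  exact lintegral_mono' h2 le_rfl

end Comparable

/-- Hölder's inequality: the products converge in L¹. It carries integration by parts over to H¹
limits. -/
theorem tendsto_integral_mul_of_tendsto_eLpNorm {α : Type*} [MeasurableSpace α] {μ : Measure α}
    {f : ℕ → α → ℝ} {g χ : α → ℝ} (hf : ∀ k, MemLp (f k) 2 μ) (hg : MemLp g 2 μ)
    (hχ : MemLp χ 2 μ) (hlim : Tendsto (fun k => eLpNorm (fun x => f k x - g x) 2 μ) atTop (𝓝 0)) :
    Tendsto (fun k => ∫ x, f k x * χ x ∂μ) atTop (𝓝 (∫ x, g x * χ x ∂μ)) := by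
  refine tendsto_integral_of_L1' _ (hg.integrable_mul hχ).aestronglyMeasurable
    (Eventually.of_forall fun k => (hf k).integrable_mul hχ) ?_
  have hl : Tendsto (fun k => eLpNorm (fun x => f k x - g x) 2 μ * eLpNorm χ 2 μ) atTop (𝓝 0) := by
    have := ENNReal.Tendsto.mul_const hlim (Or.inr hχ.eLpNorm_ne_top)
    rwa [zero_mul] at this
  refine tendsto_of_tendsto_of_tendsto_of_le_of_le tendsto_const_nhds hl (fun _ => bot_le)
    fun k => ?_
  have h := eLpNorm_le_eLpNorm_mul_eLpNorm_of_nnnorm (μ := μ) (p := 2) (q := 2) (r := 1)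
    ((hf k).sub hg).aestronglyMeasurable hχ.aestronglyMeasurable (fun a b : ℝ => a * b) 1
    (Eventually.of_forall fun x => by simp)
  rw [ENNReal.coe_one, one_mul] at h
  refine le_trans (le_of_eq ?_) h
  congr 1
  ext x
  simp [sub_mul]

/-! ### Jets of functions and the space `H¹` -/

/-- The fibre of the bundle of `1`-jets: a value and `ι` partial derivatives. -/
abbrev Jet (ι : Type*) : Type _ := EuclideanSpace ℝ (Option ι)

section Jets

variable {F : Type*} [NormedAddCommGroup F] [NormedSpace ℝ F] [FiniteDimensional ℝ F]
  {ι : Type*} [Fintype ι]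

/-- A value together with a differential, in coordinates. -/
noncomputable def jetEquiv (e : Module.Basis ι ℝ F) : (ℝ × (F →L[ℝ] ℝ)) ≃L[ℝ] Jet ι :=
  LinearEquiv.toContinuousLinearEquiv
    { toFun := fun p => WithLp.toLp 2 fun o => o.elim p.1 fun i => p.2 (e i)
      map_add' := fun p q => by
        ext o; cases o <;> simp
      map_smul' := fun c p => by
        ext o; cases o <;> simp
      invFun := fun J => (J none, LinearMap.toContinuousLinearMap
        (e.constr ℝ fun i => J (some i)))
      left_inv := fun p => by
        refine Prod.ext rfl ?_
        apply ContinuousLinearMap.coe_injective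
        exact e.ext fun i => e.constr_basis ℝ _ i
      right_inv := fun J => by
        ext o
        cases o with
        | none => rfl
        | some i => exact e.constr_basis ℝ _ i }

/-- The `1`-jet of a function with a given differential. -/
noncomputable def jet (e : Module.Basis ι ℝ F) (u : F → ℝ) (Du : F → F →L[ℝ] ℝ) (z : F) : Jet ι :=
  jetEquiv e (u z, Du z)

@[simp]
theorem jet_none (e : Module.Basis ι ℝ F) (u : F → ℝ) (Du : F → F →L[ℝ] ℝ) (z : F) :
    jet e u Du z none = u z := rfl

@[simp]
theorem jet_some (e : Module.Basis ι ℝ F) (u : F → ℝ) (Du : F → F →L[ℝ] ℝ) (z : F) (i : ι) :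
    jet e u Du z (some i) = Du z (e i) := rfl

theorem jet_sub (e : Module.Basis ι ℝ F) (u v : F → ℝ) (Du Dv : F → F →L[ℝ] ℝ) (z : F) :
    jet e u Du z - jet e v Dv z = jetEquiv e (u z - v z, Du z - Dv z) := by
  rw [jet, jet, ← map_sub]; rfl

/-- The fibrewise isomorphism `jetEquiv` is inverted pointwise. The `Du` obtained is only a formal
differential; that it is a weak one follows later from membership in a closure of test jets. -/
theorem exists_jet_of_jet (e : Module.Basis ι ℝ F) (G : F → Jet ι) :
    ∃ (u : F → ℝ) (Du : F → F →L[ℝ] ℝ), jet e u Du = G :=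
  ⟨fun z => ((jetEquiv e).symm (G z)).1, fun z => ((jetEquiv e).symm (G z)).2, by
    ext1 z; simp only [jet, Prod.mk.eta, ContinuousLinearEquiv.apply_symm_apply]⟩

variable [MeasureSpace F] {U U' : Set F} {ν : Measure F}

theorem memLp_jet_iff (e : Module.Basis ι ℝ F) {u : F → ℝ} {Du : F → F →L[ℝ] ℝ} :
    MemLp (jet e u Du) 2 ν ↔ MemLp u 2 ν ∧ MemLp Du 2 ν := by
  have h : MemLp (jet e u Du) 2 ν ↔ MemLp (fun z => (u z, Du z)) 2 ν := by
    constructor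
    · intro h
      have heq : (fun z => (u z, Du z)) =
          (jetEquiv e).symm.toContinuousLinearMap ∘ jet e u Du := by
        ext1 z; simp [jet]
      rw [heq]
      exact (jetEquiv e).symm.toContinuousLinearMap.comp_memLp' h
    · intro h
      exact (jetEquiv e).toContinuousLinearMap.comp_memLp' h
  rw [h]
  refine ⟨fun h => ⟨(ContinuousLinearMap.fst ℝ ℝ (F →L[ℝ] ℝ)).comp_memLp' h,
    (ContinuousLinearMap.snd ℝ ℝ (F →L[ℝ] ℝ)).comp_memLp' h⟩, fun h => ?_⟩
  have heq : (fun z => (u z, Du z)) = (ContinuousLinearMap.inl ℝ ℝ (F →L[ℝ] ℝ)) ∘ u +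
      (ContinuousLinearMap.inr ℝ ℝ (F →L[ℝ] ℝ)) ∘ Du := by
    ext1 z; simp
  rw [heq]
  exact ((ContinuousLinearMap.inl ℝ ℝ (F →L[ℝ] ℝ)).comp_memLp' h.1).add
    ((ContinuousLinearMap.inr ℝ ℝ (F →L[ℝ] ℝ)).comp_memLp' h.2)

/-- `jetEquiv` is bounded in both directions and the measures are comparable, so two limits in
Lebesgue norms amount to a single limit in L² of jets for ν. -/
theorem tendstoH1_iff (e : Module.Basis ι ℝ F) (hν : Comparable (volume.restrict U) ν)
    {φ : ℕ → F → ℝ} {u : F → ℝ} {Du : F → F →L[ℝ] ℝ} (hφ : ∀ k, MemLp (φ k) 2 ν)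
    (hφ' : ∀ k, MemLp (fderiv ℝ (φ k)) 2 ν) (hu : MemLp u 2 ν) (hDu : MemLp Du 2 ν) :
    TendstoH1 U φ u Du ↔
      Tendsto (fun k => eLpNorm (fun z => jet e (φ k) (fderiv ℝ (φ k)) z - jet e u Du z) 2 ν)
        atTop (𝓝 0) := by
  constructor
  · rintro ⟨h1, h2⟩
    have h1' := hν.symm.tendsto_eLpNorm h1
    have h2' := hν.symm.tendsto_eLpNorm h2
    have hlim := ENNReal.Tendsto.const_mul (a := (‖(jetEquiv e).toContinuousLinearMap‖₊ : ℝ≥0∞))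
      (h1'.add h2') (Or.inr ENNReal.coe_ne_top)
    rw [add_zero, mul_zero] at hlim
    refine tendsto_of_tendsto_of_tendsto_of_le_of_le tendsto_const_nhds hlim (fun _ => bot_le)
      fun k => ?_
    have hle : ∀ z, ‖jet e (φ k) (fderiv ℝ (φ k)) z - jet e u Du z‖₊ ≤
        ‖(jetEquiv e).toContinuousLinearMap‖₊ *
          ‖(‖φ k z - u z‖ + ‖fderiv ℝ (φ k) z - Du z‖ : ℝ)‖₊ := by
      intro z
      rw [jet_sub]
      refine ((jetEquiv e).toContinuousLinearMap.le_opNNNorm _).trans ?_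
      gcongr
      rw [← NNReal.coe_le_coe, coe_nnnorm, coe_nnnorm, Real.norm_of_nonneg (by positivity),
        Prod.norm_def]
      exact max_le_add_of_nonneg (norm_nonneg _) (norm_nonneg _)
    refine (eLpNorm_le_nnreal_smul_eLpNorm_of_ae_le_mul (Eventually.of_forall hle) 2).trans ?_
    rw [ENNReal.smul_def, smul_eq_mul]
    gcongr
    have h3 : AEStronglyMeasurable (fun z => ‖φ k z - u z‖) ν :=
      ((hφ k).sub hu).aestronglyMeasurable.norm
    have h4 : AEStronglyMeasurable (fun z => ‖fderiv ℝ (φ k) z - Du z‖) ν :=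
      ((hφ' k).sub hDu).aestronglyMeasurable.norm
    refine (eLpNorm_add_le h3 h4 (by norm_num)).trans ?_
    rw [eLpNorm_norm, eLpNorm_norm]
  · intro h
    have hlim := ENNReal.Tendsto.const_mul
      (a := (‖(jetEquiv e).symm.toContinuousLinearMap‖₊ : ℝ≥0∞)) h (Or.inr ENNReal.coe_ne_top)
    rw [mul_zero] at hlim
    have hle : ∀ k z, ‖(φ k z - u z, fderiv ℝ (φ k) z - Du z)‖₊ ≤
        ‖(jetEquiv e).symm.toContinuousLinearMap‖₊ *
          ‖jet e (φ k) (fderiv ℝ (φ k)) z - jet e u Du z‖₊ := by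
      intro k z
      have := (jetEquiv e).symm.toContinuousLinearMap.le_opNNNorm
        (jet e (φ k) (fderiv ℝ (φ k)) z - jet e u Du z)
      rw [jet_sub] at this ⊢
      simpa using this
    refine ⟨hν.tendsto_eLpNorm ?_, hν.tendsto_eLpNorm ?_⟩
    · refine tendsto_of_tendsto_of_tendsto_of_le_of_le tendsto_const_nhds hlim (fun _ => bot_le)
        fun k => ?_
      refine eLpNorm_le_nnreal_smul_eLpNorm_of_ae_le_mul (Eventually.of_forall fun z => ?_) 2
      exact (norm_fst_le (φ k z - u z, fderiv ℝ (φ k) z - Du z)).trans (hle k z)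
    · refine tendsto_of_tendsto_of_tendsto_of_le_of_le tendsto_const_nhds hlim (fun _ => bot_le)
        fun k => ?_
      refine eLpNorm_le_nnreal_smul_eLpNorm_of_ae_le_mul (Eventually.of_forall fun z => ?_) 2
      exact (norm_snd_le (φ k z - u z, fderiv ℝ (φ k) z - Du z)).trans (hle k z)

variable [BorelSpace F] [(volume : Measure F).IsAddHaarMeasure]

theorem memLp_of_compactlySupported {k : WithTop ℕ∞} (hk : k ≠ 0)
    (hν : Comparable (volume.restrict U) ν) {φ : F → ℝ} (hφ : φ ∈ CompactlySupported k U') :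
    MemLp φ 2 ν ∧ MemLp (fderiv ℝ φ) 2 ν :=
  ⟨hν.memLp ((hφ.1.continuous.memLp_of_hasCompactSupport hφ.2.1).restrict U),
    hν.memLp (((hφ.1.continuous_fderiv hk).memLp_of_hasCompactSupport
        (hφ.2.1.fderiv ℝ)).restrict U)⟩

/-- ψ is supported in U, so both integrals extend to the whole space, where integration by parts has
no boundary term; φ itself may be nonzero on the boundary of U. -/
theorem isWeakDifferential_of_contDiff {φ ψ : F → ℝ} (hφ : ContDiff ℝ 1 φ)
    (hψ : ψ ∈ CompactlySupported ∞ U) (v : F) :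
    ∫ z in U, φ z * fderiv ℝ ψ z v = - ∫ z in U, fderiv ℝ φ z v * ψ z := by
  obtain ⟨h1, h2, h3⟩ := hψ
  have hd : Continuous (fderiv ℝ φ) := hφ.continuous_fderiv one_ne_zero
  have hd' : Continuous (fderiv ℝ ψ) := h1.continuous_fderiv (by simp)
  have hc := hφ.continuous
  have hc' := h1.continuous
  have hs' : HasCompactSupport (fun z => fderiv ℝ ψ z v) :=
    (h2.fderiv ℝ).comp_left (g := fun L : F →L[ℝ] ℝ => L v) rfl
  rw [setIntegral_eq_integral_of_forall_compl_eq_zero,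
    setIntegral_eq_integral_of_forall_compl_eq_zero]
  · refine integral_mul_fderiv_eq_neg_fderiv_mul_of_integrable ?_ ?_ ?_
      (fun x _ => hφ.differentiable one_ne_zero x) (fun x _ => h1.differentiable (by simp) x)
    · exact Continuous.integrable_of_hasCompactSupport (by fun_prop) h2.mul_left
    · exact Continuous.integrable_of_hasCompactSupport (by fun_prop) hs'.mul_left
    · exact Continuous.integrable_of_hasCompactSupport (by fun_prop) h2.mul_left
  · intro x hx
    rw [image_eq_zero_of_notMem_tsupport fun h => hx (h3 h), mul_zero]
  · intro x hx
    rw [image_eq_zero_of_notMem_tsupport (f := fderiv ℝ ψ)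
      fun h => hx (h3 (tsupport_fderiv_subset ℝ h))]
    simp

/-- Both sides of the integration by parts formula are continuous along H¹ convergence. The
approximants may be supported in a larger set U', as on the half-cylinder. -/
theorem isWeakDifferential_of_tendstoH1 {φ : ℕ → F → ℝ} {u : F → ℝ}
    {Du : F → F →L[ℝ] ℝ} (hφ : ∀ k, φ k ∈ CompactlySupported 1 U')
    (hu : MemLp u 2 (volume.restrict U)) (hDu : MemLp Du 2 (volume.restrict U))
    (h : TendstoH1 U φ u Du) : IsWeakDifferential U u Du := by
  intro ψ hψ v
  have hcomp : Comparable (volume.restrict U) (volume.restrict U) :=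
    ⟨1, ENNReal.one_ne_top, by simp, by simp⟩
  have hψm := memLp_of_compactlySupported (k := ∞) (by simp) hcomp hψ
  have hm := fun k => memLp_of_compactlySupported one_ne_zero hcomp (hφ k)
  let ev : (F →L[ℝ] ℝ) →L[ℝ] ℝ := ContinuousLinearMap.apply ℝ ℝ v
  have h1 := tendsto_integral_mul_of_tendsto_eLpNorm (fun k => (hm k).1) hu
    (ev.comp_memLp' hψm.2) h.1
  have hlim : Tendsto (fun k => eLpNorm (fun z => ev (fderiv ℝ (φ k) z) - ev (Du z)) 2
      (volume.restrict U)) atTop (𝓝 0) := by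
    have hl := ENNReal.Tendsto.const_mul (a := (‖ev‖₊ : ℝ≥0∞)) h.2 (Or.inr ENNReal.coe_ne_top)
    rw [mul_zero] at hl
    refine tendsto_of_tendsto_of_tendsto_of_le_of_le tendsto_const_nhds hl (fun _ => bot_le)
      fun k => ?_
    refine eLpNorm_le_nnreal_smul_eLpNorm_of_ae_le_mul (Eventually.of_forall fun z => ?_) 2
    rw [← map_sub]
    exact ev.le_opNNNorm _
  have h2 := tendsto_integral_mul_of_tendsto_eLpNorm (fun k => ev.comp_memLp' (hm k).2)
    (ev.comp_memLp' hDu) hψm.1 hlim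
  have heq : ∀ k, ∫ z in U, φ k z * ev (fderiv ℝ ψ z) = - ∫ z in U, ev (fderiv ℝ (φ k) z) * ψ z :=
    fun k => isWeakDifferential_of_contDiff (hφ k).1 hψ v
  exact tendsto_nhds_unique (h1.congr heq) h2.neg

/-- The classes in `L²` of the `1`-jets of test functions. -/
noncomputable def testJets (e : Module.Basis ι ℝ F) (k : WithTop ℕ∞) (hk : k ≠ 0) (U' : Set F)
    (ν : Measure F) : Submodule ℝ (Lp (Jet ι) 2 ν) where
  carrier := {G | ∃ φ ∈ CompactlySupported k U', G =ᵐ[ν] jet e φ (fderiv ℝ φ)}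
  add_mem' := by
    rintro G G' ⟨φ, hφ, h⟩ ⟨φ', hφ', h'⟩
    refine ⟨φ + φ', ⟨hφ.1.add hφ'.1, hφ.2.1.add hφ'.2.1,
      (tsupport_add φ φ').trans (Set.union_subset hφ.2.2 hφ'.2.2)⟩, ?_⟩
    filter_upwards [Lp.coeFn_add G G', h, h'] with z hz h h'
    rw [hz, Pi.add_apply, h, h', jet, jet, jet, ← map_add,
      fderiv_add (hφ.1.differentiable hk z) (hφ'.1.differentiable hk z)]
    rfl
  zero_mem' := by
    refine ⟨0, ⟨contDiff_const, HasCompactSupport.zero, by simp⟩, ?_⟩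
    filter_upwards [Lp.coeFn_zero (Jet ι) 2 ν] with z hz
    rw [hz, jet, Pi.zero_apply, show (0 : F → ℝ) = fun _ => (0 : ℝ) from rfl, fderiv_const_apply]
    exact (map_zero _).symm
  smul_mem' := by
    rintro c G ⟨φ, hφ, h⟩
    refine ⟨c • φ, ⟨contDiff_const.smul hφ.1, hφ.2.1.smul_left (f := fun _ => c),
      (tsupport_smul_subset_right (fun _ => c) φ).trans hφ.2.2⟩, ?_⟩
    filter_upwards [Lp.coeFn_smul c G, h] with z hz h
    rw [hz, Pi.smul_apply, h, jet, jet, ← map_smul, fderiv_const_smul (hφ.1.differentiable hk z)]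
    rfl

/-- This trades the sequential definition of H¹₀ for a closed subspace of a Hilbert space. In the
converse direction the weak differential condition is automatic, being inherited from the
approximating test functions. -/
theorem memH1Closure_iff (e : Module.Basis ι ℝ F) {k : WithTop ℕ∞} (hk : 1 ≤ k) (hk' : k ≠ 0)
    (hν : Comparable (volume.restrict U) ν) {u : F → ℝ} {Du : F → F →L[ℝ] ℝ} :
    MemH1Closure U (CompactlySupported k U') u Du ↔
      ∃ G ∈ (testJets e k hk' U' ν).topologicalClosure, G =ᵐ[ν] jet e u Du := by
  constructor
  · rintro ⟨⟨h1, h2, -⟩, φ, hφ, hlim⟩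
    have hm := fun k => memLp_of_compactlySupported hk' hν (hφ k)
    have hmj := fun k => (memLp_jet_iff e).2 (hm k)
    have hu := (memLp_jet_iff e).2 ⟨hν.memLp h1, hν.memLp h2⟩
    refine ⟨hu.toLp _, ?_, hu.coeFn_toLp⟩
    refine mem_closure_of_tendsto (f := fun k => (hmj k).toLp _) (b := atTop) ?_
      (Eventually.of_forall fun k => ⟨φ k, hφ k, (hmj k).coeFn_toLp⟩)
    rw [Lp.tendsto_Lp_iff_tendsto_eLpNorm'']
    exact (tendstoH1_iff e hν (fun k => (hm k).1) (fun k => (hm k).2) (hν.memLp h1)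
      (hν.memLp h2)).1 hlim
  · rintro ⟨G, hG, hGu⟩
    have hu : MemLp (jet e u Du) 2 ν := (memLp_congr_ae hGu).1 (Lp.memLp G)
    obtain ⟨h1, h2⟩ := (memLp_jet_iff e).1 hu
    obtain ⟨x, hx, hlim⟩ := mem_closure_iff_seq_limit.1 hG
    choose φ hφ hxφ using hx
    have hm := fun k => memLp_of_compactlySupported hk' hν (hφ k)
    have hH1 : TendstoH1 U φ u Du := by
      rw [tendstoH1_iff e hν (fun k => (hm k).1) (fun k => (hm k).2) h1 h2]
      rw [Lp.tendsto_Lp_iff_tendsto_eLpNorm'] at hlim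
      exact hlim.congr fun k => eLpNorm_congr_ae ((hxφ k).sub hGu)
    refine ⟨⟨hν.symm.memLp h1, hν.symm.memLp h2, ?_⟩, φ, hφ, hH1⟩
    exact isWeakDifferential_of_tendstoH1 (fun k => ⟨(hφ k).1.of_le hk, (hφ k).2⟩)
      (hν.symm.memLp h1) (hν.symm.memLp h2) hH1

end Jets

/-! ### Energy forms on jets -/

section Form

open scoped InnerProductSpace

variable {ι : Type*} [Fintype ι]

/-- The energy density `a^{ij} p_i q_j + V u v`. -/
def energyDensity (a : Matrix ι ι ℝ) (V : ℝ) (J J' : Jet ι) : ℝ :=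
  (∑ i, ∑ j, a i j * J (some i) * J' (some j)) + V * J none * J' none

/-- Bounded measurable symmetric uniformly elliptic coefficients, with a nonnegative potential. -/
structure IsEllipticCoef {α : Type*} [MeasurableSpace α] (ν : Measure α) (a : α → Matrix ι ι ℝ)
    (V : α → ℝ) : Prop where
  measurable : ∀ i j, AEStronglyMeasurable (fun z => a z i j) ν
  measurable_potential : AEStronglyMeasurable V ν
  symm : ∀ᵐ z ∂ν, ∀ i j, a z i j = a z j i
  bounded : ∃ K : ℝ, 0 ≤ K ∧ ∀ᵐ z ∂ν, (∀ i j, |a z i j| ≤ K) ∧ |V z| ≤ K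
  elliptic : ∃ c : ℝ, 0 < c ∧ ∀ᵐ z ∂ν, ∀ ξ : ι → ℝ,
    c * ∑ i, ξ i ^ 2 ≤ ∑ i, ∑ j, a z i j * ξ i * ξ j
  nonneg : ∀ᵐ z ∂ν, 0 ≤ V z

theorem norm_sq_jet (J : Jet ι) : ‖J‖ ^ 2 = J none ^ 2 + ∑ i, J (some i) ^ 2 := by
  rw [EuclideanSpace.norm_sq_eq, Fintype.sum_option]
  simp

/-- The numerical factor counts the derivative terms and the single potential term. -/
theorem abs_energyDensity_le {a : Matrix ι ι ℝ} {V K : ℝ} (hK : 0 ≤ K) (ha : ∀ i j, |a i j| ≤ K)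
    (hV : |V| ≤ K) (J J' : Jet ι) :
    |energyDensity a V J J'| ≤ (Fintype.card ι ^ 2 + 1) * K * (‖J‖ * ‖J'‖) := by
  have hc : ∀ (J : Jet ι) o, |J o| ≤ ‖J‖ := fun J o => PiLp.norm_apply_le J o
  have hterm : ∀ (t : ℝ) (o o' : Option ι), |t| ≤ K → |t * J o * J' o'| ≤ K * (‖J‖ * ‖J'‖) := by
    intro t o o' ht
    rw [abs_mul, abs_mul, mul_assoc]
    gcongr
    · exact hc J o
    · exact hc J' o'
  calc |energyDensity a V J J'|
      ≤ (∑ i : ι, ∑ j : ι, K * (‖J‖ * ‖J'‖)) + K * (‖J‖ * ‖J'‖) := by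
        refine (abs_add_le _ _).trans (add_le_add ?_ (hterm _ _ _ hV))
        refine (Finset.abs_sum_le_sum_abs _ _).trans (Finset.sum_le_sum fun i _ => ?_)
        exact (Finset.abs_sum_le_sum_abs _ _).trans
          (Finset.sum_le_sum fun j _ => hterm _ _ _ (ha i j))
    _ = _ := by
        simp only [Finset.sum_const, Finset.card_univ, nsmul_eq_mul]
        ring

theorem energyDensity_symm {a : Matrix ι ι ℝ} (ha : ∀ i j, a i j = a j i) (V : ℝ) (J J' : Jet ι) :
    energyDensity a V J J' = energyDensity a V J' J := by
  unfold energyDensity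
  rw [Finset.sum_comm]
  congr 1
  · refine Finset.sum_congr rfl fun i _ => Finset.sum_congr rfl fun j _ => ?_
    rw [ha j i]; ring
  · ring

variable {α : Type*} [MeasurableSpace α] {ν : Measure α} {a : α → Matrix ι ι ℝ} {V : α → ℝ}

theorem IsEllipticCoef.aestronglyMeasurable (h : IsEllipticCoef ν a V) {G G' : α → Jet ι}
    (hG : AEStronglyMeasurable G ν) (hG' : AEStronglyMeasurable G' ν) :
    AEStronglyMeasurable (fun z => energyDensity (a z) (V z) (G z) (G' z)) ν := by
  have hc : ∀ {G : α → Jet ι}, AEStronglyMeasurable G ν → ∀ o,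
      AEStronglyMeasurable (fun z => G z o) ν := fun hG o =>
    (EuclideanSpace.proj (𝕜 := ℝ) o).continuous.comp_aestronglyMeasurable hG
  unfold energyDensity
  refine AEStronglyMeasurable.add ?_ ((h.measurable_potential.mul (hc hG _)).mul (hc hG' _))
  refine Finset.aestronglyMeasurable_fun_sum _ fun i _ =>
    Finset.aestronglyMeasurable_fun_sum _ fun j _ => ?_
  exact ((h.measurable i j).mul (hc hG _)).mul (hc hG' _)

theorem IsEllipticCoef.integrable (h : IsEllipticCoef ν a V) {G G' : α → Jet ι}
    (hG : MemLp G 2 ν) (hG' : MemLp G' 2 ν) :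
    Integrable (fun z => energyDensity (a z) (V z) (G z) (G' z)) ν := by
  obtain ⟨K, hK, hb⟩ := h.bounded
  refine Integrable.mono' ((hG.norm.integrable_mul hG'.norm).const_mul
    ((Fintype.card ι ^ 2 + 1) * K)) (h.aestronglyMeasurable hG.1 hG'.1) ?_
  filter_upwards [hb] with z hz
  exact abs_energyDensity_le hK hz.1 hz.2 _ _

theorem integral_norm_mul_norm_le {E : Type*} [NormedAddCommGroup E] (G G' : Lp E 2 ν) :
    ∫ z, ‖G z‖ * ‖G' z‖ ∂ν ≤ ‖G‖ * ‖G'‖ := by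
  have h1 := Lp.memLp G
  have h2 := Lp.memLp G'
  have h := eLpNorm_le_eLpNorm_mul_eLpNorm_of_nnnorm (μ := ν) (p := 2) (q := 2) (r := 1)
    h1.1 h2.1 (fun a b : E => ‖a‖ * ‖b‖) 1 (Eventually.of_forall fun x => by simp)
  rw [ENNReal.coe_one, one_mul, eLpNorm_one_eq_lintegral_enorm] at h
  have hint : Integrable (fun z => ‖G z‖ * ‖G' z‖) ν := h1.norm.integrable_mul h2.norm
  rw [Lp.norm_def, Lp.norm_def, ← ENNReal.toReal_mul,
    integral_eq_lintegral_of_nonneg_ae (Eventually.of_forall fun z => by positivity) hint.1]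
  refine ENNReal.toReal_mono (ENNReal.mul_ne_top h1.eLpNorm_ne_top h2.eLpNorm_ne_top) ?_
  refine le_trans (lintegral_mono fun z => ?_) h
  rw [← ofReal_norm]
  exact ENNReal.ofReal_le_ofReal (le_abs_self _)

theorem IsEllipticCoef.exists_form (h : IsEllipticCoef ν a V) :
    ∃ B : Lp (Jet ι) 2 ν →L[ℝ] Lp (Jet ι) 2 ν →L[ℝ] ℝ,
      (∀ G G', B G G' = ∫ z, energyDensity (a z) (V z) (G z) (G' z) ∂ν) ∧
      ∀ G G', B G G' = B G' G := by
  obtain ⟨K, hK, hb⟩ := h.bounded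
  have hint : ∀ G G' : Lp (Jet ι) 2 ν,
      Integrable (fun z => energyDensity (a z) (V z) (G z) (G' z)) ν :=
    fun G G' => h.integrable (Lp.memLp G) (Lp.memLp G')
  have hadd : ∀ G₁ G₂ G' : Lp (Jet ι) 2 ν,
      ∫ z, energyDensity (a z) (V z) ((G₁ + G₂ : Lp (Jet ι) 2 ν) z) (G' z) ∂ν =
        ∫ z, energyDensity (a z) (V z) (G₁ z) (G' z) ∂ν +
          ∫ z, energyDensity (a z) (V z) (G₂ z) (G' z) ∂ν := by
    intro G₁ G₂ G'
    rw [← integral_add (hint _ _) (hint _ _)]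
    refine integral_congr_ae ?_
    filter_upwards [Lp.coeFn_add G₁ G₂] with z hz
    simp only [hz, energyDensity, Pi.add_apply, PiLp.add_apply, mul_add, add_mul,
      Finset.sum_add_distrib]
    ring
  have hsmul : ∀ (c : ℝ) (G G' : Lp (Jet ι) 2 ν),
      ∫ z, energyDensity (a z) (V z) ((c • G : Lp (Jet ι) 2 ν) z) (G' z) ∂ν =
        c * ∫ z, energyDensity (a z) (V z) (G z) (G' z) ∂ν := by
    intro c G G'
    rw [← integral_const_mul]
    refine integral_congr_ae ?_
    filter_upwards [Lp.coeFn_smul c G] with z hz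
    simp only [hz, energyDensity, Pi.smul_apply, PiLp.smul_apply, smul_eq_mul, mul_add,
      Finset.mul_sum]
    congr 1
    · refine Finset.sum_congr rfl fun i _ => Finset.sum_congr rfl fun j _ => ?_
      ring
    · ring
  have hsymm : ∀ G G' : Lp (Jet ι) 2 ν,
      ∫ z, energyDensity (a z) (V z) (G z) (G' z) ∂ν =
        ∫ z, energyDensity (a z) (V z) (G' z) (G z) ∂ν := by
    intro G G'
    refine integral_congr_ae ?_
    filter_upwards [h.symm] with z hz
    exact energyDensity_symm hz _ _ _
  let B₀ : Lp (Jet ι) 2 ν →ₗ[ℝ] Lp (Jet ι) 2 ν →ₗ[ℝ] ℝ :=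
    LinearMap.mk₂ ℝ (fun G G' => ∫ z, energyDensity (a z) (V z) (G z) (G' z) ∂ν) hadd hsmul
      (fun G G₁ G₂ => by simp only [hsymm G]; exact hadd _ _ _)
      (fun c G G' => by simp only [hsymm G]; exact hsmul _ _ _)
  refine ⟨B₀.mkContinuous₂ ((Fintype.card ι ^ 2 + 1) * K) fun G G' => ?_, fun G G' => rfl,
    hsymm⟩
  change ‖∫ z, energyDensity (a z) (V z) (G z) (G' z) ∂ν‖ ≤ _
  calc ‖∫ z, energyDensity (a z) (V z) (G z) (G' z) ∂ν‖
      ≤ ∫ z, (Fintype.card ι ^ 2 + 1) * K * (‖G z‖ * ‖G' z‖) ∂ν := by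
        refine norm_integral_le_of_norm_le
          (((Lp.memLp G).norm.integrable_mul (Lp.memLp G').norm).const_mul _) ?_
        filter_upwards [hb] with z hz
        exact abs_energyDensity_le hK hz.1 hz.2 _ _
    _ ≤ (Fintype.card ι ^ 2 + 1) * K * (‖G‖ * ‖G'‖) := by
        rw [integral_const_mul]
        gcongr
        exact integral_norm_mul_norm_le G G'
    _ = _ := by ring

theorem integrable_sq_apply {G : α → Jet ι} (hG : MemLp G 2 ν) (o : Option ι) :
    Integrable (fun z => G z o ^ 2) ν :=
  ((EuclideanSpace.proj (𝕜 := ℝ) o).comp_memLp' hG).integrable_sq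

theorem norm_sq_Lp_jet (G : Lp (Jet ι) 2 ν) :
    ‖G‖ ^ 2 = ∫ z, G z none ^ 2 ∂ν + ∫ z, ∑ i, G z (some i) ^ 2 ∂ν := by
  have hm := Lp.memLp G
  rw [← real_inner_self_eq_norm_sq, L2.inner_def, ← integral_add (integrable_sq_apply hm _)
    (integrable_finsetSum _ fun i _ => integrable_sq_apply hm _)]
  simp only [real_inner_self_eq_norm_sq, norm_sq_jet]

/-- Coercivity of the energy form on a jet satisfying a Poincaré inequality. -/
theorem IsEllipticCoef.exists_coercive (h : IsEllipticCoef ν a V) {K : ℝ} (hK : 0 ≤ K) :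
    ∃ c > 0, ∀ G : Lp (Jet ι) 2 ν,
      ∫ z, G z none ^ 2 ∂ν ≤ K * ∫ z, ∑ i, G z (some i) ^ 2 ∂ν →
      c * ‖G‖ ^ 2 ≤ ∫ z, energyDensity (a z) (V z) (G z) (G z) ∂ν := by
  obtain ⟨c, hc, he⟩ := h.elliptic
  -- The assumed inequality gives ‖G‖² ≤ (1 + K) times the squared derivative part, which
  -- ellipticity controls with constant c.
  refine ⟨c / (1 + K), by positivity, fun G hG => ?_⟩
  have hm := Lp.memLp G
  have hS : Integrable (fun z => ∑ i, G z (some i) ^ 2) ν :=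
    integrable_finsetSum _ fun i _ => integrable_sq_apply hm _
  have h1 : c * ∫ z, ∑ i, G z (some i) ^ 2 ∂ν ≤ ∫ z, energyDensity (a z) (V z) (G z) (G z) ∂ν := by
    rw [← integral_const_mul]
    refine integral_mono_ae (hS.const_mul c) (h.integrable hm hm) ?_
    filter_upwards [he, h.nonneg] with z hz hV
    have := hz fun i => G z (some i)
    unfold energyDensity
    nlinarith [mul_nonneg hV (sq_nonneg (G z none))]
  rw [norm_sq_Lp_jet, div_mul_eq_mul_div, div_le_iff₀ (by positivity)]
  nlinarith

end Form

/-! ### The Poincaré inequality for jets -/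

section Poincare

variable {F : Type*} [NormedAddCommGroup F] [NormedSpace ℝ F] [FiniteDimensional ℝ F]
  {ι : Type*} [Fintype ι]

theorem exists_norm_sq_le_sum (e : Module.Basis ι ℝ F) :
    ∃ M : ℝ, 0 ≤ M ∧ ∀ L : F →L[ℝ] ℝ, ‖L‖ ^ 2 ≤ M * ∑ i, L (e i) ^ 2 := by
  refine ⟨‖(jetEquiv e).symm.toContinuousLinearMap‖ ^ 2, by positivity, fun L => ?_⟩
  have h1 := (jetEquiv e).symm.toContinuousLinearMap.le_opNorm (jetEquiv e (0, L))
  have h2 : ‖L‖ ≤ ‖((0 : ℝ), L)‖ := norm_snd_le (0, L)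
  have h3 : ‖jetEquiv e (0, L)‖ ^ 2 = ∑ i, L (e i) ^ 2 := by
    rw [norm_sq_jet]
    simp [jetEquiv]
  rw [← h3, ← mul_pow]
  refine pow_le_pow_left₀ (norm_nonneg _) (h2.trans ?_) 2
  simpa using h1

variable [MeasureSpace F] [BorelSpace F] [(volume : Measure F).IsAddHaarMeasure]
  {U U' : Set F} {ν : Measure F}

/-- The Poincaré inequality for jets of test functions, with respect to a measure comparable to
Lebesgue measure. -/
theorem exists_poincare_testJets (e : Module.Basis ι ℝ F) {k : WithTop ℕ∞} (hk : k ≠ 0)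
    (hν : Comparable (volume.restrict U) ν)
    (hP : ∃ K : ℝ≥0∞, K ≠ ⊤ ∧ ∀ φ ∈ CompactlySupported k U',
      ∫⁻ z in U, ‖φ z‖ₑ ^ 2 ≤ K * ∫⁻ z in U, ‖fderiv ℝ φ z‖ₑ ^ 2) :
    ∃ K : ℝ, 0 ≤ K ∧ ∀ G ∈ testJets e k hk U' ν,
      ∫ z, G z none ^ 2 ∂ν ≤ K * ∫ z, ∑ i, G z (some i) ^ 2 ∂ν := by
  obtain ⟨K, hK, hP⟩ := hP
  obtain ⟨M, hM, hL⟩ := exists_norm_sq_le_sum e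
  obtain ⟨C₁, hC₁, hle₁⟩ := hν.symm.lintegral_le
  obtain ⟨C₂, hC₂, hle₂⟩ := hν.lintegral_le
  -- The factors pass from ν to Lebesgue measure, apply Poincaré, return to ν, and bound the
  -- operator norm of the differential by its coordinates.
  set A : ℝ≥0∞ := C₁ * K * C₂ * ENNReal.ofReal M
  have hA : A ≠ ⊤ := by finiteness
  refine ⟨A.toReal, ENNReal.toReal_nonneg, ?_⟩
  rintro G ⟨φ, hφ, hG⟩
  have hm := Lp.memLp G
  have hI := integrable_sq_apply hm none
  have hS : Integrable (fun z => ∑ i, G z (some i) ^ 2) ν :=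
    integrable_finsetSum _ fun i _ => integrable_sq_apply hm _
  have hS0 : 0 ≤ ∫ z, ∑ i, G z (some i) ^ 2 ∂ν :=
    integral_nonneg fun z => Finset.sum_nonneg fun i _ => sq_nonneg _
  have key : ENNReal.ofReal (∫ z, G z none ^ 2 ∂ν) ≤
      A * ENNReal.ofReal (∫ z, ∑ i, G z (some i) ^ 2 ∂ν) := by
    rw [ofReal_integral_eq_lintegral_ofReal hI (Eventually.of_forall fun z => sq_nonneg _),
      ofReal_integral_eq_lintegral_ofReal hS
        (Eventually.of_forall fun z => Finset.sum_nonneg fun i _ => sq_nonneg _)]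
    calc ∫⁻ z, ENNReal.ofReal (G z none ^ 2) ∂ν = ∫⁻ z, ‖φ z‖ₑ ^ 2 ∂ν := by
          refine lintegral_congr_ae ?_
          filter_upwards [hG] with z hz
          rw [hz, jet_none, ← ofReal_norm, ← ENNReal.ofReal_pow (norm_nonneg _),
            Real.norm_eq_abs, sq_abs]
      _ ≤ C₁ * ∫⁻ z in U, ‖φ z‖ₑ ^ 2 := hle₁ _
      _ ≤ C₁ * (K * ∫⁻ z in U, ‖fderiv ℝ φ z‖ₑ ^ 2) := by gcongr; exact hP φ hφ
      _ ≤ C₁ * (K * (C₂ * ∫⁻ z, ‖fderiv ℝ φ z‖ₑ ^ 2 ∂ν)) := by gcongr; exact hle₂ _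
      _ ≤ C₁ * (K * (C₂ * ∫⁻ z, ENNReal.ofReal M *
            ENNReal.ofReal (∑ i, G z (some i) ^ 2) ∂ν)) := by
          refine mul_le_mul' le_rfl (mul_le_mul' le_rfl (mul_le_mul' le_rfl
            (lintegral_mono_ae ?_)))
          filter_upwards [hG] with z hz
          rw [hz, ← ofReal_norm, ← ENNReal.ofReal_pow (norm_nonneg _), ← ENNReal.ofReal_mul hM]
          exact ENNReal.ofReal_le_ofReal (hL _)
      _ = A * ∫⁻ z, ENNReal.ofReal (∑ i, G z (some i) ^ 2) ∂ν := by
          rw [lintegral_const_mul' _ _ ENNReal.ofReal_ne_top]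
          simp only [A]
          ring
  rw [← ENNReal.ofReal_toReal hA, ← ENNReal.ofReal_mul ENNReal.toReal_nonneg] at key
  exact (ENNReal.ofReal_le_ofReal_iff (by positivity)).1 key

end Poincare

/-! ### Elliptic metrics -/

section Metric

open scoped Matrix

variable {n : ℕ} {Ω : Set (Space n)} {g : Space n → Matrix (Fin n) (Fin n) ℝ} {V : Space n → ℝ}

theorem IsEllipticMetric.continuousOn (hg : IsEllipticMetric Ω g) :
    ContinuousOn g (closure Ω) :=
  continuousOn_pi.2 fun i => continuousOn_pi.2 fun j => (hg.smooth i j).continuousOn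

/-- Ellipticity is given on Ω only and extends to the closure by continuity of g. On the compact
closure this yields uniform bounds for the inverse metric and for the density. -/
theorem IsEllipticMetric.exists_lower_bound_closure (hg : IsEllipticMetric Ω g) :
    ∃ lam : ℝ, 0 < lam ∧ ∀ x ∈ closure Ω, ∀ ξ : Fin n → ℝ,
      lam * ∑ i, ξ i ^ 2 ≤ ∑ i, ∑ j, g x i j * ξ i * ξ j := by
  obtain ⟨lam, h0, -, h⟩ := hg.elliptic
  refine ⟨lam, h0, fun x hx ξ => ?_⟩
  refine le_on_closure (f := fun _ => lam * ∑ i, ξ i ^ 2)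
    (g := fun x => ∑ i, ∑ j, g x i j * ξ i * ξ j) (fun y hy => ?_) continuousOn_const ?_ hx
  · have := (h y hy (WithLp.toLp 2 ξ)).1
    rw [EuclideanSpace.norm_sq_eq] at this
    simpa using this
  · refine continuousOn_finsetSum _ fun i _ => continuousOn_finsetSum _ fun j _ => ?_
    exact ((hg.smooth i j).continuousOn.mul continuousOn_const).mul continuousOn_const

theorem IsEllipticMetric.posDef (hg : IsEllipticMetric Ω g) {x : Space n} (hx : x ∈ closure Ω) :
    (g x).PosDef := by
  obtain ⟨lam, h0, h⟩ := hg.exists_lower_bound_closure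
  rw [Matrix.posDef_iff_dotProduct_mulVec]
  refine ⟨?_, fun ξ hξ => ?_⟩
  · rw [Matrix.IsHermitian, Matrix.conjTranspose_eq_transpose_of_trivial]
    exact hg.symm x hx
  · have h1 := h x hx ξ
    have h2 : 0 < ∑ i, ξ i ^ 2 := by
      obtain ⟨i, hi⟩ := Function.ne_iff.1 hξ
      exact Finset.sum_pos' (fun j _ => sq_nonneg _) ⟨i, Finset.mem_univ _, by
        have : ξ i ≠ 0 := hi
        positivity⟩
    have h3 : star ξ ⬝ᵥ (g x *ᵥ ξ) = ∑ i, ∑ j, g x i j * ξ i * ξ j := by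
      simp only [dotProduct, Matrix.mulVec, Finset.mul_sum, star_trivial]
      exact Finset.sum_congr rfl fun i _ => Finset.sum_congr rfl fun j _ => by ring
    rw [h3]
    exact lt_of_lt_of_le (by positivity) h1

theorem IsEllipticMetric.continuousOn_inv (hg : IsEllipticMetric Ω g) :
    ContinuousOn (fun x => (g x)⁻¹) (closure Ω) := by
  simp only [Matrix.inv_def, Ring.inverse_eq_inv']
  refine ContinuousOn.smul (ContinuousOn.inv₀ ?_ fun x hx => (hg.posDef hx).det_pos.ne') ?_
  · exact (continuous_id.matrix_det).comp_continuousOn hg.continuousOn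
  · exact (continuous_id.matrix_adjugate).comp_continuousOn hg.continuousOn

theorem exists_abs_le_of_continuousOn {K : Set (Space n)} (hK : IsCompact K) {f : Space n → ℝ}
    (hf : ContinuousOn f K) : ∃ C : ℝ, 0 ≤ C ∧ ∀ x ∈ K, |f x| ≤ C := by
  obtain ⟨C, hC⟩ := hK.exists_bound_of_continuousOn hf
  exact ⟨max C 0, le_max_right _ _, fun x hx => (hC x hx).trans (le_max_left _ _)⟩

theorem exists_abs_entry_le {K : Set (Space n)} (hK : IsCompact K)
    {a : Space n → Matrix (Fin n) (Fin n) ℝ} (ha : ContinuousOn a K) :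
    ∃ C : ℝ, 0 ≤ C ∧ ∀ x ∈ K, ∀ i j, |a x i j| ≤ C := by
  have hij : ∀ i j, ContinuousOn (fun x => a x i j) K := fun i j =>
    continuousOn_pi.1 (continuousOn_pi.1 ha i) j
  choose C hC0 hC using fun i j => exists_abs_le_of_continuousOn hK (hij i j)
  refine ⟨∑ i, ∑ j, C i j, Finset.sum_nonneg fun i _ => Finset.sum_nonneg fun j _ => hC0 i j,
    fun x hx i j => (hC i j x hx).trans ?_⟩
  refine (Finset.single_le_sum (f := fun j => C i j) (fun j _ => hC0 i j)
    (Finset.mem_univ j)).trans ?_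
  exact Finset.single_le_sum (f := fun i => ∑ j, C i j)
    (fun i _ => Finset.sum_nonneg fun j _ => hC0 i j) (Finset.mem_univ i)

theorem IsEllipticMetric.exists_lower_bound_inv (hg : IsEllipticMetric Ω g)
    (hb : Bornology.IsBounded Ω) :
    ∃ c : ℝ, 0 < c ∧ ∀ x ∈ closure Ω, ∀ ξ : Fin n → ℝ,
      c * ∑ i, ξ i ^ 2 ≤ ∑ i, ∑ j, (g x)⁻¹ i j * ξ i * ξ j := by
  obtain ⟨lam, h0, h⟩ := hg.exists_lower_bound_closure
  obtain ⟨C, hC0, hC⟩ := exists_abs_entry_le hb.isCompact_closure hg.continuousOn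
  -- With η = g⁻¹ξ the form of g⁻¹ at ξ is that of g at η, so it is at least lam |η|², while ξ = gη
  -- and |g_ij| ≤ C give |ξ|² ≤ n²C² |η|². The summand 1 keeps the denominator positive.
  refine ⟨lam / (n * (n * C ^ 2) + 1), by positivity, fun x hx ξ => ?_⟩
  have hu : IsUnit (g x).det := (hg.posDef hx).det_pos.ne'.isUnit
  set η := (g x)⁻¹ *ᵥ ξ with hη
  have hgη : g x *ᵥ η = ξ := by
    rw [hη, Matrix.mulVec_mulVec, Matrix.mul_nonsing_inv _ hu, Matrix.one_mulVec]
  have h1 : ∑ i, ∑ j, (g x)⁻¹ i j * ξ i * ξ j = ∑ i, ∑ j, g x i j * η i * η j := by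
    have e1 : ∑ i, ∑ j, (g x)⁻¹ i j * ξ i * ξ j = ∑ i, ξ i * η i := by
      simp only [hη, Matrix.mulVec, dotProduct, Finset.mul_sum]
      exact Finset.sum_congr rfl fun i _ => Finset.sum_congr rfl fun j _ => by ring
    have e2 : ∑ i, ∑ j, g x i j * η i * η j = ∑ i, (g x *ᵥ η) i * η i := by
      simp only [Matrix.mulVec, dotProduct, Finset.sum_mul]
      exact Finset.sum_congr rfl fun i _ => Finset.sum_congr rfl fun j _ => by ring
    rw [e1, e2, hgη]
  have h2 : ∑ i, ξ i ^ 2 ≤ n * (n * C ^ 2) * ∑ i, η i ^ 2 := by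
    have hi : ∀ i, ξ i ^ 2 ≤ (n * C ^ 2) * ∑ i, η i ^ 2 := by
      intro i
      rw [← hgη]
      calc (∑ j, g x i j * η j) ^ 2 ≤ (∑ j, g x i j ^ 2) * ∑ j, η j ^ 2 :=
            Finset.sum_mul_sq_le_sq_mul_sq _ _ _
        _ ≤ (∑ _j : Fin n, C ^ 2) * ∑ j, η j ^ 2 := by
            refine mul_le_mul_of_nonneg_right (Finset.sum_le_sum fun j _ => ?_)
              (Finset.sum_nonneg fun i _ => sq_nonneg _)
            exact sq_le_sq' (abs_le.1 (hC x hx i j)).1 (abs_le.1 (hC x hx i j)).2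
        _ = _ := by simp
    calc ∑ i, ξ i ^ 2 ≤ ∑ _i : Fin n, (n * C ^ 2) * ∑ i, η i ^ 2 :=
          Finset.sum_le_sum fun i _ => hi i
      _ = _ := by simp; ring
  have h3 : 0 ≤ ∑ i, η i ^ 2 := Finset.sum_nonneg fun i _ => sq_nonneg _
  rw [h1, div_mul_eq_mul_div, div_le_iff₀ (by positivity)]
  have h4 := h x hx η
  have hA : (0 : ℝ) ≤ n * (n * C ^ 2) := by positivity
  have h5 := mul_le_mul_of_nonneg_left h2 h0.le
  have h6 := mul_le_mul_of_nonneg_left h4 hA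
  have h7 := mul_nonneg h0.le h3
  linarith

theorem IsEllipticMetric.exists_density_bounds (hg : IsEllipticMetric Ω g)
    (hb : Bornology.IsBounded Ω) (hne : Ω.Nonempty) :
    ∃ d D : ℝ, 0 < d ∧ ∀ x ∈ closure Ω, d ≤ Real.sqrt (g x).det ∧ Real.sqrt (g x).det ≤ D := by
  have hc : ContinuousOn (fun x => Real.sqrt (g x).det) (closure Ω) :=
    Real.continuous_sqrt.comp_continuousOn
      ((continuous_id.matrix_det).comp_continuousOn hg.continuousOn)
  obtain ⟨x₀, hx₀, hmin⟩ := hb.isCompact_closure.exists_isMinOn hne.closure hc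
  obtain ⟨x₁, hx₁, hmax⟩ := hb.isCompact_closure.exists_isMaxOn hne.closure hc
  exact ⟨_, _, Real.sqrt_pos.2 (hg.posDef hx₀).det_pos, fun x hx => ⟨hmin hx, hmax hx⟩⟩

theorem IsEllipticMetric.aemeasurable_density (hg : IsEllipticMetric Ω g) (hΩ : IsOpen Ω) :
    AEMeasurable (fun x => ENNReal.ofReal (Real.sqrt (g x).det)) (volume.restrict Ω) := by
  refine ENNReal.measurable_ofReal.comp_aemeasurable ?_
  have hc : ContinuousOn (fun x => Real.sqrt (g x).det) Ω :=
    Real.continuous_sqrt.comp_continuousOn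
      ((continuous_id.matrix_det).comp_continuousOn (hg.continuousOn.mono subset_closure))
  exact hc.aemeasurable hΩ.measurableSet

theorem comparable_withDensity {α : Type*} [MeasurableSpace α] {μ : Measure α} {f : α → ℝ≥0∞}
    {d D : ℝ≥0∞} (hd : d ≠ 0) (hD : D ≠ ⊤) (h : ∀ᵐ x ∂μ, d ≤ f x ∧ f x ≤ D) :
    Comparable μ (μ.withDensity f) := by
  have h1 : d • μ ≤ μ.withDensity f := by
    rw [← withDensity_const]
    exact withDensity_mono (h.mono fun x hx => hx.1)
  have h2 : μ.withDensity f ≤ D • μ := by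
    rw [← withDensity_const]
    exact withDensity_mono (h.mono fun x hx => hx.2)
  have hle : ∀ {a b : ℝ≥0∞} (ρ : Measure α), a ≤ b → a • ρ ≤ b • ρ := fun ρ hab s => by
    simp only [Measure.smul_apply, smul_eq_mul]
    gcongr
  -- An infinite lower bound contradicts f ≤ D < ⊤ at almost every point, which forces μ = 0;
  -- otherwise d can be inverted.
  by_cases hdtop : d = ⊤
  · have hμ : μ = 0 := by
      have : ∀ᵐ _ ∂μ, False := h.mono fun x hx =>
        hD (top_le_iff.1 (hdtop ▸ hx.1.trans hx.2))
      simpa using this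
    subst hμ
    exact ⟨1, ENNReal.one_ne_top, by simp, by simp⟩
  refine ⟨d⁻¹ + D, by finiteness, ?_, h2.trans (hle μ le_add_self)⟩
  calc μ = d⁻¹ • d • μ := by rw [smul_smul, ENNReal.inv_mul_cancel hd hdtop, one_smul]
    _ ≤ d⁻¹ • μ.withDensity f := by
        intro s
        simp only [Measure.smul_apply, smul_eq_mul]
        have := h1 s
        simp only [Measure.smul_apply, smul_eq_mul] at this
        gcongr
    _ ≤ _ := hle _ le_self_add

theorem IsEllipticMetric.comparable (hg : IsEllipticMetric Ω g) (hΩ : IsOpen Ω)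
    (hb : Bornology.IsBounded Ω) (hne : Ω.Nonempty) :
    Comparable (volume.restrict Ω) (riemannianMeasure g Ω) := by
  obtain ⟨d, D, hd, h⟩ := hg.exists_density_bounds hb hne
  refine comparable_withDensity (d := ENNReal.ofReal d) (D := ENNReal.ofReal D)
    (ENNReal.ofReal_pos.2 hd).ne' ENNReal.ofReal_ne_top ?_
  filter_upwards [ae_restrict_mem hΩ.measurableSet] with x hx
  exact ⟨ENNReal.ofReal_le_ofReal (h x (subset_closure hx)).1,
    ENNReal.ofReal_le_ofReal (h x (subset_closure hx)).2⟩

theorem Comparable.ae_mem {ν : Measure (Space n)} (hν : Comparable (volume.restrict Ω) ν)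
    (hΩ : IsOpen Ω) : ∀ᵐ x ∂ν, x ∈ Ω := by
  rw [← hν.ae_eq]
  exact ae_restrict_mem hΩ.measurableSet

theorem Comparable.isFiniteMeasure {α : Type*} [MeasurableSpace α] {μ ν : Measure α}
    (h : Comparable μ ν) [IsFiniteMeasure μ] : IsFiniteMeasure ν := by
  obtain ⟨C, h1, h2, h3⟩ := h
  refine ⟨(h3 Set.univ).trans_lt ?_⟩
  rw [Measure.smul_apply, smul_eq_mul]
  exact ENNReal.mul_lt_top h1.lt_top (measure_lt_top μ _)

/-- Nothing is known about g and V off the closure of Ω, so every property is stated almost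
everywhere for a measure carried by Ω; the bounds come from compactness of the closure. -/
theorem IsEllipticMetric.isEllipticCoef (hg : IsEllipticMetric Ω g) (hV : IsPotential Ω V)
    (hΩ : IsOpen Ω) (hb : Bornology.IsBounded Ω) (hne : Ω.Nonempty) :
    IsEllipticCoef (riemannianMeasure g Ω) (fun x => (g x)⁻¹) V := by
  have hν := hg.comparable hΩ hb hne
  have hmem := hν.ae_mem hΩ
  have hac := hν.symm.absolutelyContinuous
  refine ⟨fun i j => ?_, ?_, ?_, ?_, ?_, ?_⟩
  · have hij : ContinuousOn (fun x => (g x)⁻¹ i j) Ω :=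
      continuousOn_pi.1 (continuousOn_pi.1 (hg.continuousOn_inv.mono subset_closure) i) j
    exact (hij.aestronglyMeasurable hΩ.measurableSet).mono_ac hac
  · exact ((hV.smooth.continuousOn.mono subset_closure).aestronglyMeasurable
      hΩ.measurableSet).mono_ac hac
  · filter_upwards [hmem] with x hx i j
    have h1 : ((g x)⁻¹)ᵀ = (g x)⁻¹ := by
      rw [Matrix.transpose_nonsing_inv, hg.symm x (subset_closure hx)]
    rw [← congrFun (congrFun h1 i) j]; rfl
  · obtain ⟨K₁, h1, hK₁⟩ := exists_abs_entry_le hb.isCompact_closure hg.continuousOn_inv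
    obtain ⟨K₂, h2, hK₂⟩ := exists_abs_le_of_continuousOn hb.isCompact_closure hV.smooth.continuousOn
    refine ⟨max K₁ K₂, le_max_of_le_left h1, ?_⟩
    filter_upwards [hmem] with x hx
    exact ⟨fun i j => (hK₁ x (subset_closure hx) i j).trans (le_max_left _ _),
      (hK₂ x (subset_closure hx)).trans (le_max_right _ _)⟩
  · obtain ⟨c, hc, h⟩ := hg.exists_lower_bound_inv hb
    refine ⟨c, hc, ?_⟩
    filter_upwards [hmem] with x hx
    exact h x (subset_closure hx)
  · filter_upwards [hmem] with x hx
    exact hV.nonneg x (subset_closure hx)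

/-- The coefficients of the product metric `g + dy²` are elliptic if those of `g` are. -/
theorem IsEllipticCoef.prod {ν : Measure (Space n)} [SFinite ν] {ρ : Measure ℝ} [SFinite ρ]
    {a : Space n → Matrix (Fin n) (Fin n) ℝ} (h : IsEllipticCoef ν a V) :
    IsEllipticCoef (ν.prod ρ) (fun z => Matrix.fromBlocks (a z.1) 0 0 (1 : Matrix Unit Unit ℝ))
      (fun z => V z.1) := by
  have hfst : ∀ {p : Space n → Prop}, (∀ᵐ x ∂ν, p x) → ∀ᵐ z ∂(ν.prod ρ), p z.1 := fun hp =>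
    Measure.quasiMeasurePreserving_fst.ae hp
  refine ⟨?_, h.measurable_potential.comp_fst, ?_, ?_, ?_, hfst h.nonneg⟩
  · rintro (i | i) (j | j)
    · exact (h.measurable i j).comp_fst
    · exact aestronglyMeasurable_const
    · exact aestronglyMeasurable_const
    · exact aestronglyMeasurable_const
  · filter_upwards [hfst h.symm] with z hz
    rintro (i | i) (j | j)
    · exact hz i j
    · rfl
    · rfl
    · rfl
  · obtain ⟨K, hK, hb⟩ := h.bounded
    refine ⟨max K 1, le_max_of_le_left hK, ?_⟩
    filter_upwards [hfst hb] with z hz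
    refine ⟨?_, hz.2.trans (le_max_left _ _)⟩
    rintro (i | i) (j | j)
    · exact (hz.1 i j).trans (le_max_left _ _)
    · simp
    · simp
    · simp
  · obtain ⟨c, hc, he⟩ := h.elliptic
    refine ⟨min c 1, by positivity, ?_⟩
    filter_upwards [hfst he] with z hz ξ
    have h1 := hz fun i => ξ (Sum.inl i)
    have h2 : 0 ≤ ∑ i, ξ (Sum.inl i) ^ 2 := Finset.sum_nonneg fun i _ => sq_nonneg _
    simp only [Fintype.sum_sum_type, Matrix.fromBlocks_apply₁₁, Matrix.fromBlocks_apply₁₂,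
      Matrix.fromBlocks_apply₂₁, Matrix.fromBlocks_apply₂₂, Finset.univ_unique,
      Finset.sum_singleton, Matrix.zero_apply, zero_mul, Finset.sum_const_zero, add_zero, zero_add,
      Matrix.one_apply_eq, one_mul]
    nlinarith [min_le_left c 1, min_le_right c 1, sq_nonneg (ξ (Sum.inr default))]

theorem extendedMetric_inv {z : Space n × ℝ} (h : IsUnit (g z.1).det) :
    (extendedMetric g z)⁻¹ = Matrix.fromBlocks (g z.1)⁻¹ 0 0 1 := by
  refine Matrix.inv_eq_right_inv ?_
  rw [extendedMetric, Matrix.fromBlocks_multiply]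
  simp [Matrix.mul_nonsing_inv _ h]

/-- The block metric has determinant det g, independent of y, so its volume is the product of dV_g
and dy. -/
theorem riemannianMeasure_extendedMetric (hg : IsEllipticMetric Ω g) (hΩ : IsOpen Ω) :
    riemannianMeasure (extendedMetric g) (halfCylinder Ω) =
      (riemannianMeasure g Ω).prod (volume.restrict (Set.Ioi 0)) := by
  rw [riemannianMeasure, riemannianMeasure, prod_withDensity_left₀ (hg.aemeasurable_density hΩ),
    Measure.prod_restrict, halfCylinder, ← Measure.volume_eq_prod]
  congr 1
  ext1 z
  simp [extendedMetric]

end Metric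

/-! ### The Dirichlet eigenbasis -/

section Eigenbasis

open scoped InnerProductSpace

/-- The value of a square-integrable jet. -/
noncomputable def valueCLM {ι : Type*} [Fintype ι] {α : Type*} [MeasurableSpace α]
    (ν : Measure α) : Lp (Jet ι) 2 ν →L[ℝ] Lp ℝ 2 ν :=
  (EuclideanSpace.proj (𝕜 := ℝ) (none : Option ι)).compLpL 2 ν

theorem coeFn_valueCLM {ι : Type*} [Fintype ι] {α : Type*} [MeasurableSpace α]
    {ν : Measure α} (G : Lp (Jet ι) 2 ν) : valueCLM ν G =ᵐ[ν] fun z => G z none :=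
  ContinuousLinearMap.coeFn_compLpL _ _

theorem ofReal_norm_sq_Lp {α E : Type*} [MeasurableSpace α] {ν : Measure α}
    [NormedAddCommGroup E] (f : Lp E 2 ν) : ENNReal.ofReal (‖f‖ ^ 2) = ∫⁻ z, ‖f z‖ₑ ^ 2 ∂ν := by
  have h := eLpNorm_nnreal_pow_eq_lintegral (f := f) (μ := ν) (p := 2) two_ne_zero
  simp only [NNReal.coe_ofNat, ENNReal.rpow_two, ENNReal.coe_ofNat] at h
  rw [← h, ← Lp.enorm_def, ENNReal.ofReal_pow (norm_nonneg _), ofReal_norm]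

theorem L2_inner_eq_integral {α : Type*} [MeasurableSpace α] {ν : Measure α} (f g : Lp ℝ 2 ν) :
    ⟪f, g⟫_ℝ = ∫ x, f x * g x ∂ν := by
  rw [L2.inner_def]
  exact integral_congr_ae (Eventually.of_forall fun x => by simp [mul_comm])

theorem contDiff_top_ne_zero : (∞ : WithTop ℕ∞) ≠ 0 := by simp

variable {n : ℕ} {Ω : Set (Space n)} {g : Space n → Matrix (Fin n) (Fin n) ℝ} {V : Space n → ℝ}

/-- The coordinate basis of `ℝⁿ`. -/
noncomputable def spaceBasis (n : ℕ) : Module.Basis (Fin n) ℝ (Space n) :=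
  (EuclideanSpace.basisFun (Fin n) ℝ).toBasis

theorem coe_spaceBasis (n : ℕ) : ⇑(spaceBasis n) = coordVec n := by
  ext1 i
  simp [spaceBasis, coordVec]

/-- The form depends only on the almost everywhere classes of the jets. The separate matrix a allows
the inverse metric to be replaced by its block form on the half-cylinder. -/
theorem bilinearForm_eq {F ι : Type*} [NormedAddCommGroup F] [NormedSpace ℝ F]
    [FiniteDimensional ℝ F] [MeasureSpace F] [Fintype ι] [DecidableEq ι] (e : Module.Basis ι ℝ F)
    {h : F → Matrix ι ι ℝ} {a : F → Matrix ι ι ℝ} {V : F → ℝ} {U : Set F} {u φ : F → ℝ}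
    {Du Dφ : F → F →L[ℝ] ℝ} {G G' : F → Jet ι} (ha : ∀ᵐ z ∂(riemannianMeasure h U), (h z)⁻¹ = a z)
    (hG : G =ᵐ[riemannianMeasure h U] jet e u Du) (hG' : G' =ᵐ[riemannianMeasure h U] jet e φ Dφ) :
    bilinearForm e h V U u Du φ Dφ =
      ∫ z, energyDensity (a z) (V z) (G z) (G' z) ∂(riemannianMeasure h U) := by
  unfold bilinearForm
  refine integral_congr_ae ?_
  filter_upwards [ha, hG, hG'] with z hz h1 h2
  rw [h1, h2, hz]
  rfl

theorem exists_poincare (hn : n ≠ 0) (hb : Bornology.IsBounded Ω) (hΩ : IsOpen Ω)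
    {k : WithTop ℕ∞} (hk : 1 ≤ k) :
    ∃ K : ℝ≥0∞, K ≠ ⊤ ∧ ∀ φ ∈ CompactlySupported k Ω,
      ∫⁻ z in Ω, ‖φ z‖ₑ ^ 2 ≤ K * ∫⁻ z in Ω, ‖fderiv ℝ φ z‖ₑ ^ 2 := by
  have : Nonempty (Fin n) := ⟨⟨0, Nat.pos_of_ne_zero hn⟩⟩
  obtain ⟨R, hR0, hR⟩ := hb.exists_pos_norm_le
  -- Points of Ω differ by at most 2R, so a translation by a vector longer than that moves Ω off
  -- itself.
  obtain ⟨ζ, hζ⟩ := exists_norm_eq (Space n) (c := 2 * R + 1) (by positivity)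
  refine ⟨‖ζ‖ₑ ^ 2, by finiteness, fun φ hφ => ?_⟩
  refine lintegral_sq_le_of_displaced (S := Set.univ) (U' := Ω) MeasurableSet.univ hΩ.measurableSet
    (fun t => Set.preimage_univ) (Set.subset_univ _) Set.inter_subset_right (fun x hx hx' => ?_)
    ⟨hφ.1.of_le hk, hφ.2⟩
  have h1 := hR x hx
  have h2 := hR _ hx'
  have h3 : ‖ζ‖ ≤ ‖x + ζ‖ + ‖x‖ := by
    simpa using norm_sub_le (x + ζ) x
  linarith

theorem finiteMeasure_restrict (hb : Bornology.IsBounded Ω) :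
    IsFiniteMeasure ((volume : Measure (Space n)).restrict Ω) :=
  ⟨by rw [Measure.restrict_apply_univ]; exact hb.measure_lt_top⟩

/-- The Rellich compactness theorem for `H¹₀(Ω)`. -/
theorem isCompactOperator_valueCLM (hb : Bornology.IsBounded Ω) (hΩ : IsOpen Ω)
    {ν : Measure (Space n)} (hν : Comparable (volume.restrict Ω) ν) :
    IsCompactOperator ((valueCLM ν) ∘L
      (testJets (spaceBasis n) ∞ contDiff_top_ne_zero Ω ν).topologicalClosure.subtypeL) := by
  have := finiteMeasure_restrict hb
  have : IsFiniteMeasure ν := hν.isFiniteMeasure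
  obtain ⟨C, hC, hcube⟩ := exists_lintegral_sub_cubeMean_le n
  obtain ⟨M, hM, hL⟩ := exists_norm_sq_le_sum (spaceBasis n)
  obtain ⟨C₁, hC₁, hle₁⟩ := hν.symm.lintegral_le
  obtain ⟨C₂, hC₂, hle₂⟩ := hν.lintegral_le
  set A : ℝ≥0∞ := C₁ * C * C₂ * ENNReal.ofReal M with hAdef
  have hA : A ≠ ⊤ := by finiteness
  refine isCompactOperator_of_finiteDimensional_approx _ _ fun ε hε => ?_
  -- The final squared error is A / N² times ‖G‖², so N ≥ √A / ε is what is needed; passing to N₀ +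
  -- 1 makes N positive.
  obtain ⟨N₀, hN₀⟩ := exists_nat_gt (Real.sqrt A.toReal / ε)
  set N := N₀ + 1 with hNdef
  have hN : 0 < N := Nat.succ_pos _
  have hNr : (0 : ℝ) < N := by exact_mod_cast hN
  have hNε : A.toReal * ((N : ℝ)⁻¹) ^ 2 ≤ ε ^ 2 := by
    have h1 : Real.sqrt A.toReal / ε ≤ N := hN₀.le.trans (by rw [hNdef]; push_cast; linarith)
    rw [div_le_iff₀ hε] at h1
    have h2 := pow_le_pow_left₀ (Real.sqrt_nonneg _) h1 2
    rw [Real.sq_sqrt ENNReal.toReal_nonneg] at h2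
    rw [inv_pow, ← div_eq_mul_inv, div_le_iff₀ (by positivity)]
    linarith
  let I : (Fin n → ℤ) → Lp ℝ 2 ν := fun m =>
    indicatorConstLp 2 (measurableSet_cube N m) (measure_ne_top ν _) (1 : ℝ)
  have hfin := finite_cubeIndex_image N hb
  refine ⟨Submodule.span ℝ (I '' (cubeIndex N '' Ω)),
    FiniteDimensional.span_of_finite ℝ (hfin.image I), ?_⟩
  rintro G ⟨φ, hφ, hG⟩
  -- The approximant is the step function of the means of φ over the cubes that meet Ω.
  let w : Lp ℝ 2 ν := ∑ m ∈ hfin.toFinset, cubeMean N φ m • I m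
  have hw : ∀ᵐ x ∂ν, w x = cubeMean N φ (cubeIndex N x) := by
    have h1 : ∀ m : Fin n → ℤ, ∀ᵐ x ∂ν, I m x = (cube N m).indicator (fun _ => (1 : ℝ)) x :=
      fun m => indicatorConstLp_coeFn
    have h2 : ∀ᵐ x ∂ν, w x = ∑ m ∈ hfin.toFinset, cubeMean N φ m * I m x := by
      have h3 := Lp.coeFn_fun_finsetSum (p := 2)
          (μ := ν) hfin.toFinset fun m => cubeMean N φ m • I m
      have h4 : ∀ᵐ x ∂ν, ∀ m ∈ hfin.toFinset,
          (cubeMean N φ m • I m : Lp ℝ 2 ν) x = cubeMean N φ m * I m x := by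
        rw [eventually_all_finset]
        intro m _
        filter_upwards [Lp.coeFn_smul (cubeMean N φ m) (I m)] with x hx
        rw [hx]; rfl
      filter_upwards [h3, h4] with x h3 h4
      exact h3.trans (Finset.sum_congr rfl h4)
    filter_upwards [h2, ae_all_iff.2 h1, hν.ae_mem hΩ] with x h2 h1 hx
    rw [h2, Finset.sum_eq_single (cubeIndex N x)]
    · rw [h1, Set.indicator_of_mem (by rfl), mul_one]
    · intro m _ hm
      have hxm : x ∉ cube N m := fun h => hm (Eq.symm h)
      rw [h1, Set.indicator_of_notMem hxm, mul_zero]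
    · intro h
      exact absurd (hfin.mem_toFinset.2 ⟨x, hx, rfl⟩) h
  refine ⟨w, Submodule.sum_mem _ fun m hm => Submodule.smul_mem _ _
    (Submodule.subset_span ⟨m, hfin.mem_toFinset.1 hm, rfl⟩), ?_⟩
  have hsupp : ∫⁻ x, ‖fderiv ℝ φ x‖ₑ ^ 2 = ∫⁻ x in Ω, ‖fderiv ℝ φ x‖ₑ ^ 2 := by
    rw [← setLIntegral_univ, ← lintegral_inter_add_sdiff _ Set.univ hΩ.measurableSet, Set.univ_inter]
    refine (congrArg _ ?_).trans (add_zero _)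
    refine (setLIntegral_congr_fun (MeasurableSet.univ.diff hΩ.measurableSet) fun x hx => ?_).trans
      lintegral_zero
    have : fderiv ℝ φ x = 0 := image_eq_zero_of_notMem_tsupport fun h =>
      hx.2 (hφ.2.2 (tsupport_fderiv_subset ℝ h))
    simp [this, enorm_eq_nnnorm]
  have key : ENNReal.ofReal (‖valueCLM ν G - w‖ ^ 2) ≤
      A * ENNReal.ofReal ((N : ℝ)⁻¹) ^ 2 * ENNReal.ofReal (‖G‖ ^ 2) := by
    rw [ofReal_norm_sq_Lp, ofReal_norm_sq_Lp]
    calc ∫⁻ z, ‖(valueCLM ν G - w : Lp ℝ 2 ν) z‖ₑ ^ 2 ∂ν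
        = ∫⁻ z, ‖φ z - cubeMean N φ (cubeIndex N z)‖ₑ ^ 2 ∂ν := by
          refine lintegral_congr_ae ?_
          filter_upwards [Lp.coeFn_sub
              (valueCLM ν G) w, hw, coeFn_valueCLM G, hG] with z h1 h2 h3 h4
          rw [h1, Pi.sub_apply, h2, h3, h4, jet_none]
      _ ≤ C₁ * ∫⁻ z in Ω, ‖φ z - cubeMean N φ (cubeIndex N z)‖ₑ ^ 2 := hle₁ _
      _ ≤ C₁ * (C * ENNReal.ofReal ((N : ℝ)⁻¹) ^ 2 * ∫⁻ x in Ω, ‖fderiv ℝ φ x‖ₑ ^ 2) := by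
          gcongr
          rw [← hsupp]
          exact (setLIntegral_le_lintegral _ _).trans
            (hcube N hN φ (hφ.1.of_le (by exact_mod_cast le_top)) hφ.2.1)
      _ ≤ C₁ * (C * ENNReal.ofReal ((N : ℝ)⁻¹) ^ 2 *
            (C₂ * ∫⁻ x, ENNReal.ofReal M * ‖G x‖ₑ ^ 2 ∂ν)) := by
          refine mul_le_mul' le_rfl (mul_le_mul' le_rfl ((hle₂ _).trans
            (mul_le_mul' le_rfl (lintegral_mono_ae ?_))))
          filter_upwards [hG] with z hz
          rw [hz, ← ofReal_norm, ← ofReal_norm, ← ENNReal.ofReal_pow (norm_nonneg _),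
            ← ENNReal.ofReal_pow (norm_nonneg _), ← ENNReal.ofReal_mul hM, norm_sq_jet]
          refine ENNReal.ofReal_le_ofReal ((hL _).trans ?_)
          gcongr
          simp only [jet_some, jet_none]
          nlinarith [sq_nonneg (φ z)]
      _ = _ := by
          rw [lintegral_const_mul' _ _ ENNReal.ofReal_ne_top, hAdef]
          ring
  rw [← ENNReal.ofReal_toReal hA, ← ENNReal.ofReal_pow (by positivity),
    ← ENNReal.ofReal_mul ENNReal.toReal_nonneg, ← ENNReal.ofReal_mul (by positivity)] at key
  have h5 := (ENNReal.ofReal_le_ofReal_iff (by positivity)).1 key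
  refine abs_le_of_sq_le_sq' ?_ (by positivity) |>.2
  rw [mul_pow]
  exact h5.trans (mul_le_mul_of_nonneg_right hNε (by positivity))

/-- A ball in Ω contains infinitely many disjoint open spherical shells, and their indicators are
nonzero and orthogonal. -/
theorem not_finiteDimensional_L2 (hn : n ≠ 0) (hΩ : IsOpen Ω) (hne : Ω.Nonempty)
    {ν : Measure (Space n)} [IsFiniteMeasure ν] (hν : Comparable (volume.restrict Ω) ν) :
    ¬ FiniteDimensional ℝ (Lp ℝ 2 ν) := by
  have : Nonempty (Fin n) := ⟨⟨0, Nat.pos_of_ne_zero hn⟩⟩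
  obtain ⟨p, hp⟩ := hne
  obtain ⟨r, hr, hball⟩ := Metric.isOpen_iff.1 hΩ p hp
  let R : ℕ → ℝ := fun k => r / ((k : ℝ) + 1)
  let A : ℕ → Set (Space n) := fun k => Metric.ball p (R k) \ Metric.closedBall p (R (k + 1))
  have hR : ∀ k l, k ≤ l → R l ≤ R k := fun k l hkl => by
    have : (k : ℝ) ≤ l := by exact_mod_cast hkl
    simp only [R]
    gcongr
  have hRlt : ∀ k, R (k + 1) < R k := fun k => by
    simp only [R]
    push_cast
    gcongr
    linarith
  have hRpos : ∀ k, 0 < R k := fun k => by positivity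
  have hopen : ∀ k, IsOpen (A k) := fun k => Metric.isOpen_ball.sdiff Metric.isClosed_closedBall
  have hsub : ∀ k, A k ⊆ Ω := fun k x hx => hball (Metric.ball_subset_ball (by
    simpa [R] using hR 0 k (Nat.zero_le _)) hx.1)
  have hnon : ∀ k, (A k).Nonempty := fun k => by
    obtain ⟨z, hz⟩ := exists_norm_eq (Space n) (c := (R k + R (k + 1)) / 2)
      (by have := hRpos k; have := hRpos (k + 1); positivity)
    refine ⟨p + z, ?_, ?_⟩
    · simp only [Metric.mem_ball, dist_self_add_left, hz]
      linarith [hRlt k]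
    · simp only [Metric.mem_closedBall, dist_self_add_left, hz, not_le]
      linarith [hRlt k]
  have hdisj : ∀ k l, k < l → A k ∩ A l = ∅ := fun k l hkl => by
    refine Set.eq_empty_of_forall_notMem fun x hx => hx.1.2 ?_
    exact Metric.ball_subset_closedBall (Metric.ball_subset_ball (hR _ _ hkl) hx.2.1)
  have hpos : ∀ k, 0 < ν.real (A k) := fun k => by
    have h1 : volume.restrict Ω (A k) ≠ 0 := by
      rw [Measure.restrict_apply (hopen k).measurableSet, Set.inter_eq_self_of_subset_left (hsub k)]
      exact ((hopen k).measure_pos _ (hnon k)).ne'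
    rw [measureReal_def, ENNReal.toReal_pos_iff]
    refine ⟨pos_iff_ne_zero.2 fun h => h1 (hν.absolutelyContinuous h), measure_lt_top _ _⟩
  let v : ℕ → Lp ℝ 2 ν := fun k =>
    indicatorConstLp 2 (hopen k).measurableSet (measure_ne_top ν _) (1 : ℝ)
  have hinner : ∀ k l, ⟪v k, v l⟫_ℝ = ν.real (A k ∩ A l) := fun k l =>
    L2.real_inner_indicatorConstLp_one_indicatorConstLp_one _ _ _ _
  intro hfd
  refine Module.Finite.not_linearIndependent_of_infinite v
    (linearIndependent_of_ne_zero_of_inner_eq_zero (𝕜 := ℝ) (fun k h0 => ?_) fun k l hkl => ?_)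
  · have := hinner k k
    rw [h0, inner_zero_left, Set.inter_self] at this
    exact (hpos k).ne this
  · change ⟪v k, v l⟫_ℝ = 0
    rw [hinner]
    rcases lt_or_gt_of_ne hkl with h | h
    · rw [hdisj k l h, measureReal_empty]
    · rw [Set.inter_comm, hdisj l k h, measureReal_empty]

/-- The fundamental lemma of the calculus of variations; it is the density hypothesis of
`exists_eigenbasis`. -/
theorem eq_zero_of_inner_testJets (hΩ : IsOpen Ω) {ν : Measure (Space n)} [IsFiniteMeasure ν]
    (hν : Comparable (volume.restrict Ω) ν) (y : Lp ℝ 2 ν)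
    (hy : ∀ G ∈ testJets (spaceBasis n) ∞ contDiff_top_ne_zero Ω ν, ⟪y, valueCLM ν G⟫_ℝ = 0) : y = 0 := by
  have hint : Integrable y ν := (Lp.memLp y).integrable (by norm_num)
  have h := hΩ.ae_eq_zero_of_integral_contDiff_smul_eq_zero
    (hint.locallyIntegrable.locallyIntegrableOn Ω) (fun φ h1 h2 h3 => by
      have hφ : φ ∈ CompactlySupported ∞ Ω := ⟨h1, h2, h3⟩
      have hm := (memLp_jet_iff (spaceBasis n)).2
        (memLp_of_compactlySupported (by simp) hν hφ)
      have h4 := hy (hm.toLp _) ⟨φ, hφ, hm.coeFn_toLp⟩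
      rw [L2_inner_eq_integral] at h4
      rw [← h4]
      refine integral_congr_ae ?_
      filter_upwards [coeFn_valueCLM (hm.toLp _), hm.coeFn_toLp] with x h5 h6
      rw [h5, h6, jet_none, smul_eq_mul, mul_comm])
  rw [Lp.eq_zero_iff_ae_eq_zero]
  filter_upwards [h, hν.ae_mem hΩ] with x h1 h2
  exact h1 h2

theorem memH10_iff {ν : Measure (Space n)} (hν : Comparable (volume.restrict Ω) ν)
    {u : Space n → ℝ} {Du : Space n → Space n →L[ℝ] ℝ} :
    MemH10 Ω u Du ↔
      ∃ G ∈ (testJets (spaceBasis n) ∞ contDiff_top_ne_zero Ω ν).topologicalClosure,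
        G =ᵐ[ν] jet (spaceBasis n) u Du :=
  memH1Closure_iff (spaceBasis n) (by exact_mod_cast le_top) contDiff_top_ne_zero hν

/-- A uniformly elliptic operator on a bounded domain has a Dirichlet eigenbasis. -/
theorem exists_dirichletEigenbasis (hn : n ≠ 0) (hΩ : IsOpen Ω) (hne : Ω.Nonempty)
    (hb : Bornology.IsBounded Ω) (hg : IsEllipticMetric Ω g) (hV : IsPotential Ω V) :
    ∃ (b : HilbertBasis ℕ ℝ (L2g Ω g)) (lam : ℕ → ℝ), IsDirichletEigenbasis Ω g V b lam ∧
      ∃ δ > 0, ∀ k, δ ≤ lam k := by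
  have hν := hg.comparable hΩ hb hne
  have := finiteMeasure_restrict hb
  have : IsFiniteMeasure (riemannianMeasure g Ω) := hν.isFiniteMeasure
  have : Fact ((2 : ℝ≥0∞) ≠ ⊤) := ⟨by norm_num⟩
  have hcoef := hg.isEllipticCoef hV hΩ hb hne
  obtain ⟨B, hB, hBs⟩ := hcoef.exists_form
  obtain ⟨K, hK, hP⟩ := exists_poincare_testJets (spaceBasis n)
    contDiff_top_ne_zero hν (exists_poincare hn hb hΩ (by exact_mod_cast le_top))
  obtain ⟨c, hc, hcoer⟩ := hcoef.exists_coercive hK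
  obtain ⟨b, lam, x, hpos, hδ, hx⟩ := exists_eigenbasis
      (not_finiteDimensional_L2 hn hΩ hne hν) B hBs
    (testJets (spaceBasis n) ∞ contDiff_top_ne_zero Ω (riemannianMeasure g Ω)) hc
    (fun G hG => by rw [hB]; exact hcoer G (hP G hG)) (valueCLM _)
    (isCompactOperator_valueCLM hb hΩ hν) (eq_zero_of_inner_testJets hΩ hν)
  refine ⟨b, lam, ⟨hpos, fun k => ?_⟩, hδ⟩
  obtain ⟨hmem, hval, heig⟩ := hx k
  obtain ⟨u, Du, hu⟩ := exists_jet_of_jet (spaceBasis n) (x k)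
  -- The value component of x_k may be replaced by the representative of b_k, since the two agree
  -- almost everywhere.
  have hub : x k =ᵐ[riemannianMeasure g Ω] jet (spaceBasis n) (b k) Du := by
    filter_upwards [coeFn_valueCLM (x k)] with z hz
    rw [hval] at hz
    rw [← hu, jet, jet, hz, ← hu, jet_none]
  refine ⟨Du, (memH10_iff hν).2 ⟨x k, hmem, hub⟩,
    fun ψ Dψ hψ => ?_⟩
  obtain ⟨G, hG, hGψ⟩ := (memH10_iff hν).1 hψ
  rw [← coe_spaceBasis, bilinearForm_eq (spaceBasis n) (Eventually.of_forall fun z => rfl) hub hGψ,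
    ← hB, heig G hG, L2_inner_eq_integral]
  congr 1
  refine integral_congr_ae ?_
  filter_upwards [coeFn_valueCLM G, hGψ] with z h1 h2
  rw [h1, h2, jet_none]

end Eigenbasis

/-! ### The half-cylinder -/

section Cylinder

open scoped InnerProductSpace

theorem Comparable.prod {α β : Type*} [MeasurableSpace α] [MeasurableSpace β] {μ ν : Measure α}
    (h : Comparable μ ν) (ρ : Measure β) [SFinite ρ] :
    Comparable (μ.prod ρ) (ν.prod ρ) := by
  have key : ∀ {μ ν : Measure α} {C : ℝ≥0∞}, μ ≤ C • ν → μ.prod ρ ≤ C • ν.prod ρ := by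
    intro μ ν C hle
    refine Measure.le_iff.2 fun s hs => ?_
    rw [Measure.smul_apply, Measure.prod_apply hs, Measure.prod_apply hs, smul_eq_mul,
      ← smul_eq_mul, ← lintegral_smul_measure]
    exact lintegral_mono' hle le_rfl
  obtain ⟨C, h1, h2, h3⟩ := h
  exact ⟨C, h1, key h2, key h3⟩

/-- Lebesgue measure on `(0,∞)`. -/
noncomputable abbrev halfLine : Measure ℝ := volume.restrict (Set.Ioi 0)

instance isAddHaarMeasure_volume_prod (n : ℕ) :
    (volume : Measure (Space n × ℝ)).IsAddHaarMeasure :=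
  Measure.prod.instIsAddHaarMeasure volume volume

/-- The coordinate basis of `ℝⁿ × ℝ`. -/
noncomputable def cylBasis (n : ℕ) : Module.Basis (Fin n ⊕ Unit) ℝ (Space n × ℝ) :=
  (spaceBasis n).prod (Module.Basis.singleton Unit ℝ)

theorem coe_cylBasis (n : ℕ) : ⇑(cylBasis n) = coordVecCyl n := by
  ext1 i
  cases i with
  | inl i => simp [cylBasis, coordVecCyl, ← coe_spaceBasis]
  | inr i => simp [cylBasis, coordVecCyl]

variable {n : ℕ} {Ω : Set (Space n)} {ν : Measure (Space n)}

theorem volume_restrict_halfCylinder (Ω : Set (Space n)) :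
    (volume : Measure (Space n × ℝ)).restrict (halfCylinder Ω) =
      (volume.restrict Ω).prod halfLine := by
  rw [halfCylinder, Measure.volume_eq_prod, Measure.prod_restrict]

theorem comparable_halfCylinder (hν : Comparable (volume.restrict Ω) ν) :
    Comparable (volume.restrict (halfCylinder Ω)) (ν.prod halfLine) := by
  rw [volume_restrict_halfCylinder]
  exact hν.prod _

/-- The displacement is horizontal: it moves Ω off itself and preserves the half-space y > 0, so no
vanishing at the bottom is required. -/
theorem exists_poincare_cylinder (hn : n ≠ 0) (hb : Bornology.IsBounded Ω) (hΩ : IsOpen Ω) :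
    ∃ K : ℝ≥0∞, K ≠ ⊤ ∧ ∀ φ ∈ HalfCylinderTest Ω,
      ∫⁻ z in halfCylinder Ω, ‖φ z‖ₑ ^ 2 ≤ K * ∫⁻ z in halfCylinder Ω, ‖fderiv ℝ φ z‖ₑ ^ 2 := by
  have : Nonempty (Fin n) := ⟨⟨0, Nat.pos_of_ne_zero hn⟩⟩
  obtain ⟨R, hR0, hR⟩ := hb.exists_pos_norm_le
  obtain ⟨ζ, hζ⟩ := exists_norm_eq (Space n) (c := 2 * R + 1) (by positivity)
  refine ⟨‖((ζ, 0) : Space n × ℝ)‖ₑ ^ 2, by finiteness, fun φ hφ => ?_⟩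
  refine lintegral_sq_le_of_displaced (S := Set.univ ×ˢ Set.Ioi 0) (U' := Ω ×ˢ Set.univ)
    (MeasurableSet.univ.prod measurableSet_Ioi) (hΩ.measurableSet.prod measurableSet_Ioi)
    (fun t => ?_) (Set.prod_mono (Set.subset_univ _) le_rfl) (fun z hz => ⟨hz.2.1, hz.1.2⟩)
    (fun x hx hx' => ?_) hφ
  · ext z
    simp
  have h1 := hR _ hx.1
  have h2 := hR _ hx'.1
  have h3 : ‖ζ‖ ≤ ‖x.1 + ζ‖ + ‖x.1‖ := by
    simpa using norm_sub_le (x.1 + ζ) x.1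
  rw [Prod.fst_add] at h2
  linarith

/-! Slices of test functions -/

theorem HalfCylinderTest.slice {φ : Space n × ℝ → ℝ} (hφ : φ ∈ HalfCylinderTest Ω) (y : ℝ) :
    (fun x => φ (x, y)) ∈ CompactlySupported 1 Ω := by
  refine ⟨hφ.1.comp (contDiff_id.prodMk contDiff_const), ?_, ?_⟩
  · exact hφ.2.1.comp_isClosedEmbedding (g := fun x : Space n => (x, y))
      (Topology.IsClosedEmbedding.of_continuous_injective_isClosedMap (by fun_prop)
        (fun a b h => (Prod.ext_iff.1 h).1) (isClosedMap_prodMk_right y))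
  · intro x hx
    exact (hφ.2.2 (tsupport_comp_subset_preimage φ (f := fun x : Space n => (x, y))
      (by fun_prop) hx)).1

theorem fderiv_slice {φ : Space n × ℝ → ℝ} (hφ : ContDiff ℝ 1 φ) (y : ℝ) (x v : Space n) :
    fderiv ℝ (fun x => φ (x, y)) x v = fderiv ℝ φ (x, y) (v, 0) := by
  have h : HasFDerivAt (fun x => φ (x, y)) ((fderiv ℝ φ (x, y)).comp
      ((ContinuousLinearMap.id ℝ (Space n)).prod 0)) x :=
    HasFDerivAt.comp (g := φ) (f := fun x => (x, y)) x
      (hφ.differentiable one_ne_zero (x, y)).hasFDerivAt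
      ((hasFDerivAt_id x).prodMk (hasFDerivAt_const y x))
  rw [h.fderiv]
  simp

theorem hasDerivAt_slice {φ : Space n × ℝ → ℝ} (hφ : ContDiff ℝ 1 φ) (x : Space n) (y : ℝ) :
    HasDerivAt (fun y => φ (x, y)) (fderiv ℝ φ (x, y) (0, 1)) y :=
  ((hφ.differentiable one_ne_zero (x, y)).hasFDerivAt).comp_hasDerivAt y
    ((hasDerivAt_const y x).prodMk (hasDerivAt_id y))

theorem HalfCylinderTest.contDiff_vertical {φ : Space n × ℝ → ℝ} (hφ : φ ∈ HalfCylinderTest Ω)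
    (x : Space n) : ContDiff ℝ 1 (fun y => φ (x, y)) :=
  hφ.1.comp (contDiff_const.prodMk contDiff_id)

theorem HalfCylinderTest.hasCompactSupport_vertical {φ : Space n × ℝ → ℝ}
    (hφ : φ ∈ HalfCylinderTest Ω) (x : Space n) : HasCompactSupport (fun y => φ (x, y)) :=
  hφ.2.1.comp_isClosedEmbedding (g := fun y : ℝ => (x, y))
      (Topology.IsClosedEmbedding.of_continuous_injective_isClosedMap (by fun_prop)
        (fun a b h => (Prod.ext_iff.1 h).2) (isClosedMap_prodMk_left x))

/-- Square-integrable jets on the half-cylinder, together with a bottom value. -/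
abbrev CylSpace (n : ℕ) (ν : Measure (Space n)) : Type :=
  WithLp 2 (Lp (Jet (Fin n ⊕ Unit)) 2 (ν.prod halfLine) × Lp ℝ 2 ν)

/-- The jets of test functions on the half-cylinder, together with their bottom values. -/
noncomputable def cylTests (Ω : Set (Space n)) (ν : Measure (Space n)) :
    Submodule ℝ (CylSpace n ν) where
  carrier := {p | ∃ φ ∈ HalfCylinderTest Ω,
    p.fst =ᵐ[ν.prod halfLine] jet (cylBasis n) φ (fderiv ℝ φ) ∧ p.snd =ᵐ[ν] fun x => φ (x, 0)}
  add_mem' := by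
    rintro p q ⟨φ, hφ, h1, h2⟩ ⟨φ', hφ', h1', h2'⟩
    refine ⟨φ + φ', ⟨hφ.1.add hφ'.1, hφ.2.1.add hφ'.2.1,
      (tsupport_add φ φ').trans (Set.union_subset hφ.2.2 hφ'.2.2)⟩, ?_, ?_⟩
    · filter_upwards [Lp.coeFn_add p.fst q.fst, h1, h1'] with z hz h h'
      rw [WithLp.add_fst, hz, Pi.add_apply, h, h', jet, jet, jet, ← map_add,
        fderiv_add (hφ.1.differentiable one_ne_zero z) (hφ'.1.differentiable one_ne_zero z)]
      rfl
    · filter_upwards [Lp.coeFn_add p.snd q.snd, h2, h2'] with z hz h h'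
      rw [WithLp.add_snd, hz, Pi.add_apply, h, h', Pi.add_apply]
  zero_mem' := by
    refine ⟨0, ⟨contDiff_const, HasCompactSupport.zero, by simp⟩, ?_, ?_⟩
    · filter_upwards [Lp.coeFn_zero (Jet (Fin n ⊕ Unit)) 2 (ν.prod halfLine)] with z hz
      rw [WithLp.zero_fst, hz, jet, Pi.zero_apply,
        show (0 : Space n × ℝ → ℝ) = fun _ => (0 : ℝ) from rfl, fderiv_const_apply]
      exact (map_zero _).symm
    · filter_upwards [Lp.coeFn_zero ℝ 2 ν] with z hz
      rw [WithLp.zero_snd, hz, Pi.zero_apply, Pi.zero_apply]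
  smul_mem' := by
    rintro c p ⟨φ, hφ, h1, h2⟩
    refine ⟨c • φ, ⟨contDiff_const.smul hφ.1, hφ.2.1.smul_left (f := fun _ => c),
      (tsupport_smul_subset_right (fun _ => c) φ).trans hφ.2.2⟩, ?_, ?_⟩
    · filter_upwards [Lp.coeFn_smul c p.fst, h1] with z hz h
      rw [WithLp.smul_fst, hz, Pi.smul_apply, h, jet, jet, ← map_smul,
        fderiv_const_smul (hφ.1.differentiable one_ne_zero z)]
      rfl
    · filter_upwards [Lp.coeFn_smul c p.snd, h2] with z hz h
      rw [WithLp.smul_snd, hz, Pi.smul_apply, h, Pi.smul_apply]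

theorem HalfCylinderTest.memLp_jet (hν : Comparable (volume.restrict Ω) ν) {φ : Space n × ℝ → ℝ}
    (hφ : φ ∈ HalfCylinderTest Ω) :
    MemLp (jet (cylBasis n) φ (fderiv ℝ φ)) 2 (ν.prod halfLine) :=
  (memLp_jet_iff _).2
    (memLp_of_compactlySupported one_ne_zero (comparable_halfCylinder hν) hφ)

theorem HalfCylinderTest.memLp_bottom (hν : Comparable (volume.restrict Ω) ν)
    {φ : Space n × ℝ → ℝ} (hφ : φ ∈ HalfCylinderTest Ω) : MemLp (fun x => φ (x, 0)) 2 ν :=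
  (memLp_of_compactlySupported one_ne_zero hν (HalfCylinderTest.slice hφ 0)).1

theorem continuous_fst_cyl : Continuous fun p : CylSpace n ν => p.fst :=
  (WithLp.fstL 2 ℝ _ _).continuous

theorem continuous_snd_cyl : Continuous fun p : CylSpace n ν => p.snd :=
  (WithLp.sndL 2 ℝ _ _).continuous

theorem mem_closure_cylTests_of_tendsto {φ : ℕ → Space n × ℝ → ℝ}
    (hν : Comparable (volume.restrict Ω) ν) (hφ : ∀ k, φ k ∈ HalfCylinderTest Ω)
    {G : Space n × ℝ → Jet (Fin n ⊕ Unit)} {w : Space n → ℝ}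
    (hG : MemLp G 2 (ν.prod halfLine)) (hw : MemLp w 2 ν)
    (h1 : Tendsto (fun k => eLpNorm (fun z => jet (cylBasis n) (φ k) (fderiv ℝ (φ k)) z - G z) 2
      (ν.prod halfLine)) atTop (𝓝 0))
    (h2 : Tendsto (fun k => eLpNorm (fun x => φ k (x, 0) - w x) 2 ν) atTop (𝓝 0)) :
    (WithLp.toLp 2 (hG.toLp G, hw.toLp w) : CylSpace n ν) ∈ (cylTests Ω ν).topologicalClosure := by
  have hmj := fun k => HalfCylinderTest.memLp_jet hν (hφ k)
  have hmb := fun k => HalfCylinderTest.memLp_bottom hν (hφ k)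
  refine mem_closure_of_tendsto
    (f := fun k => (WithLp.toLp 2 ((hmj k).toLp _, (hmb k).toLp _) : CylSpace n ν)) (b := atTop) ?_
    (Eventually.of_forall fun k => ⟨φ k, hφ k, (hmj k).coeFn_toLp, (hmb k).coeFn_toLp⟩)
  refine ((WithLp.prodContinuousLinearEquiv 2 ℝ _ _).symm.continuous.tendsto _).comp
    (Tendsto.prodMk_nhds ?_ ?_)
  · rw [Lp.tendsto_Lp_iff_tendsto_eLpNorm'']
    exact h1
  · rw [Lp.tendsto_Lp_iff_tendsto_eLpNorm'']
    exact h2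

/-- Functions of `H¹₀(Ω × [0,∞))` with their traces, as the closure of the test jets. -/
theorem memH10Cyl_and_hasBottomTrace_iff (hν : Comparable (volume.restrict Ω) ν)
    {u : Space n × ℝ → ℝ} {Du : Space n × ℝ → Space n × ℝ →L[ℝ] ℝ} {w : Space n → ℝ} :
    (MemH10Cyl Ω u Du ∧ HasBottomTrace Ω u Du w) ↔
      ∃ p ∈ (cylTests Ω ν).topologicalClosure,
        p.fst =ᵐ[ν.prod halfLine] jet (cylBasis n) u Du ∧ p.snd =ᵐ[ν] w := by
  have hc := comparable_halfCylinder hν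
  constructor
  · rintro ⟨⟨⟨h1, h2, -⟩, -⟩, hw, φ, hφ, hlim, hlimw⟩
    have hm := fun k => memLp_of_compactlySupported one_ne_zero hc (hφ k)
    have hu := (memLp_jet_iff (cylBasis n)).2 ⟨hc.memLp h1, hc.memLp h2⟩
    refine ⟨_, mem_closure_cylTests_of_tendsto hν hφ hu (hν.memLp hw) ?_
      (hν.symm.tendsto_eLpNorm hlimw), hu.coeFn_toLp, (hν.memLp hw).coeFn_toLp⟩
    exact (tendstoH1_iff _ hc (fun k => (hm k).1) (fun k => (hm k).2) (hc.memLp h1)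
      (hc.memLp h2)).1 hlim
  · rintro ⟨p, hp, hpu, hpw⟩
    have hu : MemLp (jet (cylBasis n) u Du) 2 (ν.prod halfLine) :=
      (memLp_congr_ae hpu).1 (Lp.memLp _)
    have hw : MemLp w 2 ν := (memLp_congr_ae hpw).1 (Lp.memLp _)
    obtain ⟨h1, h2⟩ := (memLp_jet_iff _).1 hu
    obtain ⟨x, hx, hlim⟩ := mem_closure_iff_seq_limit.1 hp
    choose φ hφ hxφ hxw using hx
    have hm := fun k => memLp_of_compactlySupported one_ne_zero hc (hφ k)
    have hH1 : TendstoH1 (halfCylinder Ω) φ u Du := by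
      rw [tendstoH1_iff (cylBasis n) hc (fun k => (hm k).1) (fun k => (hm k).2) h1 h2]
      have hl := (continuous_fst_cyl.tendsto p).comp hlim
      rw [Lp.tendsto_Lp_iff_tendsto_eLpNorm'] at hl
      exact hl.congr fun k => eLpNorm_congr_ae ((hxφ k).sub hpu)
    have hmem : MemH10Cyl Ω u Du := ⟨⟨hc.symm.memLp h1, hc.symm.memLp h2,
      isWeakDifferential_of_tendstoH1 hφ (hc.symm.memLp h1) (hc.symm.memLp h2) hH1⟩, φ, hφ, hH1⟩
    refine ⟨hmem, hν.symm.memLp hw, φ, hφ, hH1, hν.tendsto_eLpNorm ?_⟩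
    have hl := (continuous_snd_cyl.tendsto p).comp hlim
    rw [Lp.tendsto_Lp_iff_tendsto_eLpNorm'] at hl
    exact hl.congr fun k => eLpNorm_congr_ae ((hxw k).sub hpw)

/-- The trace inequality. -/
theorem norm_snd_le_norm_fst_cylTests [SFinite ν] (hν : Comparable (volume.restrict Ω) ν)
    {p : CylSpace n ν} (hp : p ∈ cylTests Ω ν) : ‖p.snd‖ ^ 2 ≤ ‖p.fst‖ ^ 2 := by
  obtain ⟨φ, hφ, h1, h2⟩ := hp
  have hm := HalfCylinderTest.memLp_jet hν hφ
  have hI : Integrable (fun z : Space n × ℝ => φ z ^ 2 + fderiv ℝ φ z (0, 1) ^ 2)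
      (ν.prod halfLine) := by
    have h := (integrable_sq_apply hm none).add (integrable_sq_apply hm (some (Sum.inr ())))
    simp only [jet_none, jet_some, coe_cylBasis] at h
    exact h
  have hsnd : ‖p.snd‖ ^ 2 = ∫ x, φ (x, 0) ^ 2 ∂ν := by
    rw [← real_inner_self_eq_norm_sq, L2_inner_eq_integral]
    refine integral_congr_ae ?_
    filter_upwards [h2] with x hx
    rw [hx, sq]
  have hfst : ∫ z, (φ z ^ 2 + fderiv ℝ φ z (0, 1) ^ 2) ∂(ν.prod halfLine) ≤ ‖p.fst‖ ^ 2 := by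
    have hmp := Lp.memLp p.fst
    rw [norm_sq_Lp_jet, ← integral_add (integrable_sq_apply hmp _)
      (integrable_finsetSum _ fun i _ => integrable_sq_apply hmp _)]
    refine integral_mono_ae hI ((integrable_sq_apply hmp _).add
      (integrable_finsetSum _ fun i _ => integrable_sq_apply hmp _)) ?_
    filter_upwards [h1] with z hz
    rw [hz]
    simp only [jet_none, jet_some, coe_cylBasis, Fintype.sum_sum_type, Finset.univ_unique,
      Finset.sum_singleton]
    have : 0 ≤ ∑ i : Fin n, fderiv ℝ φ z (coordVecCyl n (Sum.inl i)) ^ 2 :=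
      Finset.sum_nonneg fun i _ => sq_nonneg _
    change _ + _ ≤ _ + (_ + fderiv ℝ φ z (0, 1) ^ 2)
    linarith
  rw [hsnd]
  refine le_trans ?_ hfst
  -- On every vertical line the one-dimensional trace inequality applies; Fubini integrates it over
  -- x.
  rw [integral_prod _ hI]
  refine integral_mono_ae (HalfCylinderTest.memLp_bottom hν hφ).integrable_sq
    hI.integral_prod_left (Eventually.of_forall fun x => ?_)
  have h := sq_le_integral_Ioi (HalfCylinderTest.contDiff_vertical hφ x)
    (HalfCylinderTest.hasCompactSupport_vertical hφ x)
  simp only [(hasDerivAt_slice hφ.1 x _).deriv] at h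
  exact h

/-- The energy form on the half-cylinder. -/
theorem exists_cylForm [SFinite ν] (hn : n ≠ 0) (hΩ : IsOpen Ω) (hb : Bornology.IsBounded Ω)
    (hν : Comparable (volume.restrict Ω) ν)
        {a : Space n × ℝ → Matrix (Fin n ⊕ Unit) (Fin n ⊕ Unit) ℝ}
    {V : Space n × ℝ → ℝ} (h : IsEllipticCoef (ν.prod halfLine) a V) :
    ∃ (B : CylSpace n ν →L[ℝ] CylSpace n ν →L[ℝ] ℝ) (c : ℝ), 0 < c ∧
      (∀ p q, B p q = ∫ z, energyDensity (a z) (V z) (p.fst z) (q.fst z) ∂(ν.prod halfLine)) ∧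
      (∀ p q, B p q = B q p) ∧
      ∀ p ∈ cylTests Ω ν, c * ‖p‖ ^ 2 ≤ B p p := by
  obtain ⟨B, hB, hBs⟩ := h.exists_form
  obtain ⟨K, hK, hP⟩ := exists_poincare_testJets (cylBasis n) one_ne_zero
    (comparable_halfCylinder hν) (exists_poincare_cylinder hn hb hΩ)
  obtain ⟨c, hc, hcoer⟩ := h.exists_coercive hK
  let π := WithLp.fstL 2 ℝ (Lp (Jet (Fin n ⊕ Unit)) 2 (ν.prod halfLine)) (Lp ℝ 2 ν)
  -- The form does not see the bottom value; the trace inequality gives ‖p‖² ≤ 2 ‖p.fst‖², at the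
  -- cost of half the constant.
  refine ⟨B.bilinearComp π π, c / 2, by positivity, fun p q => hB _ _, fun p q => hBs _ _,
    fun p hp => ?_⟩
  have h1 := norm_snd_le_norm_fst_cylTests hν hp
  have h2 : c * ‖p.fst‖ ^ 2 ≤ B p.fst p.fst := by
    obtain ⟨φ, hφ, hp1, -⟩ := hp
    rw [hB]
    exact hcoer _ (hP _ ⟨φ, hφ, hp1⟩)
  change c / 2 * ‖p‖ ^ 2 ≤ B p.fst p.fst
  rw [WithLp.prod_norm_sq_eq_of_L2]
  nlinarith

end Cylinder

/-! ### Tensor products of jets with functions of the vertical variable -/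

section Tensor

variable {n : ℕ} {Ω : Set (Space n)} {ν : Measure (Space n)}

theorem eLpNorm_two_sq {α E : Type*} [MeasurableSpace α] [NormedAddCommGroup E] (μ : Measure α)
    (f : α → E) : eLpNorm f 2 μ ^ 2 = ∫⁻ x, ‖f x‖ₑ ^ 2 ∂μ := by
  have h := eLpNorm_nnreal_pow_eq_lintegral (f := f) (μ := μ) (p := 2) two_ne_zero
  simpa only [NNReal.coe_ofNat, ENNReal.rpow_two, ENNReal.coe_ofNat] using h

/-- The jet whose value is `α(y) u(x)`, whose horizontal derivatives are `α(y) ∂ᵢu(x)`, and whose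
vertical derivative is `β(y) u(x)`, for a jet `G` of `u`. -/
noncomputable def tensorJet (α β : ℝ → ℝ) (G : Space n → Jet (Fin n)) (z : Space n × ℝ) :
    Jet (Fin n ⊕ Unit) :=
  WithLp.toLp 2 fun o => o.elim (α z.2 * G z.1 none)
    (Sum.elim (fun i => α z.2 * G z.1 (some i)) fun _ => β z.2 * G z.1 none)

@[simp]
theorem tensorJet_none (α β : ℝ → ℝ) (G : Space n → Jet (Fin n)) (z : Space n × ℝ) :
    tensorJet α β G z none = α z.2 * G z.1 none := rfl

@[simp]
theorem tensorJet_inl (α β : ℝ → ℝ) (G : Space n → Jet (Fin n)) (z : Space n × ℝ) (i : Fin n) :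
    tensorJet α β G z (some (Sum.inl i)) = α z.2 * G z.1 (some i) := rfl

@[simp]
theorem tensorJet_inr (α β : ℝ → ℝ) (G : Space n → Jet (Fin n)) (z : Space n × ℝ) (i : Unit) :
    tensorJet α β G z (some (Sum.inr i)) = β z.2 * G z.1 none := rfl

theorem tensorJet_sub_left (α β α' β' : ℝ → ℝ) (G : Space n → Jet (Fin n)) :
    tensorJet α β G - tensorJet α' β' G =
      tensorJet (fun y => α y - α' y) (fun y => β y - β' y) G := by
  ext z o
  rcases o with _ | i | i <;> simp <;> ring

theorem tensorJet_sub_right (α β : ℝ → ℝ) (G G' : Space n → Jet (Fin n)) :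
    tensorJet α β G - tensorJet α β G' = tensorJet α β (fun x => G x - G' x) := by
  ext z o
  rcases o with _ | i | i <;> simp <;> ring

/-- The squared norm is α²|G|² + β² G₀², with G₀ the value component. The bound is a function of y
times a function of x, so L² norms of tensor jets factorise by Tonelli. -/
theorem norm_tensorJet_le (α β : ℝ → ℝ) (G : Space n → Jet (Fin n)) (z : Space n × ℝ) :
    ‖tensorJet α β G z‖ ≤ ‖(‖α z.2‖ + ‖β z.2‖)‖ * ‖G z.1‖ := by
  refine abs_le_of_sq_le_sq' ?_ (by positivity) |>.2
  have hsum : ‖tensorJet α β G z‖ ^ 2 =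
      α z.2 ^ 2 * ‖G z.1‖ ^ 2 + β z.2 ^ 2 * G z.1 none ^ 2 := by
    rw [norm_sq_jet, norm_sq_jet]
    simp only [tensorJet_none, Fintype.sum_sum_type, tensorJet_inl, tensorJet_inr,
      Finset.univ_unique, Finset.sum_singleton, mul_pow, mul_add, Finset.mul_sum]
    ring
  have hG : G z.1 none ^ 2 ≤ ‖G z.1‖ ^ 2 := by
    rw [norm_sq_jet]
    exact le_add_of_nonneg_right (Finset.sum_nonneg fun i _ => sq_nonneg _)
  rw [hsum, Real.norm_of_nonneg (by positivity), Real.norm_eq_abs, Real.norm_eq_abs, mul_pow,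
    add_sq, sq_abs, sq_abs]
  have h1 := mul_le_mul_of_nonneg_left hG (sq_nonneg (β z.2))
  have h2 : 0 ≤ 2 * |α z.2| * |β z.2| * ‖G z.1‖ ^ 2 := by positivity
  nlinarith

theorem aestronglyMeasurable_tensorJet [SFinite ν] {ρ : Measure ℝ} [SFinite ρ] {α β : ℝ → ℝ}
    (hα : AEStronglyMeasurable α ρ) (hβ : AEStronglyMeasurable β ρ) {G : Space n → Jet (Fin n)}
    (hG : AEStronglyMeasurable G ν) :
    AEStronglyMeasurable (tensorJet α β G) (ν.prod ρ) := by
  have hc : ∀ o, AEStronglyMeasurable (fun z : Space n × ℝ => G z.1 o) (ν.prod ρ) := fun o =>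
    (EuclideanSpace.proj (𝕜 := ℝ) o).continuous.comp_aestronglyMeasurable hG.comp_fst
  refine (PiLp.continuous_toLp 2 _).comp_aestronglyMeasurable
    (aemeasurable_pi_iff.2 fun o => ?_).aestronglyMeasurable
  rcases o with _ | i | i
  · exact (hα.comp_snd.mul (hc _)).aemeasurable
  · exact (hα.comp_snd.mul (hc _)).aemeasurable
  · exact (hβ.comp_snd.mul (hc _)).aemeasurable

theorem eLpNorm_tensorJet_le [SFinite ν] {ρ : Measure ℝ} [SFinite ρ] {α β : ℝ → ℝ}
    (hα : AEStronglyMeasurable α ρ) (hβ : AEStronglyMeasurable β ρ) {G : Space n → Jet (Fin n)}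
    (hG : AEStronglyMeasurable G ν) :
    eLpNorm (tensorJet α β G) 2 (ν.prod ρ) ≤
      eLpNorm G 2 ν * (eLpNorm α 2 ρ + eLpNorm β 2 ρ) := by
  have h1 : eLpNorm (fun y => ‖α y‖ + ‖β y‖) 2 ρ ≤ eLpNorm α 2 ρ + eLpNorm β 2 ρ := by
    refine (eLpNorm_add_le hα.norm hβ.norm (by norm_num)).trans ?_
    rw [eLpNorm_norm, eLpNorm_norm]
  refine le_trans ?_ (mul_le_mul' le_rfl h1)
  rw [← ENNReal.pow_le_pow_left_iff two_ne_zero, mul_pow, eLpNorm_two_sq, eLpNorm_two_sq,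
    eLpNorm_two_sq, ← lintegral_prod_mul (g := fun y => ‖‖α y‖ + ‖β y‖‖ₑ ^ 2)
      (hG.enorm.pow_const 2) ((hα.norm.add hβ.norm).enorm.pow_const 2)]
  refine lintegral_mono fun z => ?_
  rw [← mul_pow]
  gcongr
  rw [mul_comm, ← ofReal_norm, ← ofReal_norm, ← ofReal_norm, ← ENNReal.ofReal_mul (norm_nonneg _)]
  exact ENNReal.ofReal_le_ofReal (norm_tensorJet_le α β G z)

theorem memLp_tensorJet [SFinite ν] {ρ : Measure ℝ} [SFinite ρ] {α β : ℝ → ℝ}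
    (hα : MemLp α 2 ρ) (hβ : MemLp β 2 ρ) {G : Space n → Jet (Fin n)} (hG : MemLp G 2 ν) :
    MemLp (tensorJet α β G) 2 (ν.prod ρ) :=
  ⟨aestronglyMeasurable_tensorJet hα.1 hβ.1 hG.1,
    (eLpNorm_tensorJet_le hα.1 hβ.1 hG.1).trans_lt
      (ENNReal.mul_lt_top hG.2 (ENNReal.add_lt_top.2 ⟨hα.2, hβ.2⟩))⟩

theorem tensor_mem_halfCylinderTest {ψ : Space n → ℝ} (hψ : ψ ∈ CompactlySupported 1 Ω)
    {η : ℝ → ℝ} (hη : ContDiff ℝ 1 η) (hηc : HasCompactSupport η) :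
    (fun z : Space n × ℝ => ψ z.1 * η z.2) ∈ HalfCylinderTest Ω := by
  have hsub : tsupport (fun z : Space n × ℝ => ψ z.1 * η z.2) ⊆ tsupport ψ ×ˢ tsupport η := by
    refine closure_minimal (fun z hz => ?_) ((isClosed_tsupport ψ).prod (isClosed_tsupport η))
    exact ⟨subset_tsupport _ (left_ne_zero_of_mul hz), subset_tsupport _ (right_ne_zero_of_mul hz)⟩
  refine ⟨(hψ.1.comp contDiff_fst).mul (hη.comp contDiff_snd), ?_, fun z hz => ?_⟩
  · exact HasCompactSupport.of_support_subset_isCompact (hψ.2.1.prod hηc)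
      ((subset_tsupport _).trans hsub)
  · exact ⟨hψ.2.2 (hsub hz).1, trivial⟩

theorem jet_tensor {ψ : Space n → ℝ} (hψ : ContDiff ℝ 1 ψ) {η : ℝ → ℝ} (hη : ContDiff ℝ 1 η) :
    jet (cylBasis n) (fun z : Space n × ℝ => ψ z.1 * η z.2)
        (fderiv ℝ fun z : Space n × ℝ => ψ z.1 * η z.2) =
      tensorJet η (deriv η) (jet (spaceBasis n) ψ (fderiv ℝ ψ)) := by
  ext z o
  have h1 : HasFDerivAt (fun z : Space n × ℝ => ψ z.1)
      ((fderiv ℝ ψ z.1).comp (ContinuousLinearMap.fst ℝ _ _)) z :=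
    HasFDerivAt.comp (g := ψ) z (hψ.differentiable one_ne_zero z.1).hasFDerivAt hasFDerivAt_fst
  have h2 : HasFDerivAt (fun z : Space n × ℝ => η z.2)
      (deriv η z.2 • ContinuousLinearMap.snd ℝ (Space n) ℝ) z :=
    HasDerivAt.comp_hasFDerivAt (h₂ := η) z (hη.differentiable one_ne_zero z.2).hasDerivAt
      hasFDerivAt_snd
  have h : fderiv ℝ (fun z : Space n × ℝ => ψ z.1 * η z.2) z = _ := (h1.mul h2).fderiv
  rcases o with _ | i | i
  · simp [mul_comm]
  · simp [h, coe_cylBasis, coordVecCyl, coe_spaceBasis]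
  · simp [h, coe_cylBasis, coordVecCyl, mul_comm]

/-- Dominated convergence in `L²`. -/
theorem tendsto_eLpNorm_of_dominated {α : Type*} [MeasurableSpace α] {ρ : Measure α}
    {f : ℕ → α → ℝ} {bound : α → ℝ} (hf : ∀ m, AEStronglyMeasurable (f m) ρ)
    (hb : MemLp bound 2 ρ) (hle : ∀ m, ∀ᵐ y ∂ρ, ‖f m y‖ ≤ bound y)
    (hlim : ∀ᵐ y ∂ρ, Tendsto (fun m => f m y) atTop (𝓝 0)) :
    Tendsto (fun m => eLpNorm (f m) 2 ρ) atTop (𝓝 0) := by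
  have h : Tendsto (fun m => ∫⁻ y, ‖f m y‖ₑ ^ 2 ∂ρ) atTop (𝓝 (∫⁻ _, 0 ∂ρ)) := by
    refine tendsto_lintegral_of_dominated_convergence' (fun y => ‖bound y‖ₑ ^ 2)
      (fun m => (hf m).enorm.pow_const 2) (fun m => ?_) ?_ ?_
    · filter_upwards [hle m] with y hy
      gcongr
      exact enorm_le_iff_norm_le.2 (hy.trans (le_abs_self _))
    · rw [← eLpNorm_two_sq]
      exact ENNReal.pow_ne_top hb.eLpNorm_ne_top
    · filter_upwards [hlim] with y hy
      have := (ENNReal.continuous_pow 2).tendsto _ |>.comp hy.enorm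
      simpa only [Function.comp_def, enorm_zero, ne_eq, OfNat.ofNat_ne_zero, not_false_eq_true, zero_pow] using this
  rw [lintegral_zero] at h
  simp_rw [← eLpNorm_two_sq] at h
  have h2 := (ENNReal.continuous_rpow_const (y := (1 / 2 : ℝ))).tendsto _ |>.comp h
  rw [ENNReal.zero_rpow_of_pos (by norm_num)] at h2
  refine h2.congr fun m => ?_
  simp only [Function.comp_apply]
  rw [← ENNReal.rpow_natCast, ← ENNReal.rpow_mul]
  norm_num

theorem memLp_exp_halfLine {s : ℝ} (hs : 0 < s) :
    MemLp (fun y => Real.exp (-s * y)) 2 halfLine := by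
  rw [memLp_two_iff_integrable_sq (by fun_prop)]
  refine (integrableOn_exp_mul_Ioi (a := -(2 * s)) (by linarith) 0).congr ?_
  refine Eventually.of_forall fun y => ?_
  simp only [← Real.exp_nat_mul]
  congr 1
  push_cast
  ring

/-- Cutoffs of a decaying exponential, converging in `H¹(0,∞)`. -/
theorem exists_cutoff_exp {s : ℝ} (hs : 0 < s) :
    ∃ η : ℕ → ℝ → ℝ, (∀ m, ContDiff ℝ 1 (η m)) ∧ (∀ m, HasCompactSupport (η m)) ∧
      (∀ m, η m 0 = 1) ∧
      Tendsto (fun m => eLpNorm (fun y => η m y - Real.exp (-s * y)) 2 halfLine) atTop (𝓝 0) ∧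
      Tendsto (fun m => eLpNorm (fun y => deriv (η m) y - -s * Real.exp (-s * y)) 2 halfLine)
        atTop (𝓝 0) := by
  obtain ⟨χ, hχ, hχc, hχone, hχ1⟩ : ∃ χ : ℝ → ℝ, ContDiff ℝ 1 χ ∧ HasCompactSupport χ ∧
      (∀ t ∈ Metric.ball (0 : ℝ) 1, χ t = 1) ∧ ∀ t, |χ t - 1| ≤ 1 := by
    let χ : ContDiffBump (0 : ℝ) := ⟨1, 2, one_pos, one_lt_two⟩
    refine ⟨χ, χ.contDiff, χ.hasCompactSupport, fun t ht =>
      χ.one_of_mem_closedBall (Metric.ball_subset_closedBall ht), fun t => abs_le.2 ⟨?_, ?_⟩⟩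
    · linarith [χ.nonneg (x := t)]
    · linarith [χ.le_one (x := t)]
  have hχd : Continuous (deriv χ) := hχ.continuous_deriv le_rfl
  obtain ⟨C, hC⟩ := hχc.deriv.exists_bound_of_continuous hχd
  have hC0 : 0 ≤ C := (norm_nonneg _).trans (hC 0)
  have hder : ∀ (m : ℕ) y, HasDerivAt (fun y => χ (y / (m + 1)) * Real.exp (-s * y))
      (deriv χ (y / (m + 1)) * (1 / (m + 1)) * Real.exp (-s * y) +
        χ (y / (m + 1)) * (-s * Real.exp (-s * y))) y := by
    intro m y
    have h1 : HasDerivAt (fun y : ℝ => χ (y / (m + 1))) (deriv χ (y / (m + 1)) * (1 / (m + 1))) y :=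
      HasDerivAt.comp (h₂ := χ) (h := fun y : ℝ => y / (m + 1)) y
          (hχ.differentiable one_ne_zero _).hasDerivAt ((hasDerivAt_id y).div_const _)
    have h2 : HasDerivAt (fun y : ℝ => Real.exp (-s * y)) (-s * Real.exp (-s * y)) y := by
      have := ((hasDerivAt_id y).const_mul (-s)).exp
      simpa [mul_comm] using this
    exact h1.mul h2
  have hder' := fun m => funext fun y => (hder m y).deriv
  have hone : ∀ (m : ℕ) (y : ℝ), 0 < y → y < m + 1 → χ (y / (m + 1)) = 1 ∧ deriv χ
      (y / (m + 1)) = 0 := by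
    intro m y h0 hy
    have hm : (0 : ℝ) < m + 1 := by positivity
    have hin : y / (m + 1) ∈ Metric.ball (0 : ℝ) 1 := by
      rw [Metric.mem_ball, dist_zero_right, Real.norm_of_nonneg (by positivity), div_lt_iff₀ hm]
      linarith
    refine ⟨hχone _ hin, ?_⟩
    have h : χ =ᶠ[𝓝 (y / (m + 1))] fun _ => 1 := by
      filter_upwards [Metric.isOpen_ball.mem_nhds hin] with t ht
      exact hχone t ht
    rw [h.deriv_eq, deriv_const]
  have hev : ∀ y : ℝ, ∀ᶠ m : ℕ in atTop, y < m + 1 := fun y => by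
    filter_upwards [(tendsto_natCast_atTop_atTop (R := ℝ)).eventually_gt_atTop y] with m hm
    linarith
  -- The dilated cutoff is 1 for |y| < m + 1, so at each height both errors are eventually zero, and
  -- the value 1 at y = 0 is exact, which leaves traces unchanged.
  refine ⟨fun m y => χ (y / (m + 1)) * Real.exp (-s * y), fun m => ?_, fun m => ?_, fun m => ?_,
    ?_, ?_⟩
  · exact (hχ.comp (contDiff_id.div_const _)).mul (by fun_prop)
  · refine HasCompactSupport.mul_right ?_
    have hm : ((m : ℝ) + 1) ≠ 0 := by positivity
    exact hχc.comp_homeomorph (Homeomorph.mulRight₀ ((m : ℝ) + 1)⁻¹ (by positivity))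
  · have : χ 0 = 1 := hχone 0 (Metric.mem_ball_self one_pos)
    simp [this]
  · refine tendsto_eLpNorm_of_dominated (bound := fun y => Real.exp (-s * y)) (fun m => ?_)
      (memLp_exp_halfLine hs) (fun m => Eventually.of_forall fun y => ?_) ?_
    · exact Continuous.aestronglyMeasurable (by have := hχ.continuous; fun_prop)
    · rw [← sub_one_mul, norm_mul, Real.norm_eq_abs, Real.norm_of_nonneg (Real.exp_pos _).le]
      exact mul_le_of_le_one_left (Real.exp_pos _).le (hχ1 _)
    · filter_upwards [ae_restrict_mem measurableSet_Ioi] with y hy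
      refine tendsto_const_nhds.congr' ?_
      filter_upwards [hev y] with m hm
      rw [(hone m y hy hm).1]
      ring
  · simp only [hder']
    -- C bounds the derivative of χ, whose dilation factor 1 / (m + 1) is at most 1, and |χ - 1| ≤ 1
    -- takes care of the term with s.
    refine tendsto_eLpNorm_of_dominated (bound := fun y => (C + s) * Real.exp (-s * y))
        (fun m => ?_)
      ((memLp_exp_halfLine hs).const_mul _) (fun m => Eventually.of_forall fun y => ?_) ?_
    · exact Continuous.aestronglyMeasurable (by have := hχ.continuous; fun_prop)
    · have heq : deriv χ (y / (m + 1)) * (1 / (m + 1)) * Real.exp (-s * y) +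
          χ (y / (m + 1)) * (-s * Real.exp (-s * y)) - -s * Real.exp (-s * y) =
          (deriv χ (y / (m + 1)) * (1 / (m + 1)) + (χ (y / (m + 1)) - 1) * -s) *
            Real.exp (-s * y) := by ring
      rw [heq, norm_mul, Real.norm_of_nonneg (Real.exp_pos _).le]
      refine mul_le_mul_of_nonneg_right ((norm_add_le _ _).trans (add_le_add ?_ ?_))
        (Real.exp_pos _).le
      · rw [norm_mul]
        have h1 : ‖(1 : ℝ) / (m + 1)‖ ≤ 1 := by
          rw [Real.norm_of_nonneg (by positivity), div_le_one (by positivity)]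
          linarith [(Nat.cast_nonneg m : (0 : ℝ) ≤ m)]
        calc _ ≤ C * 1 := mul_le_mul (hC _) h1 (norm_nonneg _) hC0
          _ = C := mul_one C
      · rw [norm_mul, norm_neg, Real.norm_of_nonneg hs.le, Real.norm_eq_abs]
        exact mul_le_of_le_one_left hs.le (hχ1 _)
    · filter_upwards [ae_restrict_mem measurableSet_Ioi] with y hy
      refine tendsto_const_nhds.congr' ?_
      filter_upwards [hev y] with m hm
      rw [(hone m y hy hm).1, (hone m y hy hm).2]
      ring

end Tensor

/-! ### Exponentially decaying extensions of eigenfunctions -/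

section Extension

variable {n : ℕ} {Ω : Set (Space n)} {ν : Measure (Space n)}

/-- The decaying extension e^{-sy} u is approximated by products of test functions ψ_k → u with
cutoffs of the exponential, so it lies in H¹₀ of the half-cylinder and has trace u. -/
theorem exists_tensor_mem_closure [SFinite ν] (hν : Comparable (volume.restrict Ω) ν)
    {G : Lp (Jet (Fin n)) 2 ν}
    (hG : G ∈ (testJets (spaceBasis n) ∞ contDiff_top_ne_zero Ω ν).topologicalClosure)
    {s : ℝ} (hs : 0 < s) :
    ∃ p ∈ (cylTests Ω ν).topologicalClosure,
      p.fst =ᵐ[ν.prod halfLine]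
        tensorJet (fun y => Real.exp (-s * y)) (fun y => -s * Real.exp (-s * y)) G ∧
      p.snd =ᵐ[ν] fun x => G x none := by
  obtain ⟨x, hx, hlim⟩ := mem_closure_iff_seq_limit.1 hG
  choose ψ hψ hxψ using hx
  obtain ⟨η, hη, hηc, hη0, hlim1, hlim2⟩ := exists_cutoff_exp hs
  have hψ1 : ∀ k, ψ k ∈ CompactlySupported 1 Ω := fun k =>
    ⟨(hψ k).1.of_le (by exact_mod_cast le_top), (hψ k).2⟩
  have he := memLp_exp_halfLine hs
  have he' := he.const_mul (-s)
  have hGm := Lp.memLp G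
  have hw : MemLp (fun x => G x none) 2 ν :=
    (EuclideanSpace.proj (𝕜 := ℝ) (none : Option (Fin n))).comp_memLp' hGm
  have hj : ∀ k, MemLp (jet (spaceBasis n) (ψ k) (fderiv ℝ (ψ k))) 2 ν := fun k =>
    (memLp_congr_ae (hxψ k)).1 (Lp.memLp _)
  have hlimG : Tendsto (fun k => eLpNorm
      (fun x => jet (spaceBasis n) (ψ k) (fderiv ℝ (ψ k)) x - G x) 2 ν) atTop (𝓝 0) := by
    rw [Lp.tendsto_Lp_iff_tendsto_eLpNorm'] at hlim
    exact hlim.congr fun k => eLpNorm_congr_ae ((hxψ k).sub (ae_eq_refl _))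
  refine ⟨_, mem_closure_cylTests_of_tendsto (φ := fun k z => ψ k z.1 * η k z.2) hν
    (fun k => tensor_mem_halfCylinderTest (hψ1 k) (hη k) (hηc k)) (memLp_tensorJet he he' hGm) hw
    ?_ ?_, (memLp_tensorJet he he' hGm).coeFn_toLp, hw.coeFn_toLp⟩
  · have hbound : Tendsto (fun k =>
        (eLpNorm (fun x => jet (spaceBasis n) (ψ k) (fderiv ℝ (ψ k)) x - G x) 2 ν + eLpNorm G 2 ν) *
          (eLpNorm (fun y => η k y - Real.exp (-s * y)) 2 halfLine +
            eLpNorm (fun y => deriv (η k) y - -s * Real.exp (-s * y)) 2 halfLine) +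
        eLpNorm (fun x => jet (spaceBasis n) (ψ k) (fderiv ℝ (ψ k)) x - G x) 2 ν *
          (eLpNorm (fun y => Real.exp (-s * y)) 2 halfLine +
            eLpNorm (fun y => -s * Real.exp (-s * y)) 2 halfLine)) atTop (𝓝 0) := by
      have h1 := ENNReal.Tendsto.mul (hlimG.add_const (eLpNorm G 2 ν))
        (Or.inr (by simp)) (hlim1.add hlim2) (Or.inr (by simpa using hGm.eLpNorm_ne_top))
      have h2 := ENNReal.Tendsto.mul_const (b := eLpNorm (fun y => Real.exp (-s * y)) 2 halfLine +
            eLpNorm (fun y => -s * Real.exp (-s * y)) 2 halfLine) hlimG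
        (Or.inr (ENNReal.add_ne_top.2 ⟨he.eLpNorm_ne_top, he'.eLpNorm_ne_top⟩))
      simpa using h1.add h2
    refine tendsto_of_tendsto_of_tendsto_of_le_of_le tendsto_const_nhds hbound (fun _ => bot_le)
      fun k => ?_
    have hηm : AEStronglyMeasurable (η k) halfLine := (hη k).continuous.aestronglyMeasurable
    have hηm' : AEStronglyMeasurable (deriv (η k)) halfLine :=
      ((hη k).continuous_deriv le_rfl).aestronglyMeasurable
    have hd : AEStronglyMeasurable (fun y => η k y - Real.exp (-s * y)) halfLine := hηm.sub he.1
    have hd' : AEStronglyMeasurable (fun y => deriv (η k) y - -s * Real.exp (-s * y)) halfLine :=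
      hηm'.sub he'.1
    have hm1 := aestronglyMeasurable_tensorJet (ν := ν) hd hd' (hj k).1
    have hm2 := aestronglyMeasurable_tensorJet (ν := ν) he.1 he'.1 ((hj k).1.sub hGm.1)
    -- The error is the cutoff error in y, against the bounded sequence of jets of ψ_k, plus the
    -- error of ψ_k in x against the fixed exponential.
    have hsplit : (fun z => jet (cylBasis n) (fun z : Space n × ℝ => ψ k z.1 * η k z.2)
          (fderiv ℝ fun z : Space n × ℝ => ψ k z.1 * η k z.2) z -
        tensorJet (fun y => Real.exp (-s * y)) (fun y => -s * Real.exp (-s * y)) G z) =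
        tensorJet (fun y => η k y - Real.exp (-s * y))
          (fun y => deriv (η k) y - -s * Real.exp (-s * y))
          (jet (spaceBasis n) (ψ k) (fderiv ℝ (ψ k))) +
        tensorJet (fun y => Real.exp (-s * y)) (fun y => -s * Real.exp (-s * y))
          (fun x => jet (spaceBasis n) (ψ k) (fderiv ℝ (ψ k)) x - G x) := by
      rw [← tensorJet_sub_left, ← tensorJet_sub_right, sub_add_sub_cancel,
        jet_tensor (hψ1 k).1 (hη k)]
      rfl
    rw [hsplit]
    refine (eLpNorm_add_le hm1 hm2 (by norm_num)).trans (add_le_add ?_ ?_)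
    · refine (eLpNorm_tensorJet_le hd hd' (hj k).1).trans ?_
      gcongr
      have := eLpNorm_add_le ((hj k).1.sub hGm.1) hGm.1 (p := 2) (by norm_num)
      rwa [sub_add_cancel] at this
    · exact eLpNorm_tensorJet_le he.1 he'.1 ((hj k).1.sub hGm.1)
  · refine tendsto_of_tendsto_of_tendsto_of_le_of_le tendsto_const_nhds hlimG (fun _ => bot_le)
      fun k => eLpNorm_mono fun x => ?_
    -- Since η_k(0) = 1, the bottom value of the approximant is exactly ψ_k.
    rw [hη0, mul_one]
    exact PiLp.norm_apply_le (jet (spaceBasis n) (ψ k) (fderiv ℝ (ψ k)) x - G x) none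

/-- The integrand is the derivative of -s φ e^{-sy}. The boundary term at y = 0 is the Neumann datum
s of the exponential. -/
theorem integral_vertical {φ : ℝ → ℝ} (hφ : ContDiff ℝ 1 φ) (hc : HasCompactSupport φ) (s : ℝ) :
    ∫ y in Set.Ioi (0 : ℝ), Real.exp (-s * y) * (s ^ 2 * φ y - s * deriv φ y) = s * φ 0 := by
  have hd : Continuous (deriv φ) := hφ.continuous_deriv le_rfl
  have hcont := hφ.continuous
  have hcs : HasCompactSupport (fun y => -(s * φ y * Real.exp (-s * y))) :=
    ((hc.mul_left (f := fun _ => s)).mul_right (f' := fun y => Real.exp (-s * y))).neg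
  have hder : ∀ y ∈ Set.Ici (0 : ℝ), HasDerivAt (fun y => -(s * φ y * Real.exp (-s * y)))
      (Real.exp (-s * y) * (s ^ 2 * φ y - s * deriv φ y)) y := by
    intro y _
    have h1 : HasDerivAt (fun y : ℝ => Real.exp (-s * y)) (-s * Real.exp (-s * y)) y := by
      have := ((hasDerivAt_id y).const_mul (-s)).exp
      simpa [mul_comm] using this
    refine ((((hφ.differentiable one_ne_zero y).hasDerivAt).const_mul s).mul h1).neg.congr_deriv ?_
    ring
  have hint : Integrable (fun y => Real.exp (-s * y) * (s ^ 2 * φ y - s * deriv φ y)) :=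
    Continuous.integrable_of_hasCompactSupport (by fun_prop)
      (((hc.mul_left (f := fun _ => s ^ 2)).sub (hc.deriv.mul_left (f := fun _ => s))).mul_left)
  have hlim : Tendsto (fun y => -(s * φ y * Real.exp (-s * y))) atTop (𝓝 0) :=
    hcs.is_zero_at_infty.mono_left atTop_le_cocompact
  rw [integral_Ioi_of_hasDerivAt_of_tendsto' hder hint.integrableOn hlim]
  simp

/-- The energy pairing of a test function with the decaying extension of an eigenfunction. -/
theorem integral_energyDensity_tensorJet [SFinite ν] (hν : Comparable (volume.restrict Ω) ν)
    {a : Space n → Matrix (Fin n) (Fin n) ℝ} {V : Space n → ℝ} (h : IsEllipticCoef ν a V)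
    {G : Space n → Jet (Fin n)} (hG : MemLp G 2 ν) {s : ℝ} (hs : 0 < s)
    (heig : ∀ ψ ∈ CompactlySupported 1 Ω,
      ∫ x, energyDensity (a x) (V x) (G x) (jet (spaceBasis n) ψ (fderiv ℝ ψ) x) ∂ν =
        s ^ 2 * ∫ x, G x none * ψ x ∂ν)
    {φ : Space n × ℝ → ℝ} (hφ : φ ∈ HalfCylinderTest Ω) :
    ∫ z, energyDensity (Matrix.fromBlocks (a z.1) 0 0 (1 : Matrix Unit Unit ℝ)) (V z.1)
        (tensorJet (fun y => Real.exp (-s * y)) (fun y => -s * Real.exp (-s * y)) G z)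
        (jet (cylBasis n) φ (fderiv ℝ φ) z) ∂(ν.prod halfLine) =
      s * ∫ x, G x none * φ (x, 0) ∂ν := by
  have he := memLp_exp_halfLine hs
  have hT := memLp_tensorJet he (he.const_mul (-s)) hG
  have hJ := HalfCylinderTest.memLp_jet hν hφ
  have hE := h.prod (ρ := halfLine) |>.integrable hT hJ
  have hD : Integrable (fun z : Space n × ℝ => (Real.exp (-s * z.2) * G z.1 none) *
      (s ^ 2 * φ z - s * fderiv ℝ φ z (0, 1))) (ν.prod halfLine) := by
    have h0 := (EuclideanSpace.proj (𝕜 := ℝ) (none : Option (Fin n ⊕ Unit))).comp_memLp' hT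
    have h1 := (EuclideanSpace.proj (𝕜 := ℝ) (none : Option (Fin n ⊕ Unit))).comp_memLp' hJ
    have h2 := (EuclideanSpace.proj (𝕜 := ℝ)
      (some (Sum.inr ()) : Option (Fin n ⊕ Unit))).comp_memLp' hJ
    have h3 := h0.integrable_mul ((h1.const_mul (s ^ 2)).sub (h2.const_mul s))
    refine h3.congr (Eventually.of_forall fun z => ?_)
    simp [coe_cylBasis, coordVecCyl]
  -- The vertical part -s e^{-sy} G₀ ∂_yφ appears on both sides and cancels. What remains at height
  -- y is e^{-sy} times the defect of the eigenvalue equation tested with the slice φ(·, y).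
  have hslice : ∀ x y, energyDensity (Matrix.fromBlocks (a x) 0 0 (1 : Matrix Unit Unit ℝ)) (V x)
        (tensorJet (fun y => Real.exp (-s * y)) (fun y => -s * Real.exp (-s * y)) G (x, y))
        (jet (cylBasis n) φ (fderiv ℝ φ) (x, y)) -
      (Real.exp (-s * y) * G x none) * (s ^ 2 * φ (x, y) - s * fderiv ℝ φ (x, y) (0, 1)) =
      Real.exp (-s * y) * (energyDensity (a x) (V x) (G x)
        (jet (spaceBasis n) (fun x => φ (x, y)) (fderiv ℝ fun x => φ (x, y)) x) -
          s ^ 2 * (G x none * φ (x, y))) := by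
    intro x y
    simp only [energyDensity, Fintype.sum_sum_type, Matrix.fromBlocks_apply₁₁,
      Matrix.fromBlocks_apply₁₂, Matrix.fromBlocks_apply₂₁, Matrix.fromBlocks_apply₂₂,
      tensorJet_none, tensorJet_inl, tensorJet_inr, jet_none, jet_some, fderiv_slice hφ.1,
      coe_cylBasis, coe_spaceBasis, coordVecCyl, Sum.elim_inl, Sum.elim_inr, Matrix.zero_apply,
      Finset.univ_unique, Finset.sum_singleton, zero_mul, Finset.sum_const_zero, add_zero, zero_add,
      Matrix.one_apply_eq, mul_sub, mul_add, Finset.mul_sum]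
    have : ∀ i j, a x i j * (Real.exp (-s * y) * G x (some i)) *
        fderiv ℝ φ (x, y) (coordVec n j, 0) = Real.exp (-s * y) *
          (a x i j * G x (some i) * fderiv ℝ φ (x, y) (coordVec n j, 0)) := fun i j => by ring
    simp only [this]
    ring
  have hzero : ∫ z, (energyDensity (Matrix.fromBlocks (a z.1) 0 0 (1 : Matrix Unit Unit ℝ)) (V z.1)
        (tensorJet (fun y => Real.exp (-s * y)) (fun y => -s * Real.exp (-s * y)) G z)
        (jet (cylBasis n) φ (fderiv ℝ φ) z) -
      (Real.exp (-s * z.2) * G z.1 none) * (s ^ 2 * φ z - s * fderiv ℝ φ z (0, 1)))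
        ∂(ν.prod halfLine) = 0 := by
    -- Integrating in x first, each slice is an admissible test function on Ω, and the defect has
    -- integral zero.
    refine (integral_prod_symm _ (hE.sub hD)).trans
        (integral_eq_zero_of_ae (Eventually.of_forall fun y => ?_))
    simp only [Pi.sub_apply, hslice, Pi.zero_apply]
    have hψ := HalfCylinderTest.slice hφ y
    have hψm := memLp_of_compactlySupported one_ne_zero hν hψ
    have hGn : MemLp (fun x => G x none) 2 ν :=
      (EuclideanSpace.proj (𝕜 := ℝ) (none : Option (Fin n))).comp_memLp' hG
    have hprod : Integrable (fun x => s ^ 2 * (G x none * φ (x, y))) ν :=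
      (hGn.integrable_mul hψm.1).const_mul _
    rw [integral_const_mul, integral_sub (h.integrable hG ((memLp_jet_iff _).2 hψm))
      hprod, integral_const_mul, heig _ hψ, sub_self, mul_zero]
  rw [integral_sub hE hD, sub_eq_zero] at hzero
  -- For the remaining term the y-integral is taken first and evaluated by `integral_vertical`.
  rw [hzero, integral_prod _ hD, ← integral_const_mul]
  refine integral_congr_ae (Eventually.of_forall fun x => ?_)
  have hv := integral_vertical (HalfCylinderTest.contDiff_vertical hφ x)
    (HalfCylinderTest.hasCompactSupport_vertical hφ x) s
  simp only [(hasDerivAt_slice hφ.1 x _).deriv] at hv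
  calc ∫ y, (Real.exp (-s * y) * G x none) * (s ^ 2 * φ (x, y) - s * fderiv ℝ φ (x, y) (0, 1))
        ∂halfLine
      = ∫ y, G x none * (Real.exp (-s * y) *
          (s ^ 2 * φ (x, y) - s * fderiv ℝ φ (x, y) (0, 1))) ∂halfLine :=
        integral_congr_ae (Eventually.of_forall fun y => by simp only; ring)
    _ = G x none * (s * φ (x, 0)) := (integral_const_mul _ _).trans (congrArg _ hv)
    _ = s * (G x none * φ (x, 0)) := by ring

end Extension

/-! ### The Neumann-to-Dirichlet map and the source-to-solution map agree -/

section Main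

open scoped InnerProductSpace

variable {n : ℕ} {Ω : Set (Space n)} {g : Space n → Matrix (Fin n) (Fin n) ℝ} {V : Space n → ℝ}

/-- Slices of test functions on the half-cylinder are only C¹, whereas H¹₀(Ω) is the closure of
smooth functions; mollification bridges the gap and lets the eigenvalue equation be tested with
slices. -/
theorem memH10_of_compactlySupported (hΩ : IsOpen Ω) {ψ : Space n → ℝ}
    (hψ : ψ ∈ CompactlySupported 1 Ω) : MemH10 Ω ψ (fderiv ℝ ψ) := by
  have hcomp : Comparable ((volume : Measure (Space n)).restrict Ω) (volume.restrict Ω) :=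
    ⟨1, ENNReal.one_ne_top, by simp, by simp⟩
  have hm := memLp_of_compactlySupported one_ne_zero hcomp hψ
  exact ⟨⟨hm.1, hm.2, fun χ hχ v => isWeakDifferential_of_contDiff hψ.1 hχ v⟩,
    exists_smooth_tendstoH1 hΩ hψ⟩

/-- The decaying extension of a Dirichlet eigenfunction. -/
theorem IsDirichletEigenbasis.exists_extension [SFinite (riemannianMeasure g Ω)] (hΩ : IsOpen Ω)
    (hν : Comparable (volume.restrict Ω) (riemannianMeasure g Ω))
    (hcoef : IsEllipticCoef (riemannianMeasure g Ω) (fun x => (g x)⁻¹) V)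
    {b : HilbertBasis ℕ ℝ (L2g Ω g)} {lam : ℕ → ℝ} (hbl : IsDirichletEigenbasis Ω g V b lam)
    (k : ℕ) :
    ∃ p ∈ (cylTests Ω (riemannianMeasure g Ω)).topologicalClosure, p.snd = b k ∧
      ∀ q ∈ cylTests Ω (riemannianMeasure g Ω),
        ∫ z, energyDensity (Matrix.fromBlocks (g z.1)⁻¹ 0 0 (1 : Matrix Unit Unit ℝ)) (V z.1)
          (p.fst z) (q.fst z) ∂((riemannianMeasure g Ω).prod halfLine) =
        Real.sqrt (lam k) * ⟪b k, q.snd⟫_ℝ := by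
  obtain ⟨Db, hDb, hk⟩ := hbl.eigen k
  obtain ⟨G, hG, hGb⟩ := (memH10_iff hν).1 hDb
  have hGnone : (fun x => G x none) =ᵐ[riemannianMeasure g Ω] b k := by
    filter_upwards [hGb] with x hx
    rw [hx, jet_none]
  have hs := Real.sqrt_pos.2 (hbl.pos k)
  obtain ⟨p, hp, hp1, hp2⟩ := exists_tensor_mem_closure hν hG hs
  refine ⟨p, hp, Lp.ext (hp2.trans hGnone), ?_⟩
  rintro q ⟨φ, hφ, hq1, hq2⟩
  have hE := integral_energyDensity_tensorJet hν hcoef (Lp.memLp G) hs (fun ψ hψ => by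
    have h1 := hk ψ _ (memH10_of_compactlySupported hΩ hψ)
    rw [← coe_spaceBasis, bilinearForm_eq (spaceBasis n) (Eventually.of_forall fun z => rfl) hGb
      (ae_eq_refl _)] at h1
    rw [h1, Real.sq_sqrt (hbl.pos k).le]
    congr 1
    refine integral_congr_ae ?_
    filter_upwards [hGnone] with x hx
    rw [hx]) hφ
  rw [L2_inner_eq_integral]
  refine Eq.trans (integral_congr_ae ?_) (hE.trans (congrArg _ (integral_congr_ae ?_)))
  · filter_upwards [hp1, hq1] with z h1 h2
    rw [h1, h2]
  · filter_upwards [hGnone, hq2] with x h1 h2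
    rw [h1, h2]

/-- Solution, test function and their traces become points of one closed subspace, so the weak
problem is a variational equation in a Hilbert space with the bottom value as second component. -/
theorem isNDValue_iff (hΩ : IsOpen Ω) (hne : Ω.Nonempty) (hb : Bornology.IsBounded Ω)
    (hg : IsEllipticMetric Ω g) [SFinite (riemannianMeasure g Ω)] {f w : Space n → ℝ} :
    IsNDValue Ω g V f w ↔
      ∃ p ∈ (cylTests Ω (riemannianMeasure g Ω)).topologicalClosure,
        p.snd =ᵐ[riemannianMeasure g Ω] w ∧
        ∀ q ∈ (cylTests Ω (riemannianMeasure g Ω)).topologicalClosure,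
          ∫ z, energyDensity (Matrix.fromBlocks (g z.1)⁻¹ 0 0 (1 : Matrix Unit Unit ℝ)) (V z.1)
            (p.fst z) (q.fst z) ∂((riemannianMeasure g Ω).prod halfLine) =
          ∫ x, f x * q.snd x ∂(riemannianMeasure g Ω) := by
  have hν := hg.comparable hΩ hb hne
  have hμ := riemannianMeasure_extendedMetric hg hΩ
  have hinv : ∀ᵐ z ∂((riemannianMeasure g Ω).prod halfLine),
      (extendedMetric g z)⁻¹ = Matrix.fromBlocks (g z.1)⁻¹ 0 0 1 := by
    filter_upwards [Measure.quasiMeasurePreserving_fst.ae (hν.ae_mem hΩ)] with z hz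
    exact extendedMetric_inv (hg.posDef (subset_closure hz)).det_pos.ne'.isUnit
  have hform : ∀ {u φ : Space n × ℝ → ℝ} {Du Dφ : Space n × ℝ → Space n × ℝ →L[ℝ] ℝ}
      {G G' : Space n × ℝ → Jet (Fin n ⊕ Unit)},
      G =ᵐ[(riemannianMeasure g Ω).prod halfLine] jet (cylBasis n) u Du →
      G' =ᵐ[(riemannianMeasure g Ω).prod halfLine] jet (cylBasis n) φ Dφ →
      bilinearForm (coordVecCyl n) (extendedMetric g) (fun z => V z.1) (halfCylinder Ω) u Du φ Dφ =
        ∫ z, energyDensity (Matrix.fromBlocks (g z.1)⁻¹ 0 0 (1 : Matrix Unit Unit ℝ)) (V z.1)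
            (G z) (G' z) ∂((riemannianMeasure g Ω).prod halfLine) := by
    intro u φ Du Dφ G G' hG hG'
    rw [← hμ] at hG hG' hinv ⊢
    rw [← coe_cylBasis]
    exact bilinearForm_eq (cylBasis n) hinv hG hG'
  constructor
  · rintro ⟨u, Du, ⟨hmem, hsol⟩, htr⟩
    obtain ⟨p, hp, hp1, hp2⟩ := (memH10Cyl_and_hasBottomTrace_iff hν).1 ⟨hmem, htr⟩
    refine ⟨p, hp, hp2, fun q hq => ?_⟩
    obtain ⟨φ, Dφ, hφ⟩ := exists_jet_of_jet (cylBasis n) q.fst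
    have hq1 : q.fst =ᵐ[(riemannianMeasure g Ω).prod halfLine] jet (cylBasis n) φ Dφ := by rw [hφ]
    obtain ⟨h1, h2⟩ := (memH10Cyl_and_hasBottomTrace_iff hν).2 ⟨q, hq, hq1, ae_eq_refl _⟩
    rw [← hform hp1 hq1]
    exact hsol φ Dφ _ h1 h2
  · rintro ⟨p, hp, hp2, hsol⟩
    obtain ⟨u, Du, hu⟩ := exists_jet_of_jet (cylBasis n) p.fst
    have hp1 : p.fst =ᵐ[(riemannianMeasure g Ω).prod halfLine] jet (cylBasis n) u Du := by rw [hu]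
    obtain ⟨h1, h2⟩ := (memH10Cyl_and_hasBottomTrace_iff hν).2 ⟨p, hp, hp1, hp2⟩
    refine ⟨u, Du, ⟨h1, fun φ Dφ w₀ hφ hw₀ => ?_⟩, h2⟩
    obtain ⟨q, hq, hq1, hq2⟩ := (memH10Cyl_and_hasBottomTrace_iff hν).1 ⟨hφ, hw₀⟩
    rw [hform hp1 hq1, hsol q hq]
    refine integral_congr_ae ?_
    filter_upwards [hq2] with x hx
    rw [hx]

/-- Lax–Milgram applied to the energy form, the right-hand side being the pairing of f with the
bottom-value map. Without existence `ndMap` would take its default value 0. -/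
theorem exists_isNDValue (hn : n ≠ 0) (hΩ : IsOpen Ω) (hne : Ω.Nonempty)
    (hb : Bornology.IsBounded Ω) (hg : IsEllipticMetric Ω g) (hV : IsPotential Ω V)
    {f : Space n → ℝ} (hf : MemLp f 2 (riemannianMeasure g Ω)) : ∃ w, IsNDValue Ω g V f w := by
  have hν := hg.comparable hΩ hb hne
  have := finiteMeasure_restrict hb
  have : IsFiniteMeasure (riemannianMeasure g Ω) := hν.isFiniteMeasure
  obtain ⟨B, c, hc, hB, -, hcoer⟩ := exists_cylForm hn hΩ hb hν
    ((hg.isEllipticCoef hV hΩ hb hne).prod (ρ := halfLine))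
  obtain ⟨R, hR, hsol⟩ := exists_solutionOperator B (cylTests Ω (riemannianMeasure g Ω)) hc hcoer
    (WithLp.sndL 2 ℝ _ _)
  refine ⟨_, (isNDValue_iff hΩ hne hb hg).2 ⟨R (hf.toLp f), hR _, ae_eq_refl _, fun q hq => ?_⟩⟩
  rw [← hB, hsol _ q hq, L2_inner_eq_integral]
  refine integral_congr_ae ?_
  filter_upwards [hf.coeFn_toLp] with x hx
  rw [hx]
  rfl

/-- The spectral coefficients of the Neumann-to-Dirichlet map. -/
theorem IsNDValue.exists_coefficients (hn : n ≠ 0) (hΩ : IsOpen Ω) (hne : Ω.Nonempty)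
    (hb : Bornology.IsBounded Ω) (hg : IsEllipticMetric Ω g) (hV : IsPotential Ω V)
    {f w : Space n → ℝ} (h : IsNDValue Ω g V f w) :
    ∃ v : L2g Ω g, v =ᵐ[riemannianMeasure g Ω] w ∧
      ∀ (b : HilbertBasis ℕ ℝ (L2g Ω g)) (lam : ℕ → ℝ), IsDirichletEigenbasis Ω g V b lam →
        ∀ k, lam k ^ (1 / 2 : ℝ) * b.repr v k = ∫ x, f x * b k x ∂(riemannianMeasure g Ω) := by
  have hν := hg.comparable hΩ hb hne
  have := finiteMeasure_restrict hb
  have : IsFiniteMeasure (riemannianMeasure g Ω) := hν.isFiniteMeasure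
  have hcoef := hg.isEllipticCoef hV hΩ hb hne
  obtain ⟨B, c, hc, hB, hBs, hcoer⟩ := exists_cylForm hn hΩ hb hν (hcoef.prod (ρ := halfLine))
  obtain ⟨p, hp, hpw, hsol⟩ := (isNDValue_iff hΩ hne hb hg).1 h
  refine ⟨p.snd, hpw, fun b lam hbl k => ?_⟩
  obtain ⟨q, hq, hqk, hE⟩ := hbl.exists_extension hΩ hν hcoef k
  -- The equation of the decaying extension q is known against test functions; both sides are
  -- continuous, so it holds against the solution p.
  have hcl : IsClosed {r : CylSpace n (riemannianMeasure g Ω) |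
      B q r = Real.sqrt (lam k) * ⟪b k, r.snd⟫_ℝ} :=
    isClosed_eq (B q).continuous
      (continuous_const.mul (continuous_const.inner continuous_snd_cyl))
  have h1 : B q p = Real.sqrt (lam k) * ⟪b k, p.snd⟫_ℝ :=
    closure_minimal (fun r hr => (hB q r).trans (hE r hr)) hcl hp
  -- By symmetry the same pairing is B p q, which the weak equation of p tested with q evaluates as
  -- ∫ f φ_k.
  rw [b.repr_apply_apply, ← Real.sqrt_eq_rpow, ← h1, hBs, hB, hsol q hq, hqk]

/-- Parseval: the series is that of ⟪f, w⟫ and converges for every w in L². Taking w = v gives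
membership in the spectral Sobolev space. -/
theorem isFractionalSolution_of_coefficients {b : HilbertBasis ℕ ℝ (L2g Ω g)} {lam : ℕ → ℝ}
    (hbl : IsDirichletEigenbasis Ω g V b lam) {f : Space n → ℝ}
    (hf : MemLp f 2 (riemannianMeasure g Ω)) {s : ℝ} {v : L2g Ω g}
    (hv : ∀ k, lam k ^ s * b.repr v k = ∫ x, f x * b k x ∂(riemannianMeasure g Ω)) :
    IsFractionalSolution Ω g V s f v := by
  have hint : ∀ w : L2g Ω g, ∫ x, f x * w x ∂(riemannianMeasure g Ω) = ⟪hf.toLp f, w⟫_ℝ := by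
    intro w
    rw [L2_inner_eq_integral]
    refine integral_congr_ae ?_
    filter_upwards [hf.coeFn_toLp] with x hx
    rw [hx]
  have hsum : ∀ w : L2g Ω g, HasSum (fun k => lam k ^ s * b.repr v k * b.repr w k)
      (∫ x, f x * w x ∂(riemannianMeasure g Ω)) := by
    intro w
    rw [hint]
    refine (b.hasSum_inner_mul_inner (hf.toLp f) w).congr_fun fun k => ?_
    rw [hv, hint, b.repr_apply_apply]
  refine ⟨b, lam, hbl, (hsum v).summable.congr fun k => ?_, fun w _ => hsum w⟩
  ring

/-- The equation is tested with the basis vectors. The eigenbasis is hidden in the definition of a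
solution and is returned along with the coefficients. -/
theorem IsFractionalSolution.exists_coefficients {f : Space n → ℝ} {s : ℝ} {v : L2g Ω g}
    (h : IsFractionalSolution Ω g V s f v) :
    ∃ (b : HilbertBasis ℕ ℝ (L2g Ω g)) (lam : ℕ → ℝ), IsDirichletEigenbasis Ω g V b lam ∧
      ∀ k, lam k ^ s * b.repr v k = ∫ x, f x * b k x ∂(riemannianMeasure g Ω) := by
  obtain ⟨b, lam, hbl, -, hsum⟩ := h
  have hrepr : ∀ k j, j ≠ k → b.repr (b k) j = 0 := fun k j hj => by
    rw [b.repr_apply_apply, b.orthonormal.2 hj]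
  have hself : ∀ k, b.repr (b k) k = 1 := fun k => by
    rw [b.repr_apply_apply, real_inner_self_eq_norm_sq, b.orthonormal.1, one_pow]
  refine ⟨b, lam, hbl, fun k => ?_⟩
  have h1 := hsum (b k) (summable_of_ne_finset_zero (s := {k}) fun j hj => by
    rw [hrepr k j (by simpa using hj)]; ring)
  have h2 := hasSum_single (f := fun j => lam j ^ s * b.repr v j * b.repr (b k) j) k
    fun j hj => by rw [hrepr k j hj, mul_zero]
  rw [h1.unique h2, hself, mul_one]

/-- The source-to-solution map of the square root of an elliptic operator is the
Neumann-to-Dirichlet map of its extension to the half-cylinder. -/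
theorem sourceToSolution_ae_eq_ndMap (hn : n ≠ 0) (hΩ : IsOpen Ω) (hne : Ω.Nonempty)
    (hb : Bornology.IsBounded Ω) (hg : IsEllipticMetric Ω g) (hV : IsPotential Ω V)
    {f : Space n → ℝ} (hf : MemLp f 2 (volume.restrict Ω)) :
    sourceToSolution Ω g V f =ᵐ[volume.restrict Ω] ndMap Ω g V f := by
  have hν := hg.comparable hΩ hb hne
  replace hf := hν.memLp hf
  have hex := exists_isNDValue hn hΩ hne hb hg hV hf
  have hnd : IsNDValue Ω g V f (ndMap Ω g V f) := by
    rw [ndMap, dif_pos hex]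
    exact hex.choose_spec
  obtain ⟨v, hvw, hv⟩ := hnd.exists_coefficients hn hΩ hne hb hg hV
  obtain ⟨b, lam, hbl, -⟩ := exists_dirichletEigenbasis hn hΩ hne hb hg hV
  have hex' : ∃ v, IsFractionalSolution Ω g V (1 / 2) f v :=
    ⟨v, isFractionalSolution_of_coefficients hbl hf (hv b lam hbl)⟩
  have hfs : IsFractionalSolution Ω g V (1 / 2) f (sourceToSolution Ω g V f) := by
    rw [sourceToSolution, dif_pos hex']
    exact hex'.choose_spec
  -- The basis behind the chosen solution need not be b. The coefficients of v are known in every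
  -- eigenbasis, so the comparison is made in b', where λ'_k > 0 allows division.
  obtain ⟨b', lam', hbl', hv'⟩ := hfs.exists_coefficients
  have heq : sourceToSolution Ω g V f = v := by
    refine b'.repr.injective (lp.ext (funext fun k => ?_))
    have hpos := Real.rpow_pos_of_pos (hbl'.pos k) (1 / 2)
    exact mul_left_cancel₀ hpos.ne' ((hv' k).trans (hv b' lam' hbl' k).symm)
  rw [heq]
  exact hν.absolutelyContinuous.ae_eq hvw

end Main

end TransversalND

theorem mainTheorem8 (n : ℕ) (hn : 2 ≤ n)
    (Ω Γ : Set (TransversalND.Space n))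
    (hΩ : TransversalND.IsSmoothDomain Ω) (hΩb : Bornology.IsBounded Ω)
    (hΓ : TransversalND.IsSmoothDomain Γ) (hΓΩ : closure Γ ⊆ Ω)
    (hΩΓ : IsConnected (Ω \ closure Γ))
    (g₁ g₂ : TransversalND.Space n → Matrix (Fin n) (Fin n) ℝ)
    (hg₁ : TransversalND.IsEllipticMetric Ω g₁) (hg₂ : TransversalND.IsEllipticMetric Ω g₂)
    (V₁ V₂ : TransversalND.Space n → ℝ)
    (hV₁ : TransversalND.IsPotential Ω V₁) (hV₂ : TransversalND.IsPotential Ω V₂)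
    (hND : ∀ f ∈ TransversalND.CompactlySupported ∞ Γ,
      TransversalND.ndMap Ω g₁ V₁ f =ᵐ[volume.restrict Γ] TransversalND.ndMap Ω g₂ V₂ f) :
    ∀ f ∈ TransversalND.CompactlySupported ∞ Γ,
      (TransversalND.sourceToSolution Ω g₁ V₁ f : TransversalND.Space n → ℝ)
        =ᵐ[volume.restrict Γ] TransversalND.sourceToSolution Ω g₂ V₂ f := by
  intro f hf
  have hΓ' : Γ ⊆ Ω := subset_closure.trans hΓΩ
  have hfm : MemLp f 2 (volume.restrict Ω) :=
    (hf.1.continuous.memLp_of_hasCompactSupport hf.2.1).restrict Ω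
  have hn0 : n ≠ 0 := by lia
  -- For each metric separately the two maps agree on Ω, hence on Γ.
  have h₁ := ae_restrict_of_ae_restrict_of_subset hΓ'
    (TransversalND.sourceToSolution_ae_eq_ndMap hn0 hΩ.isOpen hΩ.isConnected.nonempty hΩb hg₁ hV₁ hfm)
  have h₂ := ae_restrict_of_ae_restrict_of_subset hΓ'
    (TransversalND.sourceToSolution_ae_eq_ndMap hn0 hΩ.isOpen hΩ.isConnected.nonempty hΩb hg₂ hV₂ hfm)
  filter_upwards [h₁, h₂, hND f hf] with x h1 h2 h3
  rw [h1, h2, h3]
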